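/- **Conventions.** A polynomial $p(x)=\sum_{i\le j}a_{ij}x_ix_j+\sum_i b_ix_i+C$ in $n$ variables is called a degree-2 polynomial. $\operatorname{Var}(p)$ is the variance of $p(x)$ for $x\sim\mathcal N(0,1)^n$. $\lambda_{\max}(p)$ is the magnitude $\max_i|\lambda_i(A)|$ of the largest-magnitude eigenvalue of the symmetric matrix $A$ with $A_{ii}=a_{ii}$ and $A_{ij}=A_{ji}=a_{ij}/2$ for $i<j$ (it is $0$ if $n=0$). For a normalized linear form $L(x)=\sum_i w_ix_i$, $\sum_i w_i^2=1$, write $x_i=w_iL(x)+R_i(x)$ with $R_i$ orthogonal to $L$; the residue $\operatorname{Res}(p,L)$ is the part of $p(w_1y+R_1(x),\dots,w_ny+R_n(x))$ that consists of the monomials $y\,x_i$. For a rational $q$, $\langle q\rangle$ is the number of bits of its reduced fraction. Algorithms are programs for a random access machine on integers with logarithmic cost (time is measured in bit operations, up to a polynomial). **Theorem.** There is a deterministic algorithm APPROXIMATE-DECOMPOSE which takes as input (the list of coefficients of) a degree-2 polynomial $p$ in $n$ variables with integer coefficients of absolute value less than $2^b$ and constant term $0$, and rational numbers $\epsilon,\eta>0$,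 which runs in time $$\mathrm{poly}(n,b,1/\epsilon,1/\eta)+\mathrm{poly}(\langle\epsilon\rangle,\langle\eta\rangle),$$ and which has the following guarantee, for all such $n,b,p,\epsilon,\eta$. (a) If $\lambda_{\max}(p)\ge\epsilon\sqrt{\operatorname{Var}(p)}$, the algorithm outputs rational numbers $\lambda_1,\mu_1$ and a polynomial $r(y_1,x_1,\dots,x_n)$ of degree at most $2$ with rational coefficients, containing neither of the monomials $y_1$ and $y_1^2$, such that for $(y_1,x_1,\dots,x_n)\sim\mathcal N(0,1)^{n+1}$ the random variables $p(x_1,\dots,x_n)$ and $\lambda_1y_1^2+\mu_1y_1+r(y_1,x_1,\dots,x_n)$ have the same distribution, and moreover $$\operatorname{Var}(\operatorname{Res}(r,y_1))\le4\eta^2\operatorname{Var}(p),\qquad \operatorname{Var}(r)\le\Bigl(1-\frac{\epsilon^4}{40}\Bigr)\operatorname{Var}(p).$$ (b) If $\lambda_{\max}(p)<\epsilon\sqrt{\operatorname{Var}(p)}$, the algorithm either outputs "small max eigenvalue" or has an output as in (a). -/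

import Mathlib

open MeasureTheory ProbabilityTheory

namespace GaussDecomp

/-! ### A deterministic machine with a logarithmic-cost time measure

Programs act on a memory of integer cells by arithmetic, indirect addressing, branching and loops
(a random access machine with structured control flow).  Every operation is charged by the bit
lengths of the integers that it touches, so that this time measure agrees with Turing machine time
up to a polynomial. -/

/-- `σ a i j` is the content of cell `(i, j)` of array number `a`. -/
abbrev Store := ℕ → ℕ → ℕ → ℤ

/-- Bit length of an integer, sign included. -/
def bitLen (z : ℤ) : ℕ := z.natAbs.size + 1

inductive Op
  | add
  | sub
  | mul
  | div

/-- Division rounds towards minus infinity for positive divisors; division by `0` gives `0`. -/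
def Op.eval : Op → ℤ → ℤ → ℤ
  | .add, x, y => x + y
  | .sub, x, y => x - y
  | .mul, x, y => x * y
  | .div, x, y => x / y

inductive Expr
  | const (z : ℤ)
  | read (a : ℕ) (i j : Expr)
  | op (o : Op) (x y : Expr)

/-- The value of an expression (a negative address is read as `0`). -/
def Expr.val (σ : Store) : Expr → ℤ
  | .const z => z
  | .read a i j => σ a (i.val σ).toNat (j.val σ).toNat
  | .op o x y => o.eval (x.val σ) (y.val σ)

/-- The cost of evaluating an expression: constants and memory accesses are charged by the bit
length of the number obtained, arithmetic operations by the product of the bit lengths of the two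
operands. -/
def Expr.cost (σ : Store) : Expr → ℕ
  | .const z => bitLen z
  | .read a i j => i.cost σ + j.cost σ + bitLen (σ a (i.val σ).toNat (j.val σ).toNat)
  | .op _ x y => x.cost σ + y.cost σ + bitLen (x.val σ) * bitLen (y.val σ)

/-- Programs.  `write a i j e` stores `e` in cell `(i, j)` of array `a`; the conditional and the
loop test whether their expression is positive. -/
inductive Cmd
  | skip
  | write (a : ℕ) (i j e : Expr)
  | seq (c d : Cmd)
  | ite (e : Expr) (c d : Cmd)
  | loop (e : Expr) (c : Cmd)

def Store.set (σ : Store) (a i j : ℕ) (z : ℤ) : Store :=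
  fun a' i' j' => if a' = a ∧ i' = i ∧ j' = j then z else σ a' i' j'

/-- `Exec c σ t σ'`: started in `σ`, the program `c` halts after time `t` with final store `σ'`. -/
inductive Exec : Cmd → Store → ℕ → Store → Prop
  | skip (σ : Store) : Exec .skip σ 1 σ
  | write (a : ℕ) (i j e : Expr) (σ : Store) :
      Exec (.write a i j e) σ (i.cost σ + j.cost σ + e.cost σ + 1)
        (σ.set a (i.val σ).toNat (j.val σ).toNat (e.val σ))
  | seq {c d : Cmd} {σ σ' σ'' : Store} {t t' : ℕ} :
      Exec c σ t σ' → Exec d σ' t' σ'' → Exec (.seq c d) σ (t + t') σ''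
  | ite_pos {e : Expr} {c d : Cmd} {σ σ' : Store} {t : ℕ} :
      0 < e.val σ → Exec c σ t σ' → Exec (.ite e c d) σ (e.cost σ + 1 + t) σ'
  | ite_neg {e : Expr} {c d : Cmd} {σ σ' : Store} {t : ℕ} :
      ¬ 0 < e.val σ → Exec d σ t σ' → Exec (.ite e c d) σ (e.cost σ + 1 + t) σ'
  | loop_pos {e : Expr} {c : Cmd} {σ σ' σ'' : Store} {t t' : ℕ} :
      0 < e.val σ → Exec c σ t σ' → Exec (.loop e c) σ' t' σ'' →
        Exec (.loop e c) σ (e.cost σ + 1 + t + t') σ''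
  | loop_neg {e : Expr} {c : Cmd} {σ : Store} :
      ¬ 0 < e.val σ → Exec (.loop e c) σ (e.cost σ + 1) σ

/-- The machine is deterministic: final store and running time are determined by the program and
the initial store. -/
theorem Exec.deterministic {c : Cmd} {σ σ₁ : Store} {t₁ : ℕ} (h₁ : Exec c σ t₁ σ₁) :
    ∀ {t₂ : ℕ} {σ₂ : Store}, Exec c σ t₂ σ₂ → t₁ = t₂ ∧ σ₁ = σ₂ := by
  induction h₁ with
  | skip σ => intro t₂ σ₂ h; cases h; exact ⟨rfl, rfl⟩
  | write a i j e σ => intro t₂ σ₂ h; cases h; exact ⟨rfl, rfl⟩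
  | seq _ _ ih ih' =>
    intro t₂ σ₂ h
    cases h with
    | seq g g' =>
      obtain ⟨rfl, rfl⟩ := ih g
      obtain ⟨rfl, rfl⟩ := ih' g'
      exact ⟨rfl, rfl⟩
  | ite_pos hp _ ih =>
    intro t₂ σ₂ h
    cases h with
    | ite_pos _ g => obtain ⟨rfl, rfl⟩ := ih g; exact ⟨rfl, rfl⟩
    | ite_neg hn _ => exact absurd hp hn
  | ite_neg hn _ ih =>
    intro t₂ σ₂ h
    cases h with
    | ite_pos hp _ => exact absurd hp hn
    | ite_neg _ g => obtain ⟨rfl, rfl⟩ := ih g; exact ⟨rfl, rfl⟩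
  | loop_pos hp _ _ ih ih' =>
    intro t₂ σ₂ h
    cases h with
    | loop_pos _ g g' =>
      obtain ⟨rfl, rfl⟩ := ih g
      obtain ⟨rfl, rfl⟩ := ih' g'
      exact ⟨rfl, rfl⟩
    | loop_neg hn => exact absurd hp hn
  | loop_neg hn =>
    intro t₂ σ₂ h
    cases h with
    | loop_pos hp _ _ => exact absurd hp hn
    | loop_neg _ => exact ⟨rfl, rfl⟩

/-! ### Polynomials in Gaussian variables -/

noncomputable section

/-- The exponent vector of the monomial `x_i x_j` (of `x_i ^ 2` if `i = j`). -/
def pairExp {m : ℕ} (i j : Fin m) : Fin m →₀ ℕ := Finsupp.single i 1 + Finsupp.single j 1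

/-- The law `N(0,1)^m` of `m` independent standard Gaussians. -/
def gauss (m : ℕ) : Measure (Fin m → ℝ) := Measure.pi fun _ => gaussianReal 0 1

/-- The distribution of `p(x)` for `x ∼ N(0,1)^m`. -/
def law {m : ℕ} (p : MvPolynomial (Fin m) ℝ) : Measure ℝ :=
  (gauss m).map fun x => MvPolynomial.eval x p

/-- The variance of `p(x)` for `x ∼ N(0,1)^m`. -/
def polyVar {m : ℕ} (p : MvPolynomial (Fin m) ℝ) : ℝ :=
  variance (fun x => MvPolynomial.eval x p) (gauss m)

/-- The symmetric matrix of the quadratic part of `p`. -/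
def quadMatrix {m : ℕ} (p : MvPolynomial (Fin m) ℝ) : Matrix (Fin m) (Fin m) ℝ :=
  Matrix.of fun i j =>
    if i = j then p.coeff (pairExp i j) else p.coeff (pairExp i j) / 2

/-- The magnitude of the largest-magnitude eigenvalue of the quadratic part of `p`
(which is `0` when there are no variables). -/
def lambdaMax {m : ℕ} (p : MvPolynomial (Fin m) ℝ) : ℝ :=
  sSup {t : ℝ | ∃ μ : ℝ, Module.End.HasEigenvalue (Matrix.toLin' (quadMatrix p)) μ ∧ t = |μ|}

/-- For the linear form `L(x) = ∑ w_j x_j` with `∑ w_j ^ 2 = 1`, one has `x_i = w_i L(x) + R_i(x)`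
with `R_i(x) = x_i - w_i L(x)` orthogonal to `L`.  This is the polynomial
`q(y, x) = p(w_1 y + R_1(x), …, w_m y + R_m(x))`; variable `0` is `y`, variable `i + 1` is `x_i`. -/
def splitAlong {m : ℕ} (w : Fin m → ℝ) (p : MvPolynomial (Fin m) ℝ) :
    MvPolynomial (Fin (m + 1)) ℝ :=
  MvPolynomial.aeval
    (fun i : Fin m =>
      MvPolynomial.C (w i) * MvPolynomial.X 0 +
        (MvPolynomial.X i.succ -
          MvPolynomial.C (w i) * ∑ j, MvPolynomial.C (w j) * MvPolynomial.X j.succ)) p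

/-- The residue of `p` with respect to the normalized linear form with coefficient vector `w`:
the part of `splitAlong w p` consisting of the multilinear monomials of degree two that contain
`y`, that is, of the monomials `y x_i`. -/
def residue {m : ℕ} (w : Fin m → ℝ) (p : MvPolynomial (Fin m) ℝ) :
    MvPolynomial (Fin (m + 1)) ℝ :=
  ∑ i : Fin m, MvPolynomial.monomial (pairExp 0 i.succ) ((splitAlong w p).coeff (pairExp 0 i.succ))

/-- The guarantee on the numbers `lam`, `mu` and the polynomial `r(y, x_1, …, x_n)` (variable `0`
is `y`, variable `i + 1` is `x_i`) that are produced for `p`. -/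
structure IsDecomposition {n : ℕ} (p : MvPolynomial (Fin n) ℝ) (ε η lam mu : ℝ)
    (r : MvPolynomial (Fin (n + 1)) ℝ) : Prop where
  degree_le : r.totalDegree ≤ 2
  /-- The monomials `y` and `y ^ 2` are those split off, so that `y` occurs in `r` only in cross
  terms. -/
  coeff_y : r.coeff (Finsupp.single 0 1) = 0
  coeff_yy : r.coeff (Finsupp.single 0 2) = 0
  law_eq : law (MvPolynomial.C lam * MvPolynomial.X 0 ^ 2 + MvPolynomial.C mu * MvPolynomial.X 0
    + r) = law p
  var_residue_le : polyVar (residue (Pi.single 0 1) r) ≤ 4 * η ^ 2 * polyVar p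
  var_le : polyVar r ≤ (1 - ε ^ 4 / 40) * polyVar p

/-! ### Input and output -/

/-- The explicit description of the input: array `0` holds the number of variables and the reduced
fractions `ε` and `η`; arrays `1` and `2` hold the coefficients of the monomials `x_i x_j` and `x_i`
of `p`; all other cells are `0`. -/
def inputStore {n : ℕ} (p : MvPolynomial (Fin n) ℤ) (ε η : ℚ) : Store
  | 0, 0, 0 => n
  | 0, 1, 0 => ε.num
  | 0, 2, 0 => ε.den
  | 0, 3, 0 => η.num
  | 0, 4, 0 => η.den
  | 1, i, j => if h : i < n ∧ j < n then p.coeff (pairExp ⟨i, h.1⟩ ⟨j, h.2⟩) else 0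
  | 2, i, 0 => if h : i < n then p.coeff (Finsupp.single ⟨i, h⟩ 1) else 0
  | _, _, _ => 0

inductive Output (n : ℕ)
  | smallMaxEigenvalue
  | decomposition (lam mu : ℚ) (r : MvPolynomial (Fin (n + 1)) ℚ)

/-- Reading off the output.  Cell `(0, 0)` of array `3` is `0` for the answer
"small max eigenvalue"; otherwise it is a common denominator of the rational numbers in the output,
whose numerators are in the other cells of array `3` (for `λ`, `μ` and the constant term of `r`)
and in arrays `4` and `5` (for the coefficients of the quadratic and the linear monomials of `r`). -/
def readOutput (n : ℕ) (σ : Store) : Output n :=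
  if σ 3 0 0 = 0 then .smallMaxEigenvalue
  else
    .decomposition ((σ 3 1 0 : ℚ) / σ 3 0 0) ((σ 3 2 0 : ℚ) / σ 3 0 0)
      ((∑ i : Fin (n + 1), ∑ j : Fin (n + 1) with i ≤ j,
          MvPolynomial.monomial (pairExp i j) ((σ 4 i j : ℚ) / σ 3 0 0))
        + (∑ i : Fin (n + 1),
          MvPolynomial.monomial (Finsupp.single i 1) ((σ 5 i 0 : ℚ) / σ 3 0 0))
        + MvPolynomial.C ((σ 3 3 0 : ℚ) / σ 3 0 0))

/-- The output consists of numbers and a polynomial with the guarantee `IsDecomposition`. -/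
def Output.IsGood {n : ℕ} (p : MvPolynomial (Fin n) ℝ) (ε η : ℝ) (out : Output n) : Prop :=
  ∃ (lam mu : ℚ) (r : MvPolynomial (Fin (n + 1)) ℚ), out = .decomposition lam mu r ∧
    IsDecomposition p ε η lam mu (MvPolynomial.map (algebraMap ℚ ℝ) r)

/-- The number of bits of the reduced fraction `q`. -/
def ratBits (q : ℚ) : ℕ := bitLen q.num + bitLen q.den

end

end GaussDecomp

/-! Let B be twice the symmetric matrix of the quadratic part, so p(x) = x·Bx/2 + b·x. For a unit
vector w, the substitution x ↦ x + (y - w·x) w carries N(0,1)^(n+1) to N(0,1)^n. It turns p into a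
polynomial of the same law with y²-coefficient h/2, h = w·Bw, with y-coefficient β = b·w, and with
the entries of Bw - hw as coefficients of the y x_i. Distinct monomials of degree at most two are
uncorrelated, so the residue has variance |Bw|² - h² and Var(r) = Var(p) - h²/2 - β². It therefore
suffices to find a unit vector with |Bw|² - h² ≤ 4η² Var(p) and h²/2 ≥ ε⁴ Var(p)/40
(`isDecomposition_of_unit`).

For rational w both conditions are inequalities between integers. The program tests them exactly and
outputs only vectors that pass, so every decomposition it outputs is correct (`isGood_readOutput`).
What remains is that some candidate passes when the top eigenvalue is large (`exists_acc`).

Candidates come from the power method for M = s + B and M = s - B, where s = ∑|B_ij| makes both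
matrices positive semidefinite. It is started at a multiple of each coordinate vector, one of which
overlaps well with the wanted eigenvector. No spectral gap is available. Instead the moments m_j =
e·M^j e are log-convex, so the ratios m_(j+1)/m_j increase and stay below 2s; among many consecutive
steps one has a small increment, and there the iterate is nearly an eigenvector
(`exists_approx_eigenvector`). Enough initial steps force its Rayleigh quotient to be large
(`exists_good_iterate`).

Normalizing an iterate v would leave the rationals. A reflection produces a rational vector of
length exactly 1 close to v/|v| (`reflVec`), and the start vector is scaled up by Q to make this
error negligible.

The iterates are integer vectors and are never rounded. Their bit lengths grow linearly with the
number of steps, which is polynomial in n, 1/ε, 1/η. The time bound comes from step-counting triples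
`Runs` together with bit bounds `beta` for each array (`runs_decomposeCmd`, `time_le`). -/

/-! ### Gaussian moments and the variance of a polynomial of degree at most two. -/

namespace GaussDecomp

/-- The moments of the standard Gaussian. -/
noncomputable def gmom (k : ℕ) : ℝ := ∫ x, x ^ k ∂(gaussianReal 0 1)

theorem integrable_pow_gaussian (k : ℕ) : Integrable (fun x : ℝ => x ^ k) (gaussianReal 0 1) := by
  have h := (memLp_id_gaussianReal (μ := 0) (v := 1) k).integrable_norm_pow'
  refine h.mono' (by fun_prop) (ae_of_all _ fun x => ?_)
  simp

theorem gmom_odd {k : ℕ} (hk : Odd k) : gmom k = 0 := by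
  have h : gmom k = - gmom k := by
    unfold gmom
    conv_lhs => rw [show gaussianReal 0 1 = (gaussianReal 0 1).map (fun x => -x) by
      rw [gaussianReal_map_neg]; simp]
    rw [integral_map (by fun_prop) (by fun_prop), ← integral_neg]
    simp [hk.neg_pow]
  linarith

theorem gmom_zero : gmom 0 = 1 := by simp [gmom]

theorem gmom_eq_iteratedDeriv (k : ℕ) :
    gmom k = iteratedDeriv k (fun t : ℝ => Real.exp (t ^ 2 / 2)) 0 := by
  have h := iteratedDeriv_mgf_zero (X := id) (μ := gaussianReal 0 1)
    (by rw [integrableExpSet_id_gaussianReal]; simp) k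
  rw [mgf_id_gaussianReal] at h
  simp only [zero_mul, NNReal.coe_one, one_mul, zero_add] at h
  rw [h]; rfl

theorem gmom_two_four : gmom 2 = 1 ∧ gmom 4 = 3 := by
  have key (f g : ℝ → ℝ) (hf : ∀ t, HasDerivAt f (g t) t) :
      deriv (fun t => f t * Real.exp (t ^ 2 / 2)) =
        fun t => (g t + t * f t) * Real.exp (t ^ 2 / 2) := by
    ext t
    have h1 : HasDerivAt (fun t : ℝ => Real.exp (t ^ 2 / 2)) (Real.exp (t ^ 2 / 2) * t) t := by
      have := ((hasDerivAt_pow 2 t).div_const 2).exp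
      convert this using 1
      simp
    have := ((hf t).mul h1).deriv
    simp only [Pi.mul_def] at this
    rw [this]; ring
  have d1 : deriv (fun t : ℝ => Real.exp (t ^ 2 / 2)) = fun t => t * Real.exp (t ^ 2 / 2) := by
    simpa using key (fun _ => 1) (fun _ => 0) (fun t => hasDerivAt_const t 1)
  have d2 : deriv (fun t : ℝ => t * Real.exp (t ^ 2 / 2)) =
      fun t => (1 + t * t) * Real.exp (t ^ 2 / 2) := key (fun t => t) (fun _ => 1) hasDerivAt_id
  have d3 : deriv (fun t : ℝ => (1 + t * t) * Real.exp (t ^ 2 / 2)) =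
      fun t => ((t + t) + t * (1 + t * t)) * Real.exp (t ^ 2 / 2) :=
    key _ (fun t => t + t) (fun t => by
      simpa using ((hasDerivAt_id t).mul (hasDerivAt_id t)).const_add 1)
  have d4 : deriv (fun t : ℝ => ((t + t) + t * (1 + t * t)) * Real.exp (t ^ 2 / 2)) =
      fun t => ((1 + 1) + (1 * (1 + t * t) + t * (t + t)) + t * ((t + t) + t * (1 + t * t)))
        * Real.exp (t ^ 2 / 2) :=
    key _ (fun t => (1 + 1) + (1 * (1 + t * t) + t * (t + t))) (fun t =>
      ((hasDerivAt_id t).add (hasDerivAt_id t)).add ((hasDerivAt_id t).mul (by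
        simpa using ((hasDerivAt_id t).mul (hasDerivAt_id t)).const_add 1)))
  rw [gmom_eq_iteratedDeriv, gmom_eq_iteratedDeriv]
  simp only [iteratedDeriv_succ, iteratedDeriv_zero, d1, d2, d3, d4]
  norm_num

/-- The expectation of the monomial with exponent vector `e` under `N(0,1)^m`. -/
noncomputable def gmonom {m : ℕ} (e : Fin m →₀ ℕ) : ℝ := ∏ i, gmom (e i)

theorem monomial_gauss {m : ℕ} (e : Fin m →₀ ℕ) :
    Integrable (fun x : Fin m → ℝ => ∏ i, x i ^ e i) (gauss m) ∧
      ∫ x, ∏ i, x i ^ e i ∂(gauss m) = gmonom e :=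
  ⟨Integrable.fintype_prod (f := fun i x => x ^ e i) fun i => integrable_pow_gaussian (e i),
    integral_fintype_prod_eq_prod (fun i (x : ℝ) => x ^ e i)⟩

instance isProbabilityMeasure_gauss (m : ℕ) : IsProbabilityMeasure (gauss m) := by
  unfold gauss; infer_instance

theorem integrable_eval_gauss {m : ℕ} (p : MvPolynomial (Fin m) ℝ) :
    Integrable (fun x => MvPolynomial.eval x p) (gauss m) := by
  simp only [MvPolynomial.eval_eq']
  exact integrable_finsetSum _ fun e _ => (monomial_gauss e).1.const_mul _

theorem integral_eval_gauss {m : ℕ} (p : MvPolynomial (Fin m) ℝ) :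
    ∫ x, MvPolynomial.eval x p ∂(gauss m) = ∑ e ∈ p.support, p.coeff e * gmonom e := by
  simp only [MvPolynomial.eval_eq']
  rw [integral_finsetSum _ fun e _ => (monomial_gauss e).1.const_mul _]
  exact Finset.sum_congr rfl fun e _ => by rw [integral_const_mul, (monomial_gauss e).2]

theorem integral_eval_mul_gauss {m : ℕ} (p q : MvPolynomial (Fin m) ℝ) :
    ∫ x, MvPolynomial.eval x p * MvPolynomial.eval x q ∂(gauss m) =
      ∑ e ∈ p.support, ∑ f ∈ q.support, p.coeff e * q.coeff f * gmonom (e + f) := by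
  have h (x : Fin m → ℝ) : MvPolynomial.eval x p * MvPolynomial.eval x q =
      ∑ e ∈ p.support, ∑ f ∈ q.support, p.coeff e * q.coeff f * ∏ i, x i ^ (e + f) i := by
    rw [MvPolynomial.eval_eq', MvPolynomial.eval_eq', Finset.sum_mul_sum]
    refine Finset.sum_congr rfl fun e _ => Finset.sum_congr rfl fun f _ => ?_
    simp only [Finsupp.add_apply, pow_add, Finset.prod_mul_distrib]
    ring
  simp only [h]
  rw [integral_finsetSum _ fun e _ => integrable_finsetSum _ fun f _ =>
    (monomial_gauss (e + f)).1.const_mul _]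
  refine Finset.sum_congr rfl fun e _ => ?_
  rw [integral_finsetSum _ fun f _ => (monomial_gauss (e + f)).1.const_mul _]
  exact Finset.sum_congr rfl fun f _ => by rw [integral_const_mul, (monomial_gauss _).2]

/-- The covariance of two monomials under `N(0,1)^m`. -/
noncomputable def gcov {m : ℕ} (e f : Fin m →₀ ℕ) : ℝ := gmonom (e + f) - gmonom e * gmonom f

theorem polyVar_eq_sum_gcov {m : ℕ} (p : MvPolynomial (Fin m) ℝ) :
    polyVar p = ∑ e ∈ p.support, ∑ f ∈ p.support, p.coeff e * p.coeff f * gcov e f := by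
  have hL : MemLp (fun x => MvPolynomial.eval x p) 2 (gauss m) := by
    rw [memLp_two_iff_integrable_sq (integrable_eval_gauss p).1]
    exact (integrable_eval_gauss (p ^ 2)).congr (ae_of_all _ fun x => map_pow _ _ _)
  have h2 := integral_eval_mul_gauss p p
  rw [polyVar, variance_eq_sub hL]
  simp only [Pi.pow_apply, pow_two]
  rw [h2, integral_eval_gauss, Finset.sum_mul_sum, ← Finset.sum_sub_distrib]
  refine Finset.sum_congr rfl fun e _ => ?_
  rw [← Finset.sum_sub_distrib]
  exact Finset.sum_congr rfl fun f _ => by unfold gcov; ring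

theorem gmonom_eq_zero_of_odd {m : ℕ} {e : Fin m →₀ ℕ} {i : Fin m} (h : Odd (e i)) :
    gmonom e = 0 := Finset.prod_eq_zero (Finset.mem_univ i) (gmom_odd h)

theorem add_le_degree {m : ℕ} (e : Fin m →₀ ℕ) {i j : Fin m} (h : i ≠ j) :
    e i + e j ≤ e.degree := by
  rw [Finsupp.degree_eq_sum]
  rw [← Finset.sum_pair h]
  exact Finset.sum_le_sum_of_subset (Finset.subset_univ _)

/-- Distinct monomials of degree at most two are uncorrelated. -/
theorem gcov_eq_zero {m : ℕ} {e f : Fin m →₀ ℕ} (he : e.degree ≤ 2) (hf : f.degree ≤ 2)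
    (hne : e ≠ f) : gcov e f = 0 := by
  have hdisj (h : ∀ i, e i = 0 ∨ f i = 0) : gcov e f = 0 := by
    rw [gcov, sub_eq_zero, gmonom, gmonom, gmonom, ← Finset.prod_mul_distrib]
    refine Finset.prod_congr rfl fun i _ => ?_
    rcases h i with h | h <;> simp [h, gmom_zero]
  -- An odd exponent of e + f is odd in exactly one of e and f, so both terms of the covariance
  -- vanish.
  by_cases hodd : ∃ i, Odd (e i + f i)
  · obtain ⟨i, hi⟩ := hodd
    rw [gcov, gmonom_eq_zero_of_odd (e := e + f) (i := i) (by simpa using hi), zero_sub, neg_eq_zero]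
    rcases Nat.even_or_odd (e i) with h | h
    · rw [gmonom_eq_zero_of_odd (e := f) (i := i), mul_zero]
      rcases h with ⟨a, ha⟩; rcases hi with ⟨b, hb⟩; exact ⟨b - a, by omega⟩
    · rw [gmonom_eq_zero_of_odd h, zero_mul]
  -- All exponents of e + f are even. Where e and f differ, the exponents must be 0 and 2, so one
  -- monomial is x_j² and the other is free of x_j: the supports are disjoint and the monomials
  -- independent.
  · push Not at hodd
    obtain ⟨j, hj⟩ := Finsupp.ne_iff.1 hne
    apply hdisj
    intro i
    have hpar (i) : (e i + f i) % 2 = 0 := by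
      have := hodd i; rw [Nat.odd_iff] at this; omega
    have h1 := hpar j
    have hej := (Finsupp.le_degree j e).trans he
    have hfj := (Finsupp.le_degree j f).trans hf
    by_cases hij : i = j
    · subst hij; omega
    · have h2 := (add_le_degree e hij).trans he
      have h3 := (add_le_degree f hij).trans hf
      have := hpar i
      omega

theorem polyVar_eq_sum {m : ℕ} {p : MvPolynomial (Fin m) ℝ} (hp : p.totalDegree ≤ 2)
    {S : Finset (Fin m →₀ ℕ)} (hS : p.support ⊆ S) :
    polyVar p = ∑ e ∈ S, p.coeff e ^ 2 * gcov e e := by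
  have hdeg {e} (he : e ∈ p.support) : e.degree ≤ 2 := by
    refine le_trans ?_ hp
    exact MvPolynomial.le_totalDegree he
  rw [polyVar_eq_sum_gcov]
  rw [← Finset.sum_subset hS (f := fun e => p.coeff e ^ 2 * gcov e e)
    (by intro e _ he; simp [MvPolynomial.notMem_support_iff.1 he])]
  refine Finset.sum_congr rfl fun e he => ?_
  rw [Finset.sum_eq_single_of_mem e he, pow_two]
  intro f hf hne
  rw [gcov_eq_zero (hdeg he) (hdeg hf) hne.symm, mul_zero]

end GaussDecomp

/-! ### Polynomials of degree at most two in terms of their coefficients. -/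

namespace GaussDecomp

theorem pairExp_comm {m : ℕ} (i j : Fin m) : pairExp i j = pairExp j i := add_comm _ _

theorem degree_pairExp {m : ℕ} (i j : Fin m) : (pairExp i j).degree = 2 := by
  simp [pairExp, map_add]

theorem pairExp_inj {m : ℕ} {i j k l : Fin m} (h : i ≤ j) (h' : k ≤ l) :
    pairExp i j = pairExp k l ↔ i = k ∧ j = l := by
  refine ⟨fun h0 => ?_, fun h0 => by rw [h0.1, h0.2]⟩
  have := (Finsupp.single_add_single_eq_single_add_single (one_ne_zero) (one_ne_zero)).1 h0
  omega

theorem exp_cases {m : ℕ} {e : Fin m →₀ ℕ} (he : e.degree ≤ 2) :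
    e = 0 ∨ (∃ i, e = Finsupp.single i 1) ∨ ∃ i j, i ≤ j ∧ e = pairExp i j := by
  have peel (e : Fin m →₀ ℕ) (h : e ≠ 0) : ∃ i e', e = Finsupp.single i 1 + e' ∧
      e.degree = e'.degree + 1 := by
    obtain ⟨i, hi⟩ := Finsupp.ne_iff.1 h
    have : e = Finsupp.single i 1 + (e - Finsupp.single i 1) := by
      rw [add_tsub_cancel_of_le]
      rw [Finsupp.single_le_iff]
      simp at hi; omega
    refine ⟨i, _, this, ?_⟩
    conv_lhs => rw [this]
    rw [map_add, Finsupp.degree_single, add_comm]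
  by_cases h0 : e = 0
  · exact Or.inl h0
  obtain ⟨i, e1, h1, d1⟩ := peel e h0
  by_cases h0' : e1 = 0
  · right; left; exact ⟨i, by rw [h1, h0', add_zero]⟩
  obtain ⟨j, e2, h2, d2⟩ := peel e1 h0'
  have h3 : e2 = 0 := by rw [← Finsupp.degree_eq_zero_iff]; omega
  right; right
  rw [h1, h2, h3, add_zero]
  rcases le_total i j with h | h
  · exact ⟨i, j, h, rfl⟩
  · exact ⟨j, i, h, add_comm _ _⟩

section
variable {R : Type*} [CommRing R] {m : ℕ}

/-- The polynomial of degree at most two with given coefficients. -/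
noncomputable def quadPoly (A : Fin m → Fin m → R) (b : Fin m → R) (c : R) :
    MvPolynomial (Fin m) R :=
  (∑ i : Fin m, ∑ j : Fin m with i ≤ j, MvPolynomial.monomial (pairExp i j) (A i j))
    + (∑ i : Fin m, MvPolynomial.monomial (Finsupp.single i 1) (b i)) + MvPolynomial.C c

theorem pairExp_ne_single {i j k : Fin m} : pairExp i j ≠ Finsupp.single k 1 := by
  intro h
  have := congrArg Finsupp.degree h
  rw [degree_pairExp, Finsupp.degree_single] at this
  omega

theorem pairExp_ne_zero {i j : Fin m} : pairExp i j ≠ 0 := by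
  intro h
  have := congrArg Finsupp.degree h
  simp [degree_pairExp] at this

theorem coeff_quadPoly_pair (A : Fin m → Fin m → R) (b : Fin m → R) (c : R) {i j : Fin m}
    (h : i ≤ j) : (quadPoly A b c).coeff (pairExp i j) = A i j := by
  classical
  have h1 (k l : Fin m) (hl : k ≤ l) : (MvPolynomial.monomial (pairExp k l) (A k l)).coeff
      (pairExp i j) = if k = i ∧ l = j then A k l else 0 := by
    rw [MvPolynomial.coeff_monomial]; simp only [pairExp_inj hl h]
  simp only [quadPoly, MvPolynomial.coeff_add, MvPolynomial.coeff_sum]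
  rw [Finset.sum_eq_single i, Finset.sum_eq_single j, h1 i j h]
  · simp [MvPolynomial.coeff_monomial, pairExp_ne_single.symm, MvPolynomial.coeff_C,
      pairExp_ne_zero.symm]
  · intro l hl hne; rw [h1 i l (Finset.mem_filter.1 hl).2]; simp [hne]
  · intro hn; exact absurd (by simpa using h) hn
  · intro k _ hne; refine Finset.sum_eq_zero fun l hl => ?_
    rw [h1 k l (Finset.mem_filter.1 hl).2]; simp [hne]
  · simp

theorem coeff_quadPoly_single (A : Fin m → Fin m → R) (b : Fin m → R) (c : R) (i : Fin m) :
    (quadPoly A b c).coeff (Finsupp.single i 1) = b i := by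
  classical
  simp [quadPoly, MvPolynomial.coeff_sum, MvPolynomial.coeff_monomial, pairExp_ne_single,
    MvPolynomial.coeff_C, Finsupp.single_left_inj, (Finsupp.single_ne_zero.2 one_ne_zero).symm]

theorem coeff_quadPoly_zero (A : Fin m → Fin m → R) (b : Fin m → R) (c : R) :
    (quadPoly A b c).coeff 0 = c := by
  classical
  simp [quadPoly, MvPolynomial.coeff_sum, MvPolynomial.coeff_monomial, pairExp_ne_zero]

theorem totalDegree_quadPoly_le (A : Fin m → Fin m → R) (b : Fin m → R) (c : R) :
    (quadPoly A b c).totalDegree ≤ 2 := by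
  unfold quadPoly
  refine (MvPolynomial.totalDegree_add _ _).trans (max_le ((MvPolynomial.totalDegree_add _ _).trans
    (max_le ?_ ?_)) (by simp))
  · refine MvPolynomial.totalDegree_finsetSum_le fun i _ =>
      MvPolynomial.totalDegree_finsetSum_le fun j _ => ?_
    refine (MvPolynomial.totalDegree_monomial_le _ _).trans (degree_pairExp i j).le
  · refine MvPolynomial.totalDegree_finsetSum_le fun i _ => ?_
    refine (MvPolynomial.totalDegree_monomial_le _ _).trans ?_
    simp [Finsupp.sum_single_index]

theorem coeff_eq_zero_of_degree {p : MvPolynomial (Fin m) R} (hp : p.totalDegree ≤ 2)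
    {e : Fin m →₀ ℕ} (he : 2 < e.degree) : p.coeff e = 0 := by
  by_contra h
  have : e.degree ≤ _ := MvPolynomial.le_totalDegree (MvPolynomial.mem_support_iff.2 h)
  omega

theorem eq_of_coeff_eq {p q : MvPolynomial (Fin m) R} (hp : p.totalDegree ≤ 2)
    (hq : q.totalDegree ≤ 2)
    (h2 : ∀ i j, i ≤ j → p.coeff (pairExp i j) = q.coeff (pairExp i j))
    (h1 : ∀ i, p.coeff (Finsupp.single i 1) = q.coeff (Finsupp.single i 1))
    (h0 : p.coeff 0 = q.coeff 0) : p = q := by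
  ext e
  rcases le_or_gt e.degree 2 with he | he
  · rcases exp_cases he with rfl | ⟨i, rfl⟩ | ⟨i, j, hij, rfl⟩
    exacts [h0, h1 i, h2 i j hij]
  · rw [coeff_eq_zero_of_degree hp he, coeff_eq_zero_of_degree hq he]

theorem eq_quadPoly {p : MvPolynomial (Fin m) R} (hp : p.totalDegree ≤ 2) :
    p = quadPoly (fun i j => p.coeff (pairExp i j)) (fun i => p.coeff (Finsupp.single i 1))
      (p.coeff 0) :=
  eq_of_coeff_eq hp (totalDegree_quadPoly_le _ _ _)
    (fun i j h => by rw [coeff_quadPoly_pair _ _ _ h]) (fun i => by rw [coeff_quadPoly_single])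
    (coeff_quadPoly_zero _ _ _).symm

/-- Twice the symmetric matrix of a quadratic form with upper triangular coefficients `A`. -/
def hess (A : Fin m → Fin m → R) (i j : Fin m) : R :=
  if i = j then 2 * A i j else if i ≤ j then A i j else A j i

theorem hess_symm (A : Fin m → Fin m → R) (i j : Fin m) : hess A i j = hess A j i := by
  unfold hess
  rcases lt_trichotomy i j with h | h | h
  · simp [h.ne, h.ne', h.le, h.not_ge]
  · simp [h]
  · simp [h.ne, h.ne', h.le, h.not_ge]

theorem sum_upper (f : Fin m → Fin m → R) :
    2 * ∑ i : Fin m, ∑ j : Fin m with i ≤ j, f i j = ∑ i, ∑ j, hess f i j := by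
  have h1 : ∑ i : Fin m, ∑ j : Fin m with i ≤ j, f i j =
      ∑ i, ∑ j, if i ≤ j then f i j else 0 := by
    simp only [Finset.sum_filter]
  have h2 : ∑ i : Fin m, ∑ j : Fin m with i ≤ j, f i j =
      ∑ i, ∑ j, if j ≤ i then f j i else 0 := by rw [h1, Finset.sum_comm]
  rw [two_mul]
  nth_rw 1 [h1]
  rw [h2, ← Finset.sum_add_distrib]
  refine Finset.sum_congr rfl fun i _ => ?_
  rw [← Finset.sum_add_distrib]
  refine Finset.sum_congr rfl fun j _ => ?_
  unfold hess
  rcases lt_trichotomy i j with h | h | h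
  · simp [h.ne, h.le, h.not_ge]
  · subst h; simp [two_mul]
  · simp [h.ne', h.le, h.not_ge]

theorem eval_quadPoly (A : Fin m → Fin m → R) (b : Fin m → R) (c : R) (x : Fin m → R) :
    2 * MvPolynomial.eval x (quadPoly A b c) =
      ∑ i, ∑ j, hess A i j * (x i * x j) + 2 * ∑ i, b i * x i + 2 * c := by
  have h : MvPolynomial.eval x (quadPoly A b c) =
      ∑ i : Fin m, ∑ j : Fin m with i ≤ j, A i j * (x i * x j) + ∑ i, b i * x i + c := by
    simp [quadPoly, MvPolynomial.eval_monomial, pairExp, Finsupp.prod_add_index', pow_add]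
  rw [h, mul_add, mul_add, sum_upper]
  congr 3
  ext i; congr 1; ext j
  unfold hess
  split_ifs <;> ring

end

theorem gmonom_double {m : ℕ} (i : Fin m) : gmonom (Finsupp.single i 2) = 1 := by
  rw [gmonom, Finset.prod_eq_single i]
  · simp [gmom_two_four]
  · intro j _ hj; simp [Finsupp.single_eq_of_ne hj, gmom_zero]
  · simp

theorem gcov_single {m : ℕ} (i : Fin m) : gcov (Finsupp.single i 1) (Finsupp.single i 1) = 1 := by
  rw [gcov, ← Finsupp.single_add, gmonom_double,
    gmonom_eq_zero_of_odd (i := i) (e := Finsupp.single i 1) (by simp)]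
  norm_num

theorem gcov_zero {m : ℕ} : gcov (0 : Fin m →₀ ℕ) 0 = 0 := by simp [gcov, gmonom, gmom_zero]

theorem gcov_pairExp {m : ℕ} (i j : Fin m) :
    gcov (pairExp i j) (pairExp i j) = if i = j then 2 else 1 := by
  split_ifs with h
  · subst h
    have h4 : gmonom (Finsupp.single i 4) = 3 := by
      rw [gmonom, Finset.prod_eq_single i]
      · simp [gmom_two_four]
      · intro j _ hj; simp [Finsupp.single_eq_of_ne hj, gmom_zero]
      · simp
    rw [gcov, pairExp, ← Finsupp.single_add, ← Finsupp.single_add, gmonom_double]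
    norm_num [h4]
  · have h2 : gmonom (pairExp i j + pairExp i j) = 1 := by
      refine Finset.prod_eq_one fun k _ => ?_
      by_cases hi : k = i
      · subst hi; simp [pairExp, Ne.symm h, gmom_two_four]
      · by_cases hj : k = j
        · subst hj; simp [pairExp, h, gmom_two_four]
        · simp [pairExp, Ne.symm hi, Ne.symm hj, gmom_zero]
    rw [gcov, h2, gmonom_eq_zero_of_odd (i := i) (e := pairExp i j)]
    · norm_num
    · simp [pairExp, Ne.symm h]

/-- The monomials x_i² have variance 2, the others of positive degree variance 1. Since `hess`
doubles the diagonal and lists each off-diagonal coefficient twice, its Frobenius norm accounts for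
both cases at once. -/
theorem polyVar_quadPoly {m : ℕ} (A : Fin m → Fin m → ℝ) (b : Fin m → ℝ) (c : ℝ) :
    2 * polyVar (quadPoly A b c) = ∑ i, ∑ j, hess A i j ^ 2 + 2 * ∑ i, b i ^ 2 := by
  classical
  obtain ⟨P, hP⟩ : ∃ P : Finset (Fin m →₀ ℕ), P =
    ((Finset.univ.filter fun q : Fin m × Fin m => q.1 ≤ q.2).image
      fun q => pairExp q.1 q.2) := ⟨_, rfl⟩
  obtain ⟨S, hS⟩ : ∃ S : Finset (Fin m →₀ ℕ),
    S = Finset.univ.image fun i : Fin m => Finsupp.single i 1 := ⟨_, rfl⟩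
  have hsup : (quadPoly A b c).support ⊆ (P ∪ S) ∪ {0} := by
    intro e he
    have : e.degree ≤ 2 := by
      by_contra h
      exact (MvPolynomial.mem_support_iff.1 he)
        (coeff_eq_zero_of_degree (totalDegree_quadPoly_le A b c) (not_le.1 h))
    rcases exp_cases this with rfl | ⟨i, rfl⟩ | ⟨i, j, hij, rfl⟩
    · simp
    · simp [hS]
    · refine Finset.mem_union_left _ (Finset.mem_union_left _ ?_)
      rw [hP]
      exact Finset.mem_image.2 ⟨(i, j), by simpa using hij, rfl⟩
  rw [polyVar_eq_sum (totalDegree_quadPoly_le A b c) hsup, Finset.sum_union, Finset.sum_union,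
    Finset.sum_singleton, gcov_zero, mul_zero, add_zero]
  · rw [hS, Finset.sum_image (by
      intro i _ j _ h; exact (Finsupp.single_left_inj one_ne_zero).1 h)]
    simp only [coeff_quadPoly_single, gcov_single, mul_one]
    rw [mul_add, hP, Finset.sum_image (by
      rintro ⟨i, j⟩ h ⟨k, l⟩ h' h0
      simp only [Finset.coe_filter, Finset.mem_univ, true_and, Set.mem_ofPred_eq] at h h'
      have := (pairExp_inj h h').1 h0
      exact Prod.ext this.1 this.2)]
    congr 1
    have : ∀ i, ∀ j, hess A i j ^ 2 = hess (fun i j => A i j ^ 2 * if i = j then 2 else 1) i j := by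
      intro i j
      rcases eq_or_ne i j with rfl | h
      · simp only [hess, if_true]; ring
      · simp only [hess, h, h.symm, if_false]; split_ifs <;> ring
    simp only [this]
    rw [← sum_upper]
    congr 1
    rw [Finset.sum_filter, Fintype.sum_prod_type]
    refine Finset.sum_congr rfl fun i _ => ?_
    rw [Finset.sum_filter]
    refine Finset.sum_congr rfl fun j _ => ?_
    split_ifs with h1 h2
    · rw [coeff_quadPoly_pair _ _ _ h1, gcov_pairExp, if_pos h2]
    · rw [coeff_quadPoly_pair _ _ _ h1, gcov_pairExp, if_neg h2]
    · rfl
  · rw [Finset.disjoint_left]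
    intro e he he'
    simp only [hP, hS, Finset.mem_image] at he he'
    obtain ⟨q, _, rfl⟩ := he
    obtain ⟨i, _, h⟩ := he'
    exact pairExp_ne_single h.symm
  · rw [Finset.disjoint_singleton_right]
    simp only [hP, hS, Finset.mem_union, Finset.mem_image, not_or]
    refine ⟨?_, ?_⟩
    · rintro ⟨q, _, h⟩; exact pairExp_ne_zero h
    · rintro ⟨i, _, h⟩; simp at h

end GaussDecomp

/-! ### Invariance of the Gaussian law, and the residue along y. -/

namespace GaussDecomp

theorem charFun_gauss {m : ℕ} (t : EuclideanSpace ℝ (Fin m)) :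
    charFun ((gauss m).map (WithLp.toLp 2)) t = Complex.exp (-‖t‖ ^ 2 / 2) := by
  rw [← charFun_stdGaussian, gauss, map_pi_eq_stdGaussian]

/-- A linear map with `T Tᵀ = 1` pushes the standard Gaussian measure to the standard Gaussian
measure. -/
theorem map_gauss_mulVec {m n : ℕ} (T : Matrix (Fin n) (Fin m) ℝ) (hT : T * T.transpose = 1) :
    (gauss m).map (fun x => T.mulVec x) = gauss n := by
  have hmeas : Measurable fun x : Fin m → ℝ => T.mulVec x :=
    (Continuous.matrix_mulVec continuous_const continuous_id).measurable
  have hLp : Measurable (WithLp.toLp 2 : (Fin n → ℝ) → EuclideanSpace ℝ (Fin n)) := by fun_prop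
  have key : ((gauss m).map (fun x => T.mulVec x)).map (WithLp.toLp 2) =
      (gauss n).map (WithLp.toLp 2 : (Fin n → ℝ) → EuclideanSpace ℝ (Fin n)) := by
    rw [Measure.map_map hLp hmeas]
    have := Measure.isProbabilityMeasure_map (μ := gauss m) (hLp.comp hmeas).aemeasurable
    have := Measure.isProbabilityMeasure_map (μ := gauss n) hLp.aemeasurable
    apply Measure.ext_of_charFun
    ext t
    rw [charFun_gauss]
    -- Adjointness moves T to the frequency; T Tᵀ = 1 then gives |Tᵀ t| = |t|.
    have h1 : charFun ((gauss m).map (WithLp.toLp 2 ∘ fun x => T.mulVec x)) t =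
        charFun ((gauss m).map (WithLp.toLp 2))
          (WithLp.toLp 2 (T.transpose.mulVec t.ofLp) : EuclideanSpace ℝ (Fin m)) := by
      rw [charFun_apply, charFun_apply, integral_map (hLp.comp hmeas).aemeasurable (by fun_prop),
        integral_map (by fun_prop) (by fun_prop)]
      congr 1; ext x; congr 3
      simp only [Function.comp, EuclideanSpace.inner_eq_star_dotProduct, star_trivial]
      rw [Matrix.dotProduct_mulVec, Matrix.mulVec_transpose]
    rw [h1, charFun_gauss]
    congr 3
    norm_cast
    rw [← real_inner_self_eq_norm_sq, ← real_inner_self_eq_norm_sq]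
    simp only [EuclideanSpace.inner_eq_star_dotProduct, star_trivial]
    rw [Matrix.dotProduct_mulVec, ← Matrix.mulVec_transpose, Matrix.transpose_transpose,
      Matrix.mulVec_mulVec, hT, Matrix.one_mulVec]
  have h2 := congrArg (fun μ => μ.map (WithLp.ofLp : EuclideanSpace ℝ (Fin n) → (Fin n → ℝ))) key
  simp only at h2
  rw [Measure.map_map (by fun_prop) hLp, Measure.map_map (by fun_prop) hLp] at h2
  simpa [Function.comp_def] using h2

/-- The change of variables `x ↦ w y + (x - w ⟨w, x⟩)` for a unit vector `w`. -/
theorem map_gauss_split {n : ℕ} (w : Fin n → ℝ) (hw : ∑ i, w i ^ 2 = 1) :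
    (gauss (n + 1)).map (fun z i => w i * z 0 + (z i.succ - w i * ∑ j, w j * z j.succ)) =
      gauss n := by
  -- The first column is w and the remaining block is the projection 1 - w wᵀ, so T Tᵀ = w wᵀ + (1 -
  -- w wᵀ) = 1.
  let T : Matrix (Fin n) (Fin (n + 1)) ℝ := Matrix.of fun i j =>
    Fin.cases (w i) (fun k => (if i = k then 1 else 0) - w i * w k) j
  have hT : T * T.transpose = 1 := by
    ext i j
    simp only [Matrix.mul_apply, Matrix.transpose_apply, Fin.sum_univ_succ, T, Matrix.of_apply,
      Fin.cases_zero, Fin.cases_succ, Matrix.one_apply]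
    have : ∀ k, ((if i = k then (1 : ℝ) else 0) - w i * w k) * ((if j = k then 1 else 0) - w j * w k)
        = (if i = k then (if j = k then 1 else 0) else 0) - (if i = k then w j * w k else 0)
          - (if j = k then w i * w k else 0) + w i * w j * w k ^ 2 := by
      intro k; split_ifs <;> ring
    simp only [this, Finset.sum_add_distrib, Finset.sum_sub_distrib, ← Finset.mul_sum, hw,
      Finset.sum_ite_eq, Finset.mem_univ, if_true]
    rw [if_congr (eq_comm (a := j)) rfl rfl]
    ring
  rw [← map_gauss_mulVec T hT]
  congr 1
  ext z i
  simp only [Matrix.mulVec, dotProduct, T, Matrix.of_apply, Fin.sum_univ_succ,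
    Fin.cases_zero, Fin.cases_succ, sub_mul, ite_mul, one_mul, zero_mul, Finset.sum_sub_distrib,
    Finset.sum_ite_eq, Finset.mem_univ, if_true, Finset.mul_sum, mul_assoc]

theorem law_eq_of_split {n : ℕ} {p : MvPolynomial (Fin n) ℝ} {q : MvPolynomial (Fin (n + 1)) ℝ}
    (w : Fin n → ℝ) (hw : ∑ i, w i ^ 2 = 1)
    (h : ∀ z : Fin (n + 1) → ℝ, MvPolynomial.eval z q = MvPolynomial.eval
      (fun i => w i * z 0 + (z i.succ - w i * ∑ j, w j * z j.succ)) p) : law q = law p := by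
  have hp : Measurable fun x => MvPolynomial.eval x p := (MvPolynomial.continuous_eval p).measurable
  rw [law, law, ← map_gauss_split w hw, Measure.map_map hp (by fun_prop)]
  congr 1
  ext z
  exact h z

theorem polyVar_eq_of_law_eq {m n : ℕ} {p : MvPolynomial (Fin m) ℝ} {q : MvPolynomial (Fin n) ℝ}
    (h : law p = law q) : polyVar p = polyVar q := by
  have key {k : ℕ} (r : MvPolynomial (Fin k) ℝ) : polyVar r = variance id (law r) := by
    rw [law, variance_id_map (MvPolynomial.continuous_eval r).measurable.aemeasurable]; rfl
  rw [key, key, h]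

/-- Along a coordinate direction the orthogonal part R_0 is 0, so `splitAlong` is a mere renaming
that skips variable 1. Hence only the cross terms of variable 0 with the other variables survive. -/
theorem residue_zero_eq {m : ℕ} (A : Fin (m + 1) → Fin (m + 1) → ℝ) (b : Fin (m + 1) → ℝ) (c : ℝ) :
    residue (Pi.single 0 1) (quadPoly A b c) =
      quadPoly (fun i j => Fin.cases (Fin.cases 0 (Fin.cases 0 (fun l => A 0 l.succ)) j)
        (fun _ => 0) i) 0 0 := by
  classical
  have hs : splitAlong (Pi.single 0 1) (quadPoly A b c) =
      MvPolynomial.rename (Fin.cases 0 fun i => i.succ.succ) (quadPoly A b c) := by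
    rw [splitAlong, MvPolynomial.rename_eq_aeval]
    congr 2
    ext i : 1
    cases i using Fin.cases with
    | zero => simp [Fin.sum_univ_succ, Fin.succ_ne_zero]
    | succ i => simp [Fin.succ_ne_zero]
  have hinj : Function.Injective (Fin.cases 0 fun i => i.succ.succ : Fin (m + 1) → Fin (m + 2)) := by
    intro i j h
    cases i using Fin.cases <;> cases j using Fin.cases <;> simp_all [Fin.succ_ne_zero, eq_comm]
  have h1 : (splitAlong (Pi.single 0 1) (quadPoly A b c)).coeff (pairExp 0 (Fin.succ 0)) = 0 := by
    rw [hs]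
    refine MvPolynomial.coeff_rename_eq_zero _ _ _ fun u hu => ?_
    exfalso
    have := DFunLike.congr_fun hu (Fin.succ 0)
    rw [Finsupp.mapDomain_of_notMem_range] at this
    · simp [pairExp] at this
    · rintro ⟨i, hi⟩
      cases i using Fin.cases with
      | zero => simp at hi
      | succ i => simp [Fin.ext_iff] at hi
  have h2 (l : Fin m) : (splitAlong (Pi.single 0 1) (quadPoly A b c)).coeff
      (pairExp 0 (Fin.succ l.succ)) = A 0 l.succ := by
    have : pairExp 0 (Fin.succ l.succ) = Finsupp.mapDomain
      (Fin.cases 0 fun i => i.succ.succ : Fin (m + 1) → Fin (m + 2)) (pairExp 0 l.succ) := by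
      simp [pairExp, Finsupp.mapDomain_add]
    rw [hs, this, MvPolynomial.coeff_rename_mapDomain _ hinj, coeff_quadPoly_pair _ _ _ (Fin.zero_le _)]
  rw [residue, Fin.sum_univ_succ, h1]
  simp only [h2]
  simp only [quadPoly, Finset.sum_filter]
  simp [Fin.sum_univ_succ]

theorem polyVar_residue {m : ℕ} (A : Fin (m + 1) → Fin (m + 1) → ℝ) (b : Fin (m + 1) → ℝ) (c : ℝ) :
    polyVar (residue (Pi.single 0 1) (quadPoly A b c)) = ∑ l : Fin m, A 0 l.succ ^ 2 := by
  have h := polyVar_quadPoly (fun i j : Fin (m + 2) => Fin.cases (motive := fun _ => ℝ)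
    (Fin.cases (motive := fun _ => ℝ) 0 (Fin.cases 0 (fun l => A 0 l.succ)) j) (fun _ => 0) i) 0 0
  rw [residue_zero_eq]
  have h0 {k : ℕ} (i : Fin k) : ((0 : Fin (k + 1)) = i.succ) = False := by simp [(Fin.succ_ne_zero i).symm]
  simp [hess, Fin.sum_univ_succ, Fin.succ_ne_zero, h0] at h
  linarith

end GaussDecomp

/-! ### From a unit vector to a decomposition. -/

namespace GaussDecomp

/-- Twice the matrix of the quadratic part of `p`. -/
noncomputable def hessian {R : Type*} [CommRing R] {n : ℕ} (p : MvPolynomial (Fin n) R)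
    (i j : Fin n) : R :=
  if i = j then 2 * p.coeff (pairExp i j) else p.coeff (pairExp i j)

theorem hessian_symm {R : Type*} [CommRing R] {n : ℕ} (p : MvPolynomial (Fin n) R) (i j : Fin n) :
    hessian p i j = hessian p j i := by
  unfold hessian
  rcases eq_or_ne i j with rfl | h
  · rfl
  · rw [if_neg h, if_neg h.symm, pairExp_comm]

theorem hess_coeff {R : Type*} [CommRing R] {n : ℕ} (p : MvPolynomial (Fin n) R) (i j : Fin n) :
    hess (fun i j => p.coeff (pairExp i j)) i j = hessian p i j := by
  simp only [hess, hessian, pairExp_comm j i]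
  split_ifs <;> rfl

theorem polyVar_eq_hessian {n : ℕ} {p : MvPolynomial (Fin n) ℝ} (hp : p.totalDegree ≤ 2) :
    2 * polyVar p = ∑ i, ∑ j, hessian p i j ^ 2 + 2 * ∑ i, p.coeff (Finsupp.single i 1) ^ 2 := by
  conv_lhs => rw [eq_quadPoly hp]
  rw [polyVar_quadPoly]
  simp only [hess_coeff]

/-- Splitting off the direction of a unit vector `w`. -/
theorem isDecomposition_of_unit {n : ℕ} {p : MvPolynomial (Fin n) ℝ} (hp : p.totalDegree ≤ 2)
    (hp0 : p.coeff 0 = 0) {w g : Fin n → ℝ} (hw : ∑ i, w i ^ 2 = 1) {h β ε η : ℝ}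
    (hg : ∀ i, g i = ∑ j, hessian p i j * w j) (hh : h = ∑ i, w i * g i)
    (hβ : β = ∑ i, p.coeff (Finsupp.single i 1) * w i)
    {A : Fin (n + 1) → Fin (n + 1) → ℝ} {b : Fin (n + 1) → ℝ} (hA00 : A 0 0 = 0)
    (hA0 : ∀ j, A 0 (Fin.succ j) = g j - h * w j)
    (hA : ∀ i j, i ≤ j → A (Fin.succ i) (Fin.succ j) = (if i = j then 1 / 2 else 1) *
      (hessian p i j - (w i * g j + g i * w j) + h * w i * w j))
    (hb0 : b 0 = 0) (hb : ∀ i, b (Fin.succ i) = p.coeff (Finsupp.single i 1) - β * w i)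
    (hres : ∑ i, (g i - h * w i) ^ 2 ≤ 4 * η ^ 2 * polyVar p)
    (hlam : ε ^ 4 / 40 * polyVar p ≤ h ^ 2 / 2) :
    IsDecomposition p ε η (h / 2) β (quadPoly A b 0) := by
  have h00 : hess A 0 0 = 0 := by simp [hess, hA00]
  have h0s (j : Fin n) : hess A 0 j.succ = g j - h * w j := by
    simp [hess, (Fin.succ_ne_zero j).symm, hA0]
  have hs0 (j : Fin n) : hess A j.succ 0 = g j - h * w j := by rw [hess_symm, h0s]
  have hss (i j : Fin n) : hess A i.succ j.succ =
      hessian p i j - (w i * g j + g i * w j) + h * w i * w j := by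
    unfold hess
    simp only [Fin.succ_inj, Fin.succ_le_succ_iff]
    split_ifs with h1 h2
    · rw [hA i j h1.le, if_pos h1]; ring
    · rw [hA i j h2, if_neg h1]; ring
    · rw [hA j i (le_of_not_ge h2), if_neg (Ne.symm h1), hessian_symm]; ring
  have hB (x : Fin n → ℝ) : ∑ i, ∑ j, hessian p i j * (x i * w j) = ∑ i, g i * x i := by
    refine Finset.sum_congr rfl fun i _ => ?_
    rw [hg, Finset.sum_mul]
    exact Finset.sum_congr rfl fun j _ => by ring
  have hB' (x : Fin n → ℝ) : ∑ i, ∑ j, hessian p i j * (w i * x j) = ∑ i, g i * x i := by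
    rw [← hB, Finset.sum_comm]
    refine Finset.sum_congr rfl fun i _ => Finset.sum_congr rfl fun j _ => ?_
    rw [hessian_symm]; ring
  set q : MvPolynomial (Fin (n + 1)) ℝ := MvPolynomial.C (h / 2) * MvPolynomial.X 0 ^ 2
    + MvPolynomial.C β * MvPolynomial.X 0 + quadPoly A b 0 with hq
  have hlaw : law q = law p := by
    refine law_eq_of_split w hw fun z => ?_
    have hp2 (x : Fin n → ℝ) : 2 * MvPolynomial.eval x p = ∑ i, ∑ j, hessian p i j * (x i * x j)
        + 2 * ∑ i, p.coeff (Finsupp.single i 1) * x i := by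
      conv_lhs => rw [eq_quadPoly hp]
      rw [eval_quadPoly, hp0]
      simp only [hess_coeff, mul_zero, add_zero]
    set y := z 0
    set x : Fin n → ℝ := fun i => z i.succ with hx
    -- The substituted point is x + (y - t) w. The identities `e1`, `e2` expand p there, and `e3` to
    -- `e6` expand the claimed polynomial.
    set t := ∑ j, w j * z j.succ with ht
    have e1 : ∑ i, ∑ j, hessian p i j * ((w i * y + (z i.succ - w i * t)) *
          (w j * y + (z j.succ - w j * t))) =
        (y - t) ^ 2 * h + 2 * (y - t) * ∑ i, g i * x i +
          ∑ i, ∑ j, hessian p i j * (x i * x j) := by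
      have : ∀ i j, hessian p i j * ((w i * y + (z i.succ - w i * t)) *
          (w j * y + (z j.succ - w j * t))) = (y - t) ^ 2 * (hessian p i j * (w i * w j))
          + (y - t) * (hessian p i j * (x i * w j)) + (y - t) * (hessian p i j * (w i * x j))
          + hessian p i j * (x i * x j) := by
        intro i j; simp only [hx]; ring
      simp only [this, Finset.sum_add_distrib, ← Finset.mul_sum, hB, hB']
      rw [hh]
      simp only [mul_comm (w _) (g _)]
      ring
    have e2 : ∑ i, p.coeff (Finsupp.single i 1) * (w i * y + (z i.succ - w i * t)) =
        (y - t) * β + ∑ i, p.coeff (Finsupp.single i 1) * x i := by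
      rw [hβ, Finset.mul_sum, ← Finset.sum_add_distrib]
      exact Finset.sum_congr rfl fun i _ => by simp only [hx]; ring
    have e3 : ∑ i, ∑ j, (hessian p i j - (w i * g j + g i * w j) + h * w i * w j) * (x i * x j) =
        ∑ i, ∑ j, hessian p i j * (x i * x j) - 2 * t * ∑ i, g i * x i + h * t ^ 2 := by
      have h1 : ∑ i, ∑ j, (w i * x i) * (g j * x j) = t * ∑ i, g i * x i := by
        rw [ht, Finset.sum_mul_sum]
      have h2 : ∑ i, ∑ j, (g i * x i) * (w j * x j) = t * ∑ i, g i * x i := by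
        rw [mul_comm, ht, Finset.sum_mul_sum]
      have h3 : ∑ i, ∑ j, (w i * x i) * (w j * x j) = t ^ 2 := by
        rw [pow_two, ht, Finset.sum_mul_sum]
      have : ∀ i j, (hessian p i j - (w i * g j + g i * w j) + h * w i * w j) * (x i * x j) =
          hessian p i j * (x i * x j) - (w i * x i) * (g j * x j) - (g i * x i) * (w j * x j)
          + h * ((w i * x i) * (w j * x j)) := by intro i j; ring
      have h4 : ∑ i, ∑ j, h * ((w i * x i) * (w j * x j)) = h * t ^ 2 := by
        simp only [← h3, Finset.mul_sum]
      simp only [this, Finset.sum_add_distrib, Finset.sum_sub_distrib, h1, h2, h4]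
      ring
    have e4 : ∑ j, (g j - h * w j) * (y * x j) = y * (∑ i, g i * x i - h * t) := by
      rw [ht, Finset.mul_sum, ← Finset.sum_sub_distrib, Finset.mul_sum]
      exact Finset.sum_congr rfl fun j _ => by simp only [hx]; ring
    have e5 : ∑ j, (g j - h * w j) * (x j * y) = y * (∑ i, g i * x i - h * t) := by
      rw [← e4]; exact Finset.sum_congr rfl fun j _ => by ring
    have e6 : ∑ i, (p.coeff (Finsupp.single i 1) - β * w i) * x i =
        ∑ i, p.coeff (Finsupp.single i 1) * x i - β * t := by
      rw [ht, Finset.mul_sum, ← Finset.sum_sub_distrib]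
      exact Finset.sum_congr rfl fun j _ => by simp only [hx]; ring
    have hq2 : 2 * MvPolynomial.eval z q = h * y ^ 2 + 2 * β * y
        + 2 * MvPolynomial.eval z (quadPoly A b 0) := by
      simp only [hq, map_add, map_mul, MvPolynomial.eval_C, map_pow, MvPolynomial.eval_X]; ring
    rw [eval_quadPoly] at hq2
    simp only [Fin.sum_univ_succ, h00, h0s, hs0, hss, hb0, hb, zero_mul, zero_add,
      Finset.sum_add_distrib] at hq2
    simp only [hx] at e3 e4 e5 e6
    rw [e3, e4, e5, e6] at hq2
    have hpx := hp2 fun i => w i * y + (z i.succ - w i * t)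
    rw [e1, e2] at hpx
    simp only [hx] at hpx
    linarith
  -- Putting the split-off terms back into a `quadPoly` lets the variance formula apply to q as well
  -- as to r.
  have hqdeg : q = quadPoly (fun i j => if i = 0 ∧ j = 0 then h / 2 else A i j)
      (fun i => if i = 0 then β else b i) 0 := by
    have hX2 : (MvPolynomial.C (h / 2) * MvPolynomial.X 0 ^ 2 : MvPolynomial (Fin (n + 1)) ℝ) =
        MvPolynomial.monomial (pairExp 0 0) (h / 2) := by
      rw [MvPolynomial.X_pow_eq_monomial, MvPolynomial.C_mul_monomial, pairExp,
        ← Finsupp.single_add, mul_one]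
    have hX1 : (MvPolynomial.C β * MvPolynomial.X 0 : MvPolynomial (Fin (n + 1)) ℝ) =
        MvPolynomial.monomial (Finsupp.single 0 1) β := by
      rw [MvPolynomial.X, MvPolynomial.C_mul_monomial, mul_one]
    rw [hq, hX2, hX1]
    simp only [quadPoly, Finset.sum_filter]
    simp [Fin.sum_univ_succ, hA00, hb0, Fin.succ_ne_zero]
    ring
  -- The term (h/2) y² contributes 2 (h/2)² and the term β y contributes β².
  have hvar : polyVar p = polyVar (quadPoly A b 0) + h ^ 2 / 2 + β ^ 2 := by
    have h1 := polyVar_eq_of_law_eq hlaw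
    have h2 := polyVar_quadPoly (fun i j => if i = 0 ∧ j = 0 then h / 2 else A i j)
      (fun i => if i = 0 then β else b i) 0
    have h3 := polyVar_quadPoly A b 0
    rw [← hqdeg] at h2
    simp [Fin.sum_univ_succ, hess, hA00, hb0, Fin.succ_ne_zero] at h2 h3
    linarith
  refine ⟨totalDegree_quadPoly_le _ _ _, ?_, ?_, hlaw, ?_, ?_⟩
  · rw [coeff_quadPoly_single, hb0]
  · have : (Finsupp.single 0 2 : Fin (n + 1) →₀ ℕ) = pairExp 0 0 := by
      rw [pairExp, ← Finsupp.single_add]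
    rw [this, coeff_quadPoly_pair _ _ _ le_rfl, hA00]
  · rw [polyVar_residue]
    simpa only [hA0] using hres
  · have := sq_nonneg β
    linarith

end GaussDecomp

/-! ### The power method for a positive semidefinite matrix. -/

namespace GaussDecomp
open Matrix

section Power
variable {n : ℕ}

theorem dot_sq_le (x y : Fin n → ℝ) : (x ⬝ᵥ y) ^ 2 ≤ (x ⬝ᵥ x) * (y ⬝ᵥ y) := by
  simpa only [dotProduct, ← pow_two] using Finset.sum_mul_sq_le_sq_mul_sq Finset.univ x y

theorem dot_self_nonneg (x : Fin n → ℝ) : 0 ≤ x ⬝ᵥ x :=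
  Finset.sum_nonneg fun i _ => mul_self_nonneg (x i)

theorem form_sq_le {M : Matrix (Fin n) (Fin n) ℝ} (hs : M.IsSymm)
    (hM : ∀ x, 0 ≤ x ⬝ᵥ M *ᵥ x) (x y : Fin n → ℝ) :
    (x ⬝ᵥ M *ᵥ y) ^ 2 ≤ (x ⬝ᵥ M *ᵥ x) * (y ⬝ᵥ M *ᵥ y) := by
  have hxy : y ⬝ᵥ M *ᵥ x = x ⬝ᵥ M *ᵥ y := by
    rw [dotProduct_mulVec, ← mulVec_transpose, hs.eq, dotProduct_comm]
  have h := discrim_le_zero (a := y ⬝ᵥ M *ᵥ y) (b := 2 * (x ⬝ᵥ M *ᵥ y)) (c := x ⬝ᵥ M *ᵥ x)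
    (fun t => by
      have := hM (x + t • y)
      simp only [mulVec_add, mulVec_smul, add_dotProduct, dotProduct_add, smul_dotProduct,
        dotProduct_smul, smul_eq_mul, hxy] at this
      linarith)
  rw [discrim] at h
  nlinarith

/-- The power sequence `M ^ k e`. -/
def powSeq (M : Matrix (Fin n) (Fin n) ℝ) (e : Fin n → ℝ) : ℕ → Fin n → ℝ
  | 0 => e
  | k + 1 => M *ᵥ powSeq M e k

variable {M : Matrix (Fin n) (Fin n) ℝ} {e : Fin n → ℝ}

/-- The moments `⟨e, M ^ j e⟩`. -/
def powMom (M : Matrix (Fin n) (Fin n) ℝ) (e : Fin n → ℝ) (j : ℕ) : ℝ := e ⬝ᵥ powSeq M e j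

theorem powSeq_dot (hs : M.IsSymm) (i j : ℕ) : powSeq M e i ⬝ᵥ powSeq M e j = powMom M e (i + j) := by
  induction i generalizing j with
  | zero => rw [zero_add]; rfl
  | succ i ih =>
    have : i + 1 + j = i + (j + 1) := by ring
    rw [this, ← ih (j + 1), powSeq, powSeq, dotProduct_mulVec, ← mulVec_transpose, hs.eq]

theorem powMom_nonneg (hs : M.IsSymm) (hM : ∀ x, 0 ≤ x ⬝ᵥ M *ᵥ x) (j : ℕ) : 0 ≤ powMom M e j := by
  rcases Nat.even_or_odd' j with ⟨k, rfl | rfl⟩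
  · rw [two_mul, ← powSeq_dot hs]; exact dot_self_nonneg _
  · rw [two_mul, add_assoc, ← powSeq_dot hs]; exact hM _

/-- Cauchy–Schwarz for M^k e and M^(k+1) e, with the dot product if j = 2k and with the form of M if
j = 2k + 1. This log-convexity drives the whole analysis. -/
theorem powMom_sq_le (hs : M.IsSymm) (hM : ∀ x, 0 ≤ x ⬝ᵥ M *ᵥ x) (j : ℕ) :
    powMom M e (j + 1) ^ 2 ≤ powMom M e j * powMom M e (j + 2) := by
  rcases Nat.even_or_odd' j with ⟨k, rfl | rfl⟩
  · have := dot_sq_le (powSeq M e k) (powSeq M e (k + 1))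
    simp only [powSeq_dot hs] at this
    convert this using 3 <;> ring_nf
  · have := form_sq_le hs hM (powSeq M e k) (powSeq M e (k + 1))
    change (_ ⬝ᵥ powSeq M e (k + 2)) ^ 2 ≤ (_ ⬝ᵥ powSeq M e (k + 1)) * (_ ⬝ᵥ powSeq M e (k + 2)) at this
    simp only [powSeq_dot hs] at this
    convert this using 3 <;> ring_nf

/-- A vanishing odd moment would, by log-convexity, force the next even one to vanish. -/
theorem powMom_pos (hs : M.IsSymm) (hM : ∀ x, 0 ≤ x ⬝ᵥ M *ᵥ x)
    (h : ∀ k, 0 < powMom M e (2 * k)) (j : ℕ) : 0 < powMom M e j := by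
  rcases Nat.even_or_odd' j with ⟨k, rfl | rfl⟩
  · exact h k
  · refine (powMom_nonneg hs hM _).lt_of_ne fun h0 => ?_
    have h1 := powMom_sq_le (e := e) hs hM (2 * k + 1)
    rw [← h0, zero_mul] at h1
    have := h (k + 1)
    have h2 : 2 * (k + 1) = 2 * k + 1 + 1 := by ring
    rw [h2] at this
    nlinarith

/-- One of `K` consecutive iterates of the power method is an approximate eigenvector. -/
theorem exists_approx_eigenvector (hs : M.IsSymm) (hM : ∀ x, 0 ≤ x ⬝ᵥ M *ᵥ x) {R : ℝ}
    (hR : ∀ x, x ⬝ᵥ M *ᵥ x ≤ R * (x ⬝ᵥ x)) (h : ∀ k, 0 < powMom M e (2 * k))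
    (K₀ : ℕ) {K : ℕ} (hK : 0 < K) :
    ∃ k, K₀ ≤ k ∧ k < K₀ + K ∧
      K * (powMom M e (2 * k) * powMom M e (2 * k + 2) - powMom M e (2 * k + 1) ^ 2) ≤
        R ^ 2 * powMom M e (2 * k) ^ 2 ∧
      powMom M e (2 * k) ≤
        powMom M e 0 * (powMom M e (2 * k + 1) / powMom M e (2 * k)) ^ (2 * k) := by
  have hpos := powMom_pos hs hM h
  set m := powMom M e with hm
  set r : ℕ → ℝ := fun j => m (j + 1) / m j with hr
  have hr0 (j) : 0 < r j := div_pos (hpos _) (hpos _)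
  have hmono : Monotone r := monotone_nat_of_le_succ fun j => by
    simp only [hr]
    rw [div_le_div_iff₀ (hpos _) (hpos _)]
    have := powMom_sq_le (e := e) hs hM j
    rw [← hm] at this
    nlinarith
  -- Monotonicity gives r_j ≤ r_(2j), and r_(2j) is the Rayleigh quotient of M^j e.
  have hrR (j) : r j ≤ R := by
    refine (hmono (show j ≤ 2 * j by omega)).trans ?_
    simp only [hr]
    rw [div_le_iff₀ (hpos _)]
    have := hR (powSeq M e j)
    change _ ⬝ᵥ powSeq M e (j + 1) ≤ _ at this
    rw [powSeq_dot hs, powSeq_dot hs, ← add_assoc, ← two_mul] at this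
    exact this
  -- The quotient m_j / m_0 is a product of j ratios, none exceeding r_j.
  have hprod (j) : m j ≤ m 0 * r j ^ j := by
    induction j with
    | zero => simp
    | succ j ih =>
      have : m (j + 1) = r j * m j := by simp only [hr]; field_simp [(hpos j).ne']
      rw [this]
      calc r j * m j ≤ r j * (m 0 * r j ^ j) := by gcongr; exact (hr0 j).le
        _ = m 0 * r j ^ (j + 1) := by ring
        _ ≤ m 0 * r (j + 1) ^ (j + 1) := by
          gcongr
          · exact (hpos 0).le
          · exact (hr0 j).le
          · exact hmono (Nat.le_succ j)
  -- The K increments belong to disjoint steps of a monotone sequence with values in (0, R], so they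
  -- cannot all exceed R / K.
  obtain ⟨k, hk, hkr⟩ : ∃ k ∈ Finset.range K, r (2 * (K₀ + k) + 1) - r (2 * (K₀ + k)) ≤ R / K := by
    by_contra! hcon
    have h1 : ∑ k ∈ Finset.range K, R / K <
        ∑ k ∈ Finset.range K, (r (2 * (K₀ + k) + 1) - r (2 * (K₀ + k))) :=
      Finset.sum_lt_sum_of_nonempty (by simpa using hK.ne') hcon
    have h2 : ∑ k ∈ Finset.range K, (r (2 * (K₀ + k) + 1) - r (2 * (K₀ + k))) ≤
        ∑ k ∈ Finset.range K, (r (2 * (K₀ + (k + 1))) - r (2 * (K₀ + k))) :=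
      Finset.sum_le_sum fun k _ => by
        have := hmono (show 2 * (K₀ + k) + 1 ≤ 2 * (K₀ + (k + 1)) by omega)
        linarith
    rw [Finset.sum_range_sub (fun k => r (2 * (K₀ + k)))] at h2
    rw [Finset.sum_const, Finset.card_range, nsmul_eq_mul] at h1
    have h3 : (K : ℝ) * (R / K) = R := by field_simp
    have h4 := hrR (2 * (K₀ + K))
    have h5 := hr0 (2 * (K₀ + 0))
    linarith
  refine ⟨K₀ + k, by omega, by have := Finset.mem_range.1 hk; omega, ?_, hprod _⟩
  have hK' : (0 : ℝ) < K := by exact_mod_cast hK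
  have e0 := hpos (2 * (K₀ + k))
  set a := r (2 * (K₀ + k))
  set b := r (2 * (K₀ + k) + 1)
  have e1 : m (2 * (K₀ + k) + 1) = a * m (2 * (K₀ + k)) := by
    simp only [a, hr]; field_simp
  have e2 : m (2 * (K₀ + k) + 2) = b * m (2 * (K₀ + k) + 1) := by
    simp only [b, hr]; field_simp [(hpos (2 * (K₀ + k) + 1)).ne']
  rw [e2, e1]
  -- The quantity to be bounded is m_(2k)² a (b - a), where a and b are the ratios r_(2k) and
  -- r_(2k+1) for the chosen k.
  have hab : K * (a * (b - a)) ≤ R ^ 2 := by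
    have h1 : K * (b - a) ≤ R := by
      rw [le_div_iff₀ hK'] at hkr; linarith
    have h2 : 0 ≤ b - a := sub_nonneg.2 (hmono (Nat.le_succ _))
    have h3 : 0 < a := hr0 _
    have h4 : a ≤ R := hrR _
    have h5 : 0 ≤ K * (b - a) := by positivity
    nlinarith
  calc _ = (K * (a * (b - a))) * m (2 * (K₀ + k)) ^ 2 := by ring
    _ ≤ _ := by gcongr

/-- By symmetry x·M^k e = θ^k x·e; Cauchy–Schwarz turns the overlap of e with the eigenvector into
growth of the iterates. -/
theorem powMom_ge_of_eigenvector (hs : M.IsSymm) {θ : ℝ} {x : Fin n → ℝ} (hx : M *ᵥ x = θ • x)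
    (k : ℕ) : (θ ^ k * (x ⬝ᵥ e)) ^ 2 ≤ (x ⬝ᵥ x) * powMom M e (2 * k) := by
  have h (k) : x ⬝ᵥ powSeq M e k = θ ^ k * (x ⬝ᵥ e) := by
    induction k with
    | zero => simp [powSeq]
    | succ k ih =>
      rw [powSeq, dotProduct_mulVec, ← mulVec_transpose, hs.eq, hx, smul_dotProduct, ih, smul_eq_mul]
      ring
  rw [← h, two_mul, ← powSeq_dot hs]
  exact dot_sq_le _ _

end Power

end GaussDecomp

/-! ### Rational unit vectors from iterates, and the choice of constants. -/

namespace GaussDecomp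
open Matrix

section
variable {n : ℕ}

/-- The image of `-e_i` under the reflection in the hyperplane orthogonal to `v + N e_i`. It is a
unit vector with rational coordinates if `v` and `N` are rational, close to `v / N` if `N` is close
to the length of `v`. -/
noncomputable def reflVec (v : Fin n → ℝ) (N : ℝ) (i : Fin n) : Fin n → ℝ :=
  let u := v + N • Pi.single i 1
  (2 * u i / (u ⬝ᵥ u)) • u - Pi.single i 1

/-- With u = v + N e_i, the error N w - v is -((|v|² - N²)/|u|²) u. The sign v_i ≥ 0 prevents
cancellation and gives |u| ≥ N, while |v|² - N² ≤ 2N + 1 ≤ 3N; hence the error has length at most 3.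
-/
theorem reflVec_spec {v : Fin n → ℝ} {N : ℝ} {i : Fin n} (hv : 0 ≤ v i) (hN : 1 ≤ N)
    (h1 : N ^ 2 ≤ v ⬝ᵥ v) (h2 : v ⬝ᵥ v ≤ (N + 1) ^ 2) :
    0 < (v + N • Pi.single i 1) ⬝ᵥ (v + N • Pi.single i (1 : ℝ)) ∧
    (∃ δ : Fin n → ℝ, N • reflVec v N i = v + δ ∧ δ ⬝ᵥ δ ≤ 9) := by
  set u := v + N • Pi.single i (1 : ℝ) with hu
  have hui : u i = v i + N := by simp [hu]
  set d := u ⬝ᵥ u with hd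
  have hdv : d = v ⬝ᵥ v + 2 * N * v i + N ^ 2 := by
    simp [hd, hu, add_dotProduct, dotProduct_add]; ring
  have hdN : N ^ 2 ≤ d := by
    have : 0 ≤ 2 * N * v i := by positivity
    have := dot_self_nonneg v
    linarith
  have hd0 : 0 < d := by nlinarith
  refine ⟨hd0, (-((v ⬝ᵥ v - N ^ 2) / d)) • u, ?_, ?_⟩
  · ext j
    have hj : u j = v j + N * (Pi.single i (1 : ℝ) : Fin n → ℝ) j := by simp [hu]
    change N * (2 * u i / d * u j - (Pi.single i (1 : ℝ) : Fin n → ℝ) j) =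
      v j + -((v ⬝ᵥ v - N ^ 2) / d) * u j
    have : N * (Pi.single i (1 : ℝ) : Fin n → ℝ) j = u j - v j := by rw [hj]; ring
    rw [mul_sub, this, hui]
    have h3 : N * (2 * (v i + N)) = d - (v ⬝ᵥ v - N ^ 2) := by rw [hdv]; ring
    have h4 : N * (2 * (v i + N) / d * u j) = (N * (2 * (v i + N))) / d * u j := by ring
    rw [h4, h3, sub_div, div_self hd0.ne']
    ring
  · rw [smul_dotProduct, dotProduct_smul, ← hd, smul_eq_mul, smul_eq_mul]
    have h3 : -((v ⬝ᵥ v - N ^ 2) / d) * (-((v ⬝ᵥ v - N ^ 2) / d) * d) = (v ⬝ᵥ v - N ^ 2) ^ 2 / d := by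
      field_simp
    rw [h3, div_le_iff₀ hd0]
    have h4 : v ⬝ᵥ v - N ^ 2 ≤ 3 * N := by nlinarith
    have h5 : 0 ≤ v ⬝ᵥ v - N ^ 2 := by linarith
    nlinarith

theorem reflVec_dot_self {v : Fin n → ℝ} {N : ℝ} {i : Fin n}
    (h : 0 < (v + N • Pi.single i 1) ⬝ᵥ (v + N • Pi.single i (1 : ℝ))) :
    reflVec v N i ⬝ᵥ reflVec v N i = 1 := by
  simp only [reflVec]
  set u := v + N • Pi.single i (1 : ℝ)
  set d := u ⬝ᵥ u with hd
  simp only [sub_dotProduct, dotProduct_sub, smul_dotProduct, dotProduct_smul, ← hd, smul_eq_mul,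
    dotProduct_single_one, single_one_dotProduct, Pi.sub_apply, Pi.smul_apply, Pi.single_eq_same]
  field_simp
  ring

theorem dot_add_self_le (x y : Fin n → ℝ) :
    (x + y) ⬝ᵥ (x + y) ≤ 2 * (x ⬝ᵥ x) + 2 * (y ⬝ᵥ y) := by
  have h := dot_self_nonneg (x - y)
  simp only [sub_dotProduct, dotProduct_sub, add_dotProduct, dotProduct_add, dotProduct_comm y x]
    at h ⊢
  linarith

/-- The two sides differ by (x·y - c)², so any guess c for the eigenvalue bounds the true residual.
-/
theorem dot_residual (x y : Fin n → ℝ) (c : ℝ) (hx : x ⬝ᵥ x = 1) :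
    y ⬝ᵥ y - (x ⬝ᵥ y) ^ 2 ≤ (y - c • x) ⬝ᵥ (y - c • x) := by
  simp only [sub_dotProduct, dotProduct_sub, smul_dotProduct, dotProduct_smul, smul_eq_mul, hx,
    dotProduct_comm y x]
  nlinarith [sq_nonneg (x ⬝ᵥ y - c)]

variable {B : Matrix (Fin n) (Fin n) ℝ}

theorem abs_dot_mulVec_le {F : ℝ} (hF0 : 0 ≤ F)
    (hF : ∀ x, (B *ᵥ x) ⬝ᵥ (B *ᵥ x) ≤ F ^ 2 * (x ⬝ᵥ x)) {x y : Fin n → ℝ} {p q : ℝ} (hp : 0 ≤ p)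
    (hq : 0 ≤ q) (hx : x ⬝ᵥ x ≤ p ^ 2) (hy : y ⬝ᵥ y ≤ q ^ 2) : |x ⬝ᵥ B *ᵥ y| ≤ p * (F * q) := by
  apply abs_le_of_sq_le_sq _ (by positivity)
  refine (dot_sq_le _ _).trans ?_
  have := hF y
  calc _ ≤ p ^ 2 * (F ^ 2 * q ^ 2) := by
        gcongr
        · exact dot_self_nonneg _
        · exact this.trans (by gcongr)
    _ = _ := by ring

/-- The quality of the unit vector obtained from an approximate eigenvector. -/
theorem reflVec_residual {F : ℝ} (hF0 : 0 ≤ F) (hB : B.IsSymm)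
    (hF : ∀ x, (B *ᵥ x) ⬝ᵥ (B *ᵥ x) ≤ F ^ 2 * (x ⬝ᵥ x)) {v : Fin n → ℝ} {N : ℝ} {i : Fin n}
    (hv : 0 ≤ v i) (hN : 1 ≤ N) (h1 : N ^ 2 ≤ v ⬝ᵥ v) (h2 : v ⬝ᵥ v ≤ (N + 1) ^ 2) {ρ τ : ℝ}
    (hρ : v ⬝ᵥ B *ᵥ v = ρ * (v ⬝ᵥ v)) (hτ : (B *ᵥ v) ⬝ᵥ (B *ᵥ v) - ρ ^ 2 * (v ⬝ᵥ v) ≤ τ * (v ⬝ᵥ v)) :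
    let w := reflVec v N i
    ((B *ᵥ w) ⬝ᵥ (B *ᵥ w) - (w ⬝ᵥ B *ᵥ w) ^ 2 ≤ 8 * τ + 72 * F ^ 2 / N ^ 2) ∧
      (0 ≤ ρ → ρ - 21 * F / N ≤ w ⬝ᵥ B *ᵥ w) := by
  intro w
  obtain ⟨hd, δ, hδ, hδ9⟩ := reflVec_spec hv hN h1 h2
  have hw : w ⬝ᵥ w = 1 := reflVec_dot_self hd
  change N • w = v + δ at hδ
  have hvv : v ⬝ᵥ v ≤ (2 * N) ^ 2 := by nlinarith
  have hvpos : 0 < v ⬝ᵥ v := by nlinarith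
  have hN0 : 0 < N := by linarith
  constructor
  · have hρF : ρ ^ 2 ≤ F ^ 2 := by
      have h3 := dot_sq_le v (B *ᵥ v)
      rw [hρ] at h3
      have h4 := hF v
      have : ρ ^ 2 * (v ⬝ᵥ v) ^ 2 ≤ F ^ 2 * (v ⬝ᵥ v) ^ 2 := by nlinarith
      exact le_of_mul_le_mul_right this (by positivity)
    -- The Rayleigh quotient ρ of v replaces that of w, so that the residual of v and the
    -- perturbation δ separate.
    have h3 : N ^ 2 * ((B *ᵥ w) ⬝ᵥ (B *ᵥ w) - (w ⬝ᵥ B *ᵥ w) ^ 2) ≤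
        N ^ 2 * ((B *ᵥ w - ρ • w) ⬝ᵥ (B *ᵥ w - ρ • w)) := by
      gcongr; exact dot_residual _ _ _ hw
    have h4 : N ^ 2 * ((B *ᵥ w - ρ • w) ⬝ᵥ (B *ᵥ w - ρ • w)) =
        (B *ᵥ (N • w) - ρ • (N • w)) ⬝ᵥ (B *ᵥ (N • w) - ρ • (N • w)) := by
      have : B *ᵥ (N • w) - ρ • (N • w) = N • (B *ᵥ w - ρ • w) := by
        rw [mulVec_smul, smul_sub, smul_comm]
      rw [this, smul_dotProduct, dotProduct_smul, smul_eq_mul, smul_eq_mul]; ring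
    have h5 : B *ᵥ (v + δ) - ρ • (v + δ) = (B *ᵥ v - ρ • v) + (B *ᵥ δ + (-ρ) • δ) := by
      rw [mulVec_add, smul_add, neg_smul]; abel
    have h6 := dot_add_self_le (B *ᵥ v - ρ • v) (B *ᵥ δ + (-ρ) • δ)
    have h7 := dot_add_self_le (B *ᵥ δ) ((-ρ) • δ)
    have h8 : (B *ᵥ v - ρ • v) ⬝ᵥ (B *ᵥ v - ρ • v) =
        (B *ᵥ v) ⬝ᵥ (B *ᵥ v) - ρ ^ 2 * (v ⬝ᵥ v) := by
      simp only [sub_dotProduct, dotProduct_sub, smul_dotProduct, dotProduct_smul, smul_eq_mul,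
        dotProduct_comm (B *ᵥ v) v, hρ]
      ring
    have h9 : ((-ρ) • δ) ⬝ᵥ ((-ρ) • δ) = ρ ^ 2 * (δ ⬝ᵥ δ) := by
      rw [smul_dotProduct, dotProduct_smul, smul_eq_mul, smul_eq_mul]; ring
    have h10 := hF δ
    have hδ0 := dot_self_nonneg δ
    rw [h4, hδ, h5] at h3
    have hτv : (B *ᵥ v) ⬝ᵥ (B *ᵥ v) - ρ ^ 2 * (v ⬝ᵥ v) ≤ τ * (2 * N) ^ 2 := by
      refine hτ.trans ?_
      have hτ0 : 0 ≤ τ := by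
        have : 0 ≤ τ * (v ⬝ᵥ v) := (h8 ▸ dot_self_nonneg (B *ᵥ v - ρ • v)).trans hτ
        exact nonneg_of_mul_nonneg_left this hvpos
      gcongr
    have h11 : F ^ 2 * (δ ⬝ᵥ δ) ≤ F ^ 2 * 9 := by gcongr
    have h12 : ρ ^ 2 * (δ ⬝ᵥ δ) ≤ F ^ 2 * 9 := by gcongr
    -- By |x + y|² ≤ 2|x|² + 2|y|², applied twice: 8τN² is 2τ(2N)², and 72 is 2(2·9 + 2·9).
    have h13 : N ^ 2 * ((B *ᵥ w) ⬝ᵥ (B *ᵥ w) - (w ⬝ᵥ B *ᵥ w) ^ 2) ≤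
        N ^ 2 * (8 * τ + 72 * F ^ 2 / N ^ 2) := by
      have : N ^ 2 * (8 * τ + 72 * F ^ 2 / N ^ 2) = 8 * τ * N ^ 2 + 72 * F ^ 2 := by
        field_simp
      rw [this]
      linarith
    exact le_of_mul_le_mul_left h13 (by positivity)
  · intro hρ0
    have hsym : δ ⬝ᵥ B *ᵥ v = v ⬝ᵥ B *ᵥ δ := by
      rw [dotProduct_mulVec, ← mulVec_transpose, hB.eq, dotProduct_comm]
    have h3 : N ^ 2 * (w ⬝ᵥ B *ᵥ w) = (v + δ) ⬝ᵥ B *ᵥ (v + δ) := by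
      rw [← hδ, mulVec_smul, smul_dotProduct, dotProduct_smul, smul_eq_mul, smul_eq_mul]; ring
    have h4 : (v + δ) ⬝ᵥ B *ᵥ (v + δ) =
        v ⬝ᵥ B *ᵥ v + 2 * (v ⬝ᵥ B *ᵥ δ) + δ ⬝ᵥ B *ᵥ δ := by
      rw [mulVec_add, add_dotProduct, dotProduct_add, dotProduct_add, hsym]; ring
    have hδ9' : δ ⬝ᵥ δ ≤ 3 ^ 2 := by linarith
    have h5 := abs_le.1 (abs_dot_mulVec_le hF0 hF (by positivity) (by norm_num) hvv hδ9')
    have h6 := abs_le.1 (abs_dot_mulVec_le hF0 hF (by norm_num) (by norm_num) hδ9' hδ9')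
    -- The cross terms cost 2·(2N)·F·3 = 12FN and the term quadratic in δ costs 9F ≤ 9FN.
    have h7 : N ^ 2 * (ρ - 21 * F / N) ≤ N ^ 2 * (w ⬝ᵥ B *ᵥ w) := by
      have e1 : N ^ 2 * (ρ - 21 * F / N) = ρ * N ^ 2 - 21 * (F * N) := by field_simp
      have e2 : ρ * N ^ 2 ≤ ρ * (v ⬝ᵥ v) := by gcongr
      have e3 : F ≤ F * N := le_mul_of_one_le_right hF0 hN
      rw [e1, h3, h4, hρ]
      linarith [h5.1, h6.1]
    exact le_of_mul_le_mul_left h7 (by positivity)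

set_option maxHeartbeats 1000000 in
/-- Some iterate of the power method applied to `s + B` and a coordinate vector leads to a unit
vector that is an approximate eigenvector of `B` for a large eigenvalue. -/
theorem exists_good_iterate {s F L : ℝ} (hB : B.IsSymm) (hF0 : 0 < F)
    (hF : ∀ x, (B *ᵥ x) ⬝ᵥ (B *ᵥ x) ≤ F ^ 2 * (x ⬝ᵥ x))
    (hs : ∀ x, |x ⬝ᵥ B *ᵥ x| ≤ s * (x ⬝ᵥ x)) (hs1 : 1 ≤ s) (hsF : s ≤ n * F)
    {x : Fin n → ℝ} (hx0 : x ≠ 0) (hx : B *ᵥ x = L • x) (hL : 0 < L) {a c : ℕ} (hc : 1 ≤ c)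
    (haL : F ≤ a * L) :
    ∃ (i : Fin n) (k : ℕ), k < 2 * n ^ 2 * a + 32 * n ^ 2 * c ^ 2 ∧
      let v := powSeq (s • 1 + B) (((n * (84 * a + 9 * c + 1) : ℕ) : ℝ) • Pi.single i 1) k
      ∀ N : ℝ, 0 ≤ N → N ^ 2 ≤ v ⬝ᵥ v → v ⬝ᵥ v ≤ (N + 1) ^ 2 →
        let w := reflVec v N i
        0 < (v + N • Pi.single i 1) ⬝ᵥ (v + N • Pi.single i (1 : ℝ)) ∧
        c ^ 2 * ((B *ᵥ w) ⬝ᵥ (B *ᵥ w) - (w ⬝ᵥ B *ᵥ w) ^ 2) ≤ 2 * F ^ 2 ∧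
        L / 4 ≤ w ⬝ᵥ B *ᵥ w := by
  have hxx : 0 < x ⬝ᵥ x := (dot_self_nonneg x).lt_of_ne fun h => hx0 (by
    exact dotProduct_self_eq_zero.1 h.symm)
  have hn : 0 < n := by
    rcases Nat.eq_zero_or_pos n with rfl | h
    · exact absurd (Subsingleton.elim _ _) hx0
    · exact h
  have hn' : (1 : ℝ) ≤ n := by exact_mod_cast hn
  -- Some coordinate carries at least the average share of |x|²; the method is started there.
  obtain ⟨i, hi⟩ : ∃ i, x ⬝ᵥ x ≤ n * x i ^ 2 := by
    by_contra! hcon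
    have := Finset.sum_lt_sum_of_nonempty (s := Finset.univ) ⟨⟨0, hn⟩, Finset.mem_univ _⟩
      fun i _ => hcon i
    rw [← Finset.mul_sum] at this
    simp only [Finset.sum_const, Finset.card_univ, Fintype.card_fin, nsmul_eq_mul] at this
    have h2 : ∑ i, x i ^ 2 = x ⬝ᵥ x := by simp only [dotProduct, pow_two]
    rw [h2] at this
    linarith
  have hLs : L ≤ s := by
    have := (abs_le.1 (hs x)).2
    rw [hx, dotProduct_smul, smul_eq_mul] at this
    exact le_of_mul_le_mul_right this hxx
  set Q : ℝ := ((n * (84 * a + 9 * c + 1) : ℕ) : ℝ) with hQ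
  set M : Matrix (Fin n) (Fin n) ℝ := s • 1 + B with hM
  set e : Fin n → ℝ := Q • Pi.single i 1 with he
  have hMx (y) : M *ᵥ y = s • y + B *ᵥ y := by rw [hM, add_mulVec, smul_mulVec, one_mulVec]
  have hMs : M.IsSymm := by
    rw [hM, Matrix.IsSymm, transpose_add, transpose_smul, transpose_one, hB.eq]
  have hM0 (y) : 0 ≤ y ⬝ᵥ M *ᵥ y := by
    rw [hMx, dotProduct_add, dotProduct_smul, smul_eq_mul]
    linarith [(abs_le.1 (hs y)).1]
  have hMR (y) : y ⬝ᵥ M *ᵥ y ≤ 2 * s * (y ⬝ᵥ y) := by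
    rw [hMx, dotProduct_add, dotProduct_smul, smul_eq_mul]
    linarith [(abs_le.1 (hs y)).2]
  have hMe : M *ᵥ x = (s + L) • x := by rw [hMx, hx, add_smul]
  have hθ : 1 ≤ s + L := by linarith
  have hQ1 : n * (84 * a + 9 * c + 1 : ℝ) = Q := by rw [hQ]; push_cast; ring
  have hQpos : 0 < Q := by rw [← hQ1]; positivity
  have hm0 : powMom M e 0 = Q ^ 2 := by
    simp [powMom, powSeq, he]; ring
  have hlow (k) : (s + L) ^ (2 * k) * Q ^ 2 ≤ n * powMom M e (2 * k) := by
    have h1 := powMom_ge_of_eigenvector (e := e) hMs hMe k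
    have h2 : x ⬝ᵥ e = Q * x i := by simp [he]
    rw [h2] at h1
    have h3 : (s + L) ^ (2 * k) * Q ^ 2 * (x ⬝ᵥ x) ≤ (s + L) ^ (2 * k) * Q ^ 2 * (n * x i ^ 2) := by
      gcongr
    have h4 : (s + L) ^ (2 * k) * Q ^ 2 * (n * x i ^ 2) = n * ((s + L) ^ k * (Q * x i)) ^ 2 := by
      ring
    have h5 : n * ((s + L) ^ k * (Q * x i)) ^ 2 ≤ n * ((x ⬝ᵥ x) * powMom M e (2 * k)) := by
      gcongr
    refine le_of_mul_le_mul_right ?_ hxx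
    linarith
  have hpos (k) : 0 < powMom M e (2 * k) := by
    have h1 := hlow k
    have h2 : 0 < (s + L) ^ (2 * k) * Q ^ 2 := by positivity
    have h3 : (0 : ℝ) < n := by linarith
    exact pos_of_mul_pos_right (h2.trans_le h1) h3.le
  have hK : 0 < 32 * n ^ 2 * c ^ 2 := by positivity
  -- The first 2n²a steps make the Rayleigh quotient large; the window of 32n²c² steps makes the
  -- residual small.
  obtain ⟨k, hk0, hk1, hres, hray⟩ := exists_approx_eigenvector hMs hM0 hMR hpos (2 * n ^ 2 * a) hK
  refine ⟨i, k, hk1, ?_⟩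
  intro v N hN0 h1 h2 w
  have hv0 : v ⬝ᵥ v = powMom M e (2 * k) := by rw [two_mul]; exact powSeq_dot hMs k k
  have hv1 : v ⬝ᵥ M *ᵥ v = powMom M e (2 * k + 1) := by
    rw [two_mul, add_assoc]; exact powSeq_dot hMs k (k + 1)
  have hv2 : (M *ᵥ v) ⬝ᵥ (M *ᵥ v) = powMom M e (2 * k + 2) := by
    have : 2 * k + 2 = (k + 1) + (k + 1) := by ring
    rw [this]; exact powSeq_dot hMs (k + 1) (k + 1)
  -- The coordinate Q v_i is the moment e·M^k e, which is nonnegative.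
  have hvi : 0 ≤ v i := by
    have h3 : powMom M e k = Q * v i := by
      change e ⬝ᵥ v = _
      simp [he]
    have h4 := powMom_nonneg (e := e) hMs hM0 k
    rw [h3] at h4
    exact nonneg_of_mul_nonneg_right h4 hQpos
  have hvpos : 0 < v ⬝ᵥ v := hv0 ▸ hpos k
  -- From Q² ≤ n|v|² ≤ (n(N + 1))². The summand 1 in Q pays for rounding |v| down to N.
  have hNbig : (84 * a + 9 * c : ℝ) ≤ N := by
    have h3 : Q ^ 2 ≤ (n * (N + 1)) ^ 2 := by
      have h4 := hlow k
      have h5 : Q ^ 2 ≤ (s + L) ^ (2 * k) * Q ^ 2 :=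
        le_mul_of_one_le_left (sq_nonneg Q) (one_le_pow₀ hθ)
      rw [← hv0] at h4
      calc Q ^ 2 ≤ n * (v ⬝ᵥ v) := h5.trans h4
        _ ≤ n * (N + 1) ^ 2 := by gcongr
        _ ≤ n ^ 2 * (N + 1) ^ 2 := by
            have : (n : ℝ) ≤ n ^ 2 := by nlinarith
            gcongr
        _ = _ := by ring
    have h4 : Q ≤ n * (N + 1) := le_of_sq_le_sq h3 (by positivity)
    rw [← hQ1] at h4
    have := le_of_mul_le_mul_left h4 (by linarith)
    linarith
  have hc' : (1 : ℝ) ≤ c := by exact_mod_cast hc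
  have ha0 : (0 : ℝ) ≤ a := Nat.cast_nonneg a
  have hN1 : 1 ≤ N := by linarith
  set r := powMom M e (2 * k + 1) / powMom M e (2 * k) with hr
  have hrm : powMom M e (2 * k + 1) = r * (v ⬝ᵥ v) := by
    rw [hr, hv0, div_mul_cancel₀ _ (hpos k).ne']
  set ρ := r - s with hρdef
  have hρ : v ⬝ᵥ B *ᵥ v = ρ * (v ⬝ᵥ v) := by
    have h3 := hv1
    rw [hMx, dotProduct_add, dotProduct_smul, smul_eq_mul, hrm] at h3
    rw [hρdef]; linarith
  have hBB : (B *ᵥ v) ⬝ᵥ (B *ᵥ v) = powMom M e (2 * k + 2) - 2 * s * (ρ * (v ⬝ᵥ v))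
      - s ^ 2 * (v ⬝ᵥ v) := by
    rw [← hv2, hMx]
    simp only [add_dotProduct, dotProduct_add, smul_dotProduct, dotProduct_smul, smul_eq_mul,
      dotProduct_comm (B *ᵥ v) v, hρ]
    ring
  have hKr : (0 : ℝ) < ((32 * n ^ 2 * c ^ 2 : ℕ) : ℝ) := by exact_mod_cast hK
  -- The shift by s does not change the residual, and (2s)² / (32n²c²) ≤ F² / (8c²) because s ≤ nF.
  have hτ : (B *ᵥ v) ⬝ᵥ (B *ᵥ v) - ρ ^ 2 * (v ⬝ᵥ v) ≤ F ^ 2 / (8 * c ^ 2) * (v ⬝ᵥ v) := by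
    rw [hBB]
    rw [← hv0, hrm] at hres
    have h3 : ((32 * n ^ 2 * c ^ 2 : ℕ) : ℝ) * (powMom M e (2 * k + 2) - r ^ 2 * (v ⬝ᵥ v)) ≤
        (2 * s) ^ 2 * (v ⬝ᵥ v) := by
      refine le_of_mul_le_mul_right ?_ hvpos
      linarith
    have h4 : (2 * s) ^ 2 * (v ⬝ᵥ v) ≤ (2 * (n * F)) ^ 2 * (v ⬝ᵥ v) := by gcongr
    have h5 : (2 * (n * F)) ^ 2 * (v ⬝ᵥ v) = ((32 * n ^ 2 * c ^ 2 : ℕ) : ℝ) *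
        (F ^ 2 / (8 * c ^ 2) * (v ⬝ᵥ v)) := by
      push_cast; field_simp; ring
    have h6 := le_of_mul_le_mul_left (h5 ▸ h3.trans h4) hKr
    have h7 : powMom M e (2 * k + 2) - 2 * s * (ρ * (v ⬝ᵥ v)) - s ^ 2 * (v ⬝ᵥ v)
        - ρ ^ 2 * (v ⬝ᵥ v) = powMom M e (2 * k + 2) - r ^ 2 * (v ⬝ᵥ v) := by rw [hρdef]; ring
    rw [h7]; exact h6
  -- If ρ < L/2, then r < s + L/2 ≤ 3s/2, so s + L exceeds r by a factor of at least 1 + L/(3s).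
  -- Comparing the lower bound (s + L)^(2k) Q²/n for m_(2k) with the upper bound Q² r^(2k) gives (1
  -- + L/(3s))^(2k) ≤ n. Bernoulli refutes this, since s ≤ naL and k ≥ 2n²a give 2kL/(3s) ≥ n.
  have hρL : L / 2 ≤ ρ := by
    by_contra! hcon
    have hr0 : 0 < r := by
      rw [hr]
      exact div_pos (powMom_pos hMs hM0 hpos _) (hpos k)
    have hrs : r < s + L / 2 := by linarith
    have h3 : (s + L) ^ (2 * k) ≤ n * r ^ (2 * k) := by
      have h4 := (hlow k).trans (mul_le_mul_of_nonneg_left hray (by linarith : (0 : ℝ) ≤ n))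
      rw [hm0] at h4
      refine le_of_mul_le_mul_right (h4.trans_eq ?_) (by positivity : 0 < Q ^ 2)
      ring
    have h4 : (1 + L / (3 * s)) * r ≤ s + L := by
      have h5 : L / (3 * s) * r ≤ L / 2 := by
        rw [div_mul_eq_mul_div, div_le_iff₀ (by linarith)]
        have h6 : L * r ≤ L * (3 / 2 * s) := mul_le_mul_of_nonneg_left (by linarith) hL.le
        linarith
      linarith
    have hLs0 : 0 < L / (3 * s) := by positivity
    have h5 : (1 + L / (3 * s)) ^ (2 * k) * r ^ (2 * k) ≤ n * r ^ (2 * k) := by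
      rw [← mul_pow]
      exact (pow_le_pow_left₀ (by positivity) h4 _).trans h3
    have h6 := le_of_mul_le_mul_right h5 (by positivity)
    have h7 := one_add_mul_le_pow (show (-2 : ℝ) ≤ L / (3 * s) by linarith) (2 * k)
    have h8 : (n : ℝ) ≤ ((2 * k : ℕ) : ℝ) * (L / (3 * s)) := by
      rw [← mul_div_assoc, le_div_iff₀ (by linarith)]
      have h9 : (2 * n ^ 2 * a : ℝ) ≤ k := by exact_mod_cast hk0
      have h10 : s ≤ n * (a * L) := hsF.trans (by gcongr)
      push_cast
      calc (n : ℝ) * (3 * s) ≤ n * (3 * (n * (a * L))) := by gcongr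
        _ ≤ 2 * (2 * n ^ 2 * a) * L := by
            have : 0 ≤ (n : ℝ) ^ 2 * a * L := by positivity
            linarith
        _ ≤ 2 * k * L := by gcongr
    linarith
  obtain ⟨hA, hC⟩ := reflVec_residual hF0.le hB hF hvi hN1 h1 h2 hρ hτ
  refine ⟨(reflVec_spec hvi hN1 h1 h2).1, ?_, ?_⟩
  -- Here N ≥ 9c gives 72/81 = 8/9; with 8τ = F²/c² the sum is (17/9) F²/c².
  · have h3 : F ^ 2 * 72 / N ^ 2 ≤ 8 / 9 * (F ^ 2 / c ^ 2) := by
      rw [div_le_iff₀ (by positivity)]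
      have h4 : (9 * c : ℝ) ^ 2 ≤ N ^ 2 := by gcongr; linarith
      calc F ^ 2 * 72 = 8 / 9 * (F ^ 2 / c ^ 2) * (9 * c) ^ 2 := by field_simp; ring
        _ ≤ _ := by gcongr
    have h4 : (c : ℝ) ^ 2 * (8 * (F ^ 2 / (8 * c ^ 2)) + 8 / 9 * (F ^ 2 / c ^ 2)) ≤ 2 * F ^ 2 := by
      have : (c : ℝ) ^ 2 * (8 * (F ^ 2 / (8 * c ^ 2)) + 8 / 9 * (F ^ 2 / c ^ 2)) =
        (1 + 8 / 9) * F ^ 2 := by field_simp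
      rw [this]
      have := sq_nonneg F
      linarith
    refine le_trans ?_ h4
    gcongr
    refine hA.trans ?_
    rw [mul_comm (72 : ℝ)]
    linarith
  · have h3 := hC (by linarith)
    -- From N ≥ 84a and F ≤ aL: the 84 is 4·21.
    have h4 : 21 * F / N ≤ L / 4 := by
      rw [div_le_iff₀ (by linarith)]
      have : L / 4 * (84 * a) ≤ L / 4 * N := by gcongr; linarith
      linarith
    change ρ - 21 * F / N ≤ w ⬝ᵥ B *ᵥ w at h3
    linarith

end

end GaussDecomp

namespace GaussDecomp

/-! ### Bit lengths -/

theorem bitLen_le_iff {z : ℤ} {k : ℕ} : bitLen z ≤ k + 1 ↔ z.natAbs < 2 ^ k := by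
  rw [bitLen, Nat.add_le_add_iff_right, Nat.size_le]

theorem one_le_bitLen (z : ℤ) : 1 ≤ bitLen z := Nat.le_add_left 1 _

theorem bitLen_le_of_natAbs_le {x y : ℤ} (h : x.natAbs ≤ y.natAbs) : bitLen x ≤ bitLen y :=
  Nat.add_le_add_right (Nat.size_le_size h) 1

theorem bitLen_add_le_of_le {x y : ℤ} {k : ℕ} (hx : bitLen x ≤ k) (hy : bitLen y ≤ k) :
    bitLen (x + y) ≤ k + 1 := by
  obtain ⟨k, rfl⟩ : ∃ k', k = k' + 1 := ⟨k - 1, by have := one_le_bitLen x; omega⟩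
  rw [bitLen_le_iff] at *
  have := Int.natAbs_add_le x y
  rw [pow_succ]; omega

theorem bitLen_add_le (x y : ℤ) : bitLen (x + y) ≤ bitLen x + bitLen y := by
  have hx := one_le_bitLen x
  have hy := one_le_bitLen y
  refine (bitLen_add_le_of_le (le_max_left _ _) (le_max_right _ _)).trans ?_
  rcases max_cases (bitLen x) (bitLen y) with h | h <;> omega

theorem bitLen_neg (x : ℤ) : bitLen (-x) = bitLen x := by rw [bitLen, bitLen, Int.natAbs_neg]

theorem bitLen_sub_le (x y : ℤ) : bitLen (x - y) ≤ bitLen x + bitLen y := by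
  rw [sub_eq_add_neg, ← bitLen_neg y]; exact bitLen_add_le _ _

theorem bitLen_mul_le (x y : ℤ) : bitLen (x * y) ≤ bitLen x + bitLen y := by
  obtain ⟨k, hk⟩ : ∃ k, bitLen x = k + 1 := ⟨bitLen x - 1, by have := one_le_bitLen x; omega⟩
  obtain ⟨l, hl⟩ : ∃ l, bitLen y = l + 1 := ⟨bitLen y - 1, by have := one_le_bitLen y; omega⟩
  have h1 := bitLen_le_iff.1 hk.le
  have h2 := bitLen_le_iff.1 hl.le
  have : bitLen (x * y) ≤ k + l + 1 := by
    rw [bitLen_le_iff, Int.natAbs_mul, pow_add]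
    exact Nat.mul_lt_mul'' h1 h2
  omega

theorem bitLen_div_le (x y : ℤ) : bitLen (x / y) ≤ bitLen x :=
  bitLen_le_of_natAbs_le (Int.natAbs_ediv_le_natAbs x y)

theorem bitLen_natCast_le (k : ℕ) : bitLen k ≤ k + 1 := by
  rw [bitLen_le_iff, Int.natAbs_natCast]; exact Nat.lt_two_pow_self

theorem bitLen_sum_le {g : ℕ → ℤ} {w N : ℕ} (hw : 1 ≤ w) (h : ∀ k < N, bitLen (g k) ≤ w) :
    bitLen (∑ k ∈ Finset.range N, g k) ≤ w + N := by
  induction N with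
  | zero => simpa [bitLen] using hw
  | succ N ih =>
    rw [Finset.sum_range_succ]
    refine bitLen_add_le_of_le (ih fun k hk => h k (by omega)) ?_
    exact (h N (by omega)).trans (Nat.le_add_right _ _)

/-! ### Expressions -/

instance : Add Expr := ⟨.op .add⟩
instance : Sub Expr := ⟨.op .sub⟩
instance : Mul Expr := ⟨.op .mul⟩
instance : Div Expr := ⟨.op .div⟩
instance (k : ℕ) : OfNat Expr k := ⟨.const k⟩

namespace Expr

/-- The cell `(0, 0)` of an array, used as a variable. -/
def var (a : ℕ) : Expr := read a 0 0

variable (σ : Store)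

@[simp] theorem val_ofNat (k : ℕ) [k.AtLeastTwo] : (ofNat(k) : Expr).val σ = (ofNat(k) : ℤ) := rfl
@[simp] theorem val_zero : (0 : Expr).val σ = 0 := rfl
@[simp] theorem val_one : (1 : Expr).val σ = 1 := rfl
@[simp] theorem val_add (x y : Expr) : (x + y).val σ = x.val σ + y.val σ := rfl
@[simp] theorem val_sub (x y : Expr) : (x - y).val σ = x.val σ - y.val σ := rfl
@[simp] theorem val_mul (x y : Expr) : (x * y).val σ = x.val σ * y.val σ := rfl
@[simp] theorem val_div (x y : Expr) : (x / y).val σ = x.val σ / y.val σ := rfl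
@[simp] theorem val_read (a : ℕ) (i j : Expr) :
    (read a i j).val σ = σ a (i.val σ).toNat (j.val σ).toNat := rfl
@[simp] theorem val_var (a : ℕ) : (var a).val σ = σ a 0 0 := rfl

/-- The size of an expression, constants being counted in unary. -/
def sz : Expr → ℕ
  | const z => z.natAbs + 1
  | read _ i j => i.sz + j.sz + 1
  | op _ x y => x.sz + y.sz

/-- A bound for the bit length of the value of an expression, from bounds for the contents of the
arrays. -/
def bits (β : ℕ → ℕ) : Expr → ℕ
  | const z => bitLen z
  | read a _ _ => β a
  | op .add x y => x.bits β + y.bits β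
  | op .sub x y => x.bits β + y.bits β
  | op .mul x y => x.bits β + y.bits β
  | op .div x _ => x.bits β

variable (β : ℕ → ℕ)

@[simp] theorem bits_ofNat (k : ℕ) [k.AtLeastTwo] :
    (ofNat(k) : Expr).bits β = bitLen (ofNat(k) : ℤ) := rfl
@[simp] theorem bits_zero : (0 : Expr).bits β = 1 := by simp [bits, bitLen]
@[simp] theorem bits_one : (1 : Expr).bits β = 2 := by simp [bits, bitLen]
@[simp] theorem bits_add (x y : Expr) : (x + y).bits β = x.bits β + y.bits β := rfl
@[simp] theorem bits_sub (x y : Expr) : (x - y).bits β = x.bits β + y.bits β := rfl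
@[simp] theorem bits_mul (x y : Expr) : (x * y).bits β = x.bits β + y.bits β := rfl
@[simp] theorem bits_div (x y : Expr) : (x / y).bits β = x.bits β := rfl
@[simp] theorem bits_read (a : ℕ) (i j : Expr) : (read a i j).bits β = β a := rfl
@[simp] theorem bits_var (a : ℕ) : (var a).bits β = β a := rfl

end Expr

/-- The contents of array `a` have at most `β a` bits. -/
def Ok (β : ℕ → ℕ) (σ : Store) : Prop := ∀ a i j, bitLen (σ a i j) ≤ β a

variable {β : ℕ → ℕ} {σ : Store} {W : ℕ}

theorem Ok.bitLen_val_le (h : Ok β σ) (e : Expr) : bitLen (e.val σ) ≤ e.bits β := by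
  induction e with
  | const z => exact le_rfl
  | read a i j => exact h _ _ _
  | op o x y hx hy =>
    cases o
    · exact (bitLen_add_le _ _).trans (Nat.add_le_add hx hy)
    · exact (bitLen_sub_le _ _).trans (Nat.add_le_add hx hy)
    · exact (bitLen_mul_le _ _).trans (Nat.add_le_add hx hy)
    · exact (bitLen_div_le _ _).trans hx

theorem Expr.one_le_sz (e : Expr) : 1 ≤ e.sz := by
  induction e with
  | const z => exact Nat.le_add_left _ _
  | read a i j => exact Nat.le_add_left _ _
  | op o x y hx hy => exact hx.trans (Nat.le_add_right _ _)

/-- An operation costs at most sz(x)·sz(y)·W². The exponent 3 on the size lets the induction absorb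
it, as x³ + y³ + xy ≤ (x + y)³ for sizes. -/
theorem Ok.cost_le (h : Ok β σ) (hβ : ∀ a, β a ≤ W) (hW : 1 ≤ W) (e : Expr) :
    bitLen (e.val σ) ≤ e.sz * W ∧ e.cost σ ≤ e.sz ^ 3 * W ^ 2 := by
  have hWW : W ≤ W ^ 2 := Nat.le_self_pow two_ne_zero W
  induction e with
  | const z =>
    have h1 : bitLen z ≤ z.natAbs + 1 := by
      rw [bitLen_le_iff]; exact Nat.lt_two_pow_self
    have h2 : bitLen z ≤ (z.natAbs + 1) * W := h1.trans (Nat.le_mul_of_pos_right _ hW)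
    refine ⟨h2, h2.trans ?_⟩
    exact Nat.mul_le_mul (Nat.le_self_pow (by norm_num) _) hWW
  | read a i j hi hj =>
    have h1 : bitLen ((Expr.read a i j).val σ) ≤ W := (h _ _ _).trans (hβ a)
    refine ⟨h1.trans (Nat.le_mul_of_pos_left _ (by simp [Expr.sz])), ?_⟩
    calc (Expr.read a i j).cost σ = i.cost σ + j.cost σ + bitLen ((Expr.read a i j).val σ) := rfl
      _ ≤ i.sz ^ 3 * W ^ 2 + j.sz ^ 3 * W ^ 2 + W ^ 2 := by
        gcongr
        exacts [hi.2, hj.2, h1.trans hWW]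
      _ = (i.sz ^ 3 + j.sz ^ 3 + 1) * W ^ 2 := by ring
      _ ≤ (i.sz + j.sz + 1) ^ 3 * W ^ 2 := by
        gcongr
        have : (i.sz + j.sz + 1) ^ 3 = i.sz ^ 3 + j.sz ^ 3 + 1 + 3 * (i.sz + j.sz) *
          (i.sz * j.sz + i.sz + j.sz + 1) := by ring
        rw [this]; exact Nat.le_add_right _ _
  | op o x y hx hy =>
    have h3 : x.sz ^ 3 + y.sz ^ 3 + x.sz * y.sz ≤ (x.sz + y.sz) ^ 3 := by
      have : (x.sz + y.sz) ^ 3 = x.sz ^ 3 + y.sz ^ 3 + x.sz * y.sz * (3 * (x.sz + y.sz)) := by ring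
      rw [this]
      exact Nat.add_le_add_left
        (Nat.le_mul_of_pos_right _ (by have := x.one_le_sz; omega)) _
    constructor
    · have hadd : bitLen (x.val σ) + bitLen (y.val σ) ≤ (x.sz + y.sz) * W := by
        rw [add_mul]; exact Nat.add_le_add hx.1 hy.1
      cases o
      · exact (bitLen_add_le _ _).trans hadd
      · exact (bitLen_sub_le _ _).trans hadd
      · exact (bitLen_mul_le _ _).trans hadd
      · exact (bitLen_div_le _ _).trans ((Nat.le_add_right _ _).trans hadd)
    · calc (Expr.op o x y).cost σ = x.cost σ + y.cost σ + bitLen (x.val σ) * bitLen (y.val σ) := rfl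
        _ ≤ x.sz ^ 3 * W ^ 2 + y.sz ^ 3 * W ^ 2 + (x.sz * W) * (y.sz * W) := by
          gcongr
          exacts [hx.2, hy.2, hx.1, hy.1]
        _ = (x.sz ^ 3 + y.sz ^ 3 + x.sz * y.sz) * W ^ 2 := by ring
        _ ≤ (x.sz + y.sz) ^ 3 * W ^ 2 := by gcongr

/-! ### Stores -/

/-- Outside of the arrays in `S` the stores agree. -/
def Frame (S : List ℕ) (σ σ' : Store) : Prop := ∀ a, a ∉ S → σ' a = σ a

theorem Frame.refl (S : List ℕ) (σ : Store) : Frame S σ σ := fun _ _ => rfl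

theorem Frame.trans {S S' T : List ℕ} {σ σ' σ'' : Store} (h : Frame S σ σ') (h' : Frame S' σ' σ'')
    (hS : S ⊆ T) (hS' : S' ⊆ T) : Frame T σ σ'' := fun a ha => by
  rw [h' a fun h => ha (hS' h), h a fun h => ha (hS h)]

theorem Frame.mono {S T : List ℕ} {σ σ' : Store} (h : Frame S σ σ') (hS : S ⊆ T) : Frame T σ σ' :=
  fun a ha => h a fun h' => ha (hS h')

theorem Store.set_ne {a a' i j : ℕ} {z : ℤ} (h : a' ≠ a) : σ.set a i j z a' = σ a' := by
  funext i' j'; simp [Store.set, h]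

theorem Store.set_cell_ne {a a' i j i' j' : ℕ} {z : ℤ} (h : ¬(a' = a ∧ i' = i ∧ j' = j)) :
    σ.set a i j z a' i' j' = σ a' i' j' := by
  simp only [Store.set, h, if_false]

theorem Store.set_self {a i j : ℕ} {z : ℤ} : σ.set a i j z a i j = z := by simp [Store.set]

theorem Frame.set {S : List ℕ} {σ σ' : Store} (h : Frame S σ σ') {a : ℕ} (ha : a ∈ S) (i j : ℕ)
    (z : ℤ) : Frame S σ (σ'.set a i j z) := fun a' ha' => by
  rw [Store.set_ne (by rintro rfl; exact ha' ha), h a' ha']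

theorem Ok.set (h : Ok β σ) {a : ℕ} {z : ℤ} (hz : bitLen z ≤ β a) (i j : ℕ) :
    Ok β (σ.set a i j z) := fun a' i' j' => by
  by_cases h' : a' = a ∧ i' = i ∧ j' = j
  · obtain ⟨rfl, rfl, rfl⟩ := h'; rwa [Store.set_self]
  · rw [Store.set_cell_ne h']; exact h _ _ _

/-! ### Commands -/

/-- A bound for the cost of an elementary step with operands of at most `W` bits. -/
def stepCost (W : ℕ) : ℕ := 2 * 1000 ^ 3 * W ^ 2

/-- Started in `σ`, the program `c` halts after at most `T` elementary steps in a store that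
satisfies `Q`. -/
def Runs (W : ℕ) (c : Cmd) (σ : Store) (T : ℕ) (Q : Store → Prop) : Prop :=
  ∃ t σ', Exec c σ t σ' ∧ t ≤ T * stepCost W ∧ Q σ'

variable {c d : Cmd} {T T' : ℕ} {Q R : Store → Prop}

theorem Runs.mono (h : Runs W c σ T R) (hT : T ≤ T') (hQ : ∀ σ', R σ' → Q σ') :
    Runs W c σ T' Q := by
  obtain ⟨t, σ', h1, h2, h3⟩ := h
  exact ⟨t, σ', h1, h2.trans (Nat.mul_le_mul_right _ hT), hQ _ h3⟩

theorem one_le_stepCost (hW : 1 ≤ W) : 1 ≤ stepCost W :=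
  Nat.mul_pos (by norm_num) (by positivity)

theorem Runs.skip (hW : 1 ≤ W) (hQ : Q σ) : Runs W .skip σ 1 Q :=
  ⟨1, σ, .skip σ, by rw [one_mul]; exact one_le_stepCost hW, hQ⟩

theorem Runs.seq (h : Runs W c σ T R) (h' : ∀ σ', R σ' → Runs W d σ' T' Q) :
    Runs W (.seq c d) σ (T + T') Q := by
  obtain ⟨t, σ', h1, h2, h3⟩ := h
  obtain ⟨t', σ'', h1', h2', h3'⟩ := h' σ' h3
  exact ⟨t + t', σ'', h1.seq h1', by rw [add_mul]; omega, h3'⟩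

theorem step_le {x : ℕ} (hW : 1 ≤ W) (hx : x ≤ 1000 ^ 3 * W ^ 2) : x + 1 ≤ stepCost W := by
  have : 1 ≤ 1000 ^ 3 * W ^ 2 := Nat.mul_pos (by norm_num) (by positivity)
  unfold stepCost; omega

theorem Ok.test_le (h : Ok β σ) (hβ : ∀ a, β a ≤ W) (hW : 1 ≤ W) {e : Expr} (he : e.sz ≤ 1000) :
    e.cost σ + 1 ≤ stepCost W :=
  step_le hW ((h.cost_le hβ hW e).2.trans (by gcongr))

theorem Runs.write (h : Ok β σ) (hβ : ∀ a, β a ≤ W) (hW : 1 ≤ W) {a : ℕ} {i j e : Expr}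
    (hsz : i.sz + j.sz + e.sz ≤ 1000)
    (hQ : Q (σ.set a (i.val σ).toNat (j.val σ).toNat (e.val σ))) :
    Runs W (.write a i j e) σ 1 Q := by
  refine ⟨_, _, .write a i j e σ, ?_, hQ⟩
  rw [one_mul]
  refine step_le hW ?_
  calc i.cost σ + j.cost σ + e.cost σ
      ≤ i.sz ^ 3 * W ^ 2 + j.sz ^ 3 * W ^ 2 + e.sz ^ 3 * W ^ 2 := by
        gcongr
        exacts [(h.cost_le hβ hW i).2, (h.cost_le hβ hW j).2, (h.cost_le hβ hW e).2]
    _ = (i.sz ^ 3 + j.sz ^ 3 + e.sz ^ 3) * W ^ 2 := by ring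
    _ ≤ (i.sz + j.sz + e.sz) ^ 3 * W ^ 2 := by
        gcongr
        have : (i.sz + j.sz + e.sz) ^ 3 = i.sz ^ 3 + j.sz ^ 3 + e.sz ^ 3 +
          3 * (i.sz + j.sz) * (i.sz * j.sz + e.sz * (i.sz + j.sz) + e.sz ^ 2) := by ring
        rw [this]; exact Nat.le_add_right _ _
    _ ≤ 1000 ^ 3 * W ^ 2 := by gcongr

theorem Runs.ite (h : Ok β σ) (hβ : ∀ a, β a ≤ W) (hW : 1 ≤ W) {e : Expr} (he : e.sz ≤ 1000)
    (hc : 0 < e.val σ → Runs W c σ T Q) (hd : ¬ 0 < e.val σ → Runs W d σ T Q) :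
    Runs W (.ite e c d) σ (T + 1) Q := by
  have h0 := h.test_le hβ hW he
  by_cases hp : 0 < e.val σ
  · obtain ⟨t, σ', h1, h2, h3⟩ := hc hp
    exact ⟨_, σ', .ite_pos hp h1, by rw [add_mul]; omega, h3⟩
  · obtain ⟨t, σ', h1, h2, h3⟩ := hd hp
    exact ⟨_, σ', .ite_neg hp h1, by rw [add_mul]; omega, h3⟩

theorem Runs.loop_pos (h : Ok β σ) (hβ : ∀ a, β a ≤ W) (hW : 1 ≤ W) {e : Expr} (he : e.sz ≤ 1000)
    (hp : 0 < e.val σ) (hc : Runs W c σ T R) (hl : ∀ σ', R σ' → Runs W (.loop e c) σ' T' Q) :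
    Runs W (.loop e c) σ (T + 1 + T') Q := by
  have h0 := h.test_le hβ hW he
  obtain ⟨t, σ', h1, h2, h3⟩ := hc
  obtain ⟨t', σ'', h1', h2', h3'⟩ := hl σ' h3
  exact ⟨_, σ'', .loop_pos hp h1 h1', by rw [add_mul, add_mul]; omega, h3'⟩

theorem Runs.loop_neg (h : Ok β σ) (hβ : ∀ a, β a ≤ W) (hW : 1 ≤ W) {e : Expr} (he : e.sz ≤ 1000)
    (hp : ¬ 0 < e.val σ) (hQ : Q σ) : Runs W (.loop e c) σ 1 Q :=
  ⟨_, σ, .loop_neg hp, by rw [one_mul]; exact h.test_le hβ hW he, hQ⟩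

/-- `for x < e do c` -/
def forLoop (x : ℕ) (e : Expr) (c : Cmd) : Cmd :=
  .seq (.write x 0 0 0) (.loop (e - .var x) (.seq c (.write x 0 0 (.var x + 1))))

/-- The invariant must be insensitive to the loop variable (`hI`), since the increment happens after
the body; the limit e is re-evaluated in every round, so the invariant must also determine it. The 2
in T + 2 is the test and the increment. -/
theorem Runs.forLoop (h : Ok β σ) (hβ : ∀ a, β a ≤ W) (hW : 1 ≤ W) {x : ℕ} {e : Expr} {N : ℕ}
    {I : ℕ → Store → Prop} (he : e.sz ≤ 900) (hx : bitLen N ≤ β x)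
    (hI : ∀ k σ z, I k σ → I k (σ.set x 0 0 z)) (hN : ∀ k σ, I k σ → e.val σ = N)
    (hinit : I 0 σ)
    (hstep : ∀ k < N, ∀ σ, Ok β σ → σ x 0 0 = k → I k σ →
      Runs W c σ T (fun σ' => Ok β σ' ∧ σ' x 0 0 = k ∧ I (k + 1) σ')) :
    Runs W (GaussDecomp.forLoop x e c) σ (N * (T + 2) + 2) (fun σ' => Ok β σ' ∧ I N σ') := by
  have hbit (k : ℕ) (hk : k ≤ N) : bitLen k ≤ β x :=
    (bitLen_le_of_natAbs_le (by simpa using hk)).trans hx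
  have hsz : (e - .var x).sz ≤ 1000 := by
    change e.sz + (1 + 1 + 1) ≤ 1000
    omega
  have main (m : ℕ) : ∀ k σ, k + m = N → Ok β σ → σ x 0 0 = k → I k σ →
      Runs W (.loop (e - .var x) (.seq c (.write x 0 0 (.var x + 1)))) σ (m * (T + 2) + 1)
        (fun σ' => Ok β σ' ∧ I N σ') := by
    induction m with
    | zero =>
      intro k σ hk hok hxk hIk
      refine (Runs.loop_neg hok hβ hW hsz ?_ ⟨hok, ?_⟩).mono (by omega) fun _ h => h
      · simp [hN k σ hIk, hxk]; omega
      · rwa [show N = k by omega]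
    | succ m ih =>
      intro k σ hk hok hxk hIk
      have hpos : 0 < (e - .var x).val σ := by simp [hN k σ hIk, hxk]; omega
      refine (Runs.loop_pos (T := T + 1) (T' := m * (T + 2) + 1)
        (R := fun σ' => Ok β σ' ∧ σ' x 0 0 = (k + 1 : ℕ) ∧ I (k + 1) σ')
        hok hβ hW hsz hpos ?_ ?_).mono (by rw [Nat.succ_mul]; omega) fun _ h => h
      · refine (hstep k (by omega) σ hok hxk hIk).seq ?_
        rintro σ' ⟨hok', hx', hI'⟩
        refine Runs.write hok' hβ hW (by change 1 + 1 + ((1 + 1 + 1) + 2) ≤ 1000; norm_num) ?_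
        simp only [Expr.val_add, Expr.val_var, Expr.val_one, Expr.val_zero, hx', Int.toNat_zero]
        exact ⟨hok'.set (hbit (k + 1) (by omega)) 0 0, by rw [Store.set_self]; simp, hI _ _ _ hI'⟩
      · rintro σ' ⟨hok', hx', hI'⟩
        exact ih (k + 1) σ' (by omega) hok' hx' hI'
  refine (Runs.seq (T := 1) (T' := N * (T + 2) + 1)
    (R := fun σ' => Ok β σ' ∧ σ' x 0 0 = (0 : ℕ) ∧ I 0 σ') ?_ ?_).mono (by omega) fun _ h => h
  · refine Runs.write h hβ hW (by decide) ?_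
    simp only [Expr.val_zero, Int.toNat_zero]
    exact ⟨h.set (hbit 0 (by omega)) 0 0, by rw [Store.set_self]; simp, hI _ _ _ hinit⟩
  · rintro σ' ⟨hok', hx', hI'⟩
    exact main N 0 σ' (by omega) hok' hx' hI'

/-- `acc := ∑ x < e, f` -/
def sumLoop (acc x : ℕ) (e f : Expr) : Cmd :=
  .seq (.write acc 0 0 0) (forLoop x e (.write acc 0 0 (.var acc + f)))

theorem Runs.sumLoop (h : Ok β σ) (hβ : ∀ a, β a ≤ W) (hW : 1 ≤ W) {acc x : ℕ} {e f : Expr} {N : ℕ}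
    {g : ℕ → ℤ} {w : ℕ} (hax : acc ≠ x) (he : e.sz ≤ 900) (hf : f.sz ≤ 900) (hx : bitLen N ≤ β x)
    (hN : ∀ σ', Frame [acc, x] σ σ' → e.val σ' = N)
    (hg : ∀ k < N, ∀ σ', Frame [acc, x] σ σ' → σ' x 0 0 = k → f.val σ' = g k)
    (hw : ∀ k < N, bitLen (g k) ≤ w) (hw1 : 1 ≤ w) (hwN : w + N ≤ β acc) :
    Runs W (GaussDecomp.sumLoop acc x e f) σ (3 * N + 3) (fun σ' => Ok β σ' ∧
      Frame [acc, x] σ σ' ∧ σ' acc 0 0 = ∑ k ∈ Finset.range N, g k) := by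
  have hbit (k : ℕ) (hk : k ≤ N) : bitLen (∑ k ∈ Finset.range k, g k) ≤ β acc :=
    (bitLen_sum_le hw1 fun l hl => hw l (by omega)).trans (by omega)
  refine (Runs.seq (T := 1) (T' := N * (1 + 2) + 2)
    (R := fun σ' => Ok β σ' ∧ Frame [acc, x] σ σ' ∧ σ' acc 0 0 = 0) ?_ ?_).mono (by omega)
      fun _ h => h
  · refine Runs.write h hβ hW (by decide) ?_
    simp only [Expr.val_zero, Int.toNat_zero]
    exact ⟨h.set (by simpa using hbit 0 (by omega)) 0 0, (Frame.refl _ _).set (by simp) _ _ _,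
      Store.set_self⟩
  · rintro σ' ⟨hok', hfr, h0⟩
    refine Runs.forLoop (I := fun k σ' => Frame [acc, x] σ σ' ∧ σ' acc 0 0 =
      ∑ k ∈ Finset.range k, g k) hok' hβ hW he hx ?_ (fun k σ' h => hN σ' h.1) ⟨hfr, by simpa⟩ ?_
    · rintro k σ' z ⟨h1, h2⟩
      exact ⟨h1.set (by simp) _ _ _, by rw [Store.set_ne hax, h2]⟩
    · rintro k hk σ' hok hxk ⟨h1, h2⟩
      refine Runs.write hok hβ hW ?_ ?_
      · change 1 + 1 + ((1 + 1 + 1) + f.sz) ≤ 1000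
        omega
      have hv : σ' acc 0 0 + f.val σ' = ∑ k ∈ Finset.range (k + 1), g k := by
        rw [h2, hg k hk σ' h1 hxk, Finset.sum_range_succ]
      simp only [Expr.val_zero, Int.toNat_zero, Expr.val_add, Expr.val_var, hv]
      exact ⟨hok.set (hbit (k + 1) (by omega)) 0 0, by rw [Store.set_ne hax.symm, hxk],
        h1.set (by simp) _ _ _, Store.set_self⟩

/-- `for x < e do (c; a[i, j] := f)` -/
def fillLoop (a x : ℕ) (e : Expr) (c : Cmd) (i j f : Expr) : Cmd :=
  forLoop x e (.seq c (.write a i j f))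

/-- Injectivity of the targets keeps earlier entries from being overwritten. The clause on untouched
cells serves arrays that are filled in several passes, and bodies that read other rows of the array
being filled. -/
theorem Runs.fillLoop (h : Ok β σ) (hβ : ∀ a, β a ≤ W) (hW : 1 ≤ W) {a x : ℕ} {e i j f : Expr}
    {N : ℕ} {g : ℕ → ℤ} {ci cj : ℕ → ℕ} {S : List ℕ} (hax : a ≠ x) (haS : a ∉ S) (hxS : x ∉ S)
    (he : e.sz ≤ 900) (hf : i.sz + j.sz + f.sz ≤ 1000) (hx : bitLen N ≤ β x)
    (hinj : ∀ k < N, ∀ l < N, ci k = ci l → cj k = cj l → k = l)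
    (hN : ∀ σ', Frame (x :: a :: S) σ σ' → e.val σ' = N)
    (hbody : ∀ k < N, ∀ σ', Ok β σ' → Frame (x :: a :: S) σ σ' → σ' x 0 0 = k →
      (∀ i j, (∀ l < N, ¬(ci l = i ∧ cj l = j)) → σ' a i j = σ a i j) →
      Runs W c σ' T fun σ'' => Ok β σ'' ∧ Frame S σ' σ'' ∧ (i.val σ'').toNat = ci k ∧
        (j.val σ'').toNat = cj k ∧ f.val σ'' = g k ∧ bitLen (g k) ≤ β a) :
    Runs W (GaussDecomp.fillLoop a x e c i j f) σ (N * (T + 3) + 2) (fun σ' => Ok β σ' ∧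
      Frame (x :: a :: S) σ σ' ∧ (∀ k < N, σ' a (ci k) (cj k) = g k) ∧
      (∀ i j, (∀ l < N, ¬(ci l = i ∧ cj l = j)) → σ' a i j = σ a i j)) := by
  refine Runs.forLoop (T := T + 1) (I := fun k σ' => Frame (x :: a :: S) σ σ' ∧
    (∀ l < k, σ' a (ci l) (cj l) = g l) ∧
    (∀ i j, (∀ l < N, ¬(ci l = i ∧ cj l = j)) → σ' a i j = σ a i j)) h hβ hW he hx ?_
    (fun k σ' h => hN σ' h.1) ⟨Frame.refl _ _, by simp, fun _ _ _ => rfl⟩ ?_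
  · rintro k σ' z ⟨h1, h2, h3⟩
    refine ⟨h1.set (by simp) _ _ _, ?_, ?_⟩
    · rw [Store.set_ne hax]; exact h2
    · rw [Store.set_ne hax]; exact h3
  · rintro k hk σ' hok hxk ⟨h1, h2, h3⟩
    refine (hbody k hk σ' hok h1 hxk h3).seq ?_
    rintro σ'' ⟨hok'', hfr, hi, hj, hv, hb⟩
    refine Runs.write hok'' hβ hW hf ?_
    rw [hi, hj, hv]
    refine ⟨hok''.set hb _ _, by rw [Store.set_ne hax.symm, hfr x hxS, hxk],
      (h1.trans (T := x :: a :: S) hfr (fun _ h => h)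
        (fun _ h => by simp [h])).set (by simp) _ _ _, ?_, ?_⟩
    · intro l hl
      by_cases hlk : l = k
      · subst hlk; exact Store.set_self
      · rw [Store.set_cell_ne, hfr a haS, h2 l (by omega)]
        rintro ⟨_, h4, h5⟩
        exact hlk (hinj l (by omega) k hk h4 h5)
    · intro i' j' hij
      rw [Store.set_cell_ne, hfr a haS, h3 i' j' hij]
      rintro ⟨_, h4, h5⟩
      exact hij k hk ⟨h4.symm, h5.symm⟩

end GaussDecomp

namespace GaussDecomp

/-! ### The program -/

namespace Expr

/-- `1` if the values are equal and `0` otherwise. -/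
def ind (x y : Expr) : Expr := 1 / (1 + (x - y) * (x - y))

/-- The absolute value. -/
def abs (x : Expr) : Expr := x * (1 + 2 * (x / (x * x + 1)))

/-- An entry of twice the matrix of the quadratic part of the input. -/
def entry (i j : Expr) : Expr := read 1 i j * (1 + ind i j)

/-- The row index of the entry number `var 6` of the matrix. -/
def row : Expr := var 6 / var 0

/-- The column index of the entry number `var 6` of the matrix. -/
def col : Expr := var 6 - var 0 * (var 6 / var 0)

end Expr

open GaussDecomp.Expr GaussDecomp.Cmd

def initCmd : Cmd :=
  .seq (sumLoop 10 6 (var 0 * var 0) (Expr.abs (entry row col)))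
  (.seq (sumLoop 27 6 (var 0 * var 0) (entry row col * entry row col))
  (.seq (sumLoop 28 6 (var 0) (read 2 (var 6) 0 * read 2 (var 6) 0))
  (.write 11 0 0 (var 27 + 2 * var 28))))

/-- Newton's iteration for the integer square root, run downwards from an upper bound. -/
def sqrtLoop : Cmd := .loop (var 20 * var 20 - var 19) (.write 20 0 0 ((var 20 + var 19 / var 20) / 2))

/-- The unit vector belonging to the current iterate, multiplied by a common denominator. -/
def vectorCmd : Cmd :=
  .seq (sumLoop 19 6 (var 0) (read 18 (var 17) (var 6) * read 18 (var 17) (var 6)))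
  (.seq (.write 20 0 0 (var 19 + 1))
  (.seq sqrtLoop
  (.seq (.write 21 0 0 (var 19 + 2 * var 20 * read 18 (var 17) (var 15) + var 20 * var 20))
  (fillLoop 22 6 (var 0) .skip 0 (var 6)
    (2 * (read 18 (var 17) (var 15) + var 20) *
      (read 18 (var 17) (var 6) + var 20 * ind (var 6) (var 15)) - var 21 * ind (var 6) (var 15))))))

def imageCmd : Cmd :=
  .seq (fillLoop 23 8 (var 0) (sumLoop 7 6 (var 0) (entry (var 8) (var 6) * read 22 0 (var 6)))
    0 (var 8) (var 7))
  (.seq (sumLoop 24 6 (var 0) (read 22 0 (var 6) * read 23 0 (var 6)))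
  (sumLoop 25 6 (var 0) (read 23 0 (var 6) * read 23 0 (var 6))))

def outputCmd : Cmd :=
  .seq (sumLoop 26 6 (var 0) (read 2 (var 6) 0 * read 22 0 (var 6)))
  (.seq (.write 3 0 0 (2 * (var 21 * var 21 * var 21 * var 21)))
  (.seq (.write 3 1 0 (var 24 * (var 21 * var 21)))
  (.seq (.write 3 2 0 (2 * var 26 * (var 21 * var 21 * var 21)))
  (.seq (fillLoop 4 6 (var 0) .skip 0 (var 6 + 1)
    (2 * var 21 * (var 21 * var 21 * read 23 0 (var 6) - var 24 * read 22 0 (var 6))))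
  (.seq (fillLoop 5 6 (var 0) .skip (var 6 + 1) 0
    (2 * (var 21 * var 21) * (var 21 * var 21 * read 2 (var 6) 0 - var 26 * read 22 0 (var 6))))
  (fillLoop 4 6 (var 0 * var 0) .skip (row + 1) (col + 1)
    ((2 - ind row col) * (var 21 * var 21 * (var 21 * var 21 * entry row col
      - (read 22 0 row * read 23 0 col + read 23 0 row * read 22 0 col))
      + var 24 * read 22 0 row * read 22 0 col))))))))

/-- The two inequalities that have to hold for an acceptable decomposition. -/
def resCheck : Expr :=
  2 * (read 0 3 0 * read 0 3 0) * var 11 * (var 21 * var 21 * (var 21 * var 21)) + 1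
    - (var 21 * var 21 * var 25 - var 24 * var 24) * (read 0 4 0 * read 0 4 0)

def eigCheck : Expr :=
  40 * (var 24 * var 24) * (read 0 2 0 * read 0 2 0 * (read 0 2 0 * read 0 2 0)) + 1
    - read 0 1 0 * read 0 1 0 * (read 0 1 0 * read 0 1 0) * var 11 *
      (var 21 * var 21 * (var 21 * var 21))

def testCmd : Cmd :=
  .seq vectorCmd (.seq imageCmd
    (.ite (var 21) (.ite resCheck (.ite eigCheck outputCmd .skip) .skip) .skip))

/-- Row k of array 18 holds iterate k, so writing iterate k + 1 never destroys the row being read.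
-/
def updateCmd : Cmd :=
  fillLoop 18 8 (var 0) (sumLoop 7 6 (var 0)
    ((var 10 * ind (var 8) (var 6) + var 16 * entry (var 8) (var 6)) * read 18 (var 17) (var 6)))
    (var 17 + 1) (var 8) (var 7)

def startCmd : Cmd :=
  .seq (.write 15 0 0 (var 14 / 2))
  (.seq (.write 16 0 0 (2 * (var 14 - 2 * (var 14 / 2)) - 1))
  (.seq (fillLoop 18 6 (var 0) .skip 0 (var 6) (var 13 * ind (var 6) (var 15)))
  (forLoop 17 (var 12) (.seq testCmd updateCmd))))

def mainCmd : Cmd :=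
  .seq (.write 12 0 0 (2 * var 0 * var 0 * (read 0 2 0 / read 0 1 0 + 1) +
    32 * var 0 * var 0 * (read 0 4 0 / read 0 3 0 + 1) * (read 0 4 0 / read 0 3 0 + 1)))
  (.seq (.write 13 0 0 (var 0 * (84 * (read 0 2 0 / read 0 1 0 + 1) +
    9 * (read 0 4 0 / read 0 3 0 + 1) + 1)))
  (forLoop 14 (2 * var 0) startCmd))

/-- APPROXIMATE-DECOMPOSE -/
def decomposeCmd : Cmd := .seq initCmd (.ite (var 11) mainCmd (.write 3 0 0 1))

/-! ### What the program computes -/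

/-- The data of an input: the number of variables, the coefficients, and the numerators and
denominators of `ε` and `η`. -/
structure Inst where
  n : ℕ
  quad : ℕ → ℕ → ℤ
  lin : ℕ → ℤ
  en : ℕ
  ed : ℕ
  hn : ℕ
  hd : ℕ

namespace Inst

variable (I : Inst)

def B (i j : ℕ) : ℤ := I.quad i j * (1 + if i = j then 1 else 0)
-- An integer bound for the spectral norm, so that s ± B is positive semidefinite.
def s : ℤ := ∑ t ∈ Finset.range (I.n * I.n), |I.B (t / I.n) (t % I.n)|
def F : ℤ := ∑ t ∈ Finset.range (I.n * I.n), I.B (t / I.n) (t % I.n) * I.B (t / I.n) (t % I.n)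
/-- Twice the variance. -/
def V : ℤ := I.F + 2 * ∑ j ∈ Finset.range I.n, I.lin j * I.lin j
-- The numbers `a` and `c` are integers above 1/ε and 1/η. The constants in `K` and `Q` are those of
-- `exists_good_iterate`.
def a : ℕ := I.ed / I.en + 1
def c : ℕ := I.hd / I.hn + 1
def K : ℕ := 2 * I.n * I.n * I.a + 32 * I.n * I.n * I.c * I.c
def Q : ℕ := I.n * (84 * I.a + 9 * I.c + 1)

/-- The iterates of the power method for the start vector number `i` and the matrix `s + sg B`. -/
def v (i : ℕ) (sg : ℤ) : ℕ → ℕ → ℤ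
  | 0, j => I.Q * if j = i then 1 else 0
  | k + 1, j => ∑ l ∈ Finset.range I.n, (I.s * (if j = l then 1 else 0) + sg * I.B j l) * v i sg k l

def len (v : ℕ → ℤ) : ℕ := Nat.sqrt (∑ j ∈ Finset.range I.n, v j * v j).toNat
def den (v : ℕ → ℤ) (i : ℕ) : ℤ :=
  ∑ j ∈ Finset.range I.n, v j * v j + 2 * I.len v * v i + I.len v * I.len v
def vec (v : ℕ → ℤ) (i j : ℕ) : ℤ :=
  2 * (v i + I.len v) * (v j + I.len v * if j = i then 1 else 0) - I.den v i * if j = i then 1 else 0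
def img (z : ℕ → ℤ) (j : ℕ) : ℤ := ∑ l ∈ Finset.range I.n, I.B j l * z l
def ray (z : ℕ → ℤ) : ℤ := ∑ j ∈ Finset.range I.n, z j * I.img z j
def imgSq (z : ℕ → ℤ) : ℤ := ∑ j ∈ Finset.range I.n, I.img z j * I.img z j
def linDot (z : ℕ → ℤ) : ℤ := ∑ j ∈ Finset.range I.n, I.lin j * z j

/-- The vector `z / d` yields a decomposition with the required properties. -/
def Good (z : ℕ → ℤ) (d : ℤ) : Prop :=
  0 < d ∧ (d * d * I.imgSq z - I.ray z * I.ray z) * (I.hd * I.hd) ≤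
      2 * (I.hn * I.hn) * I.V * (d * d * (d * d)) ∧
    I.en * I.en * (I.en * I.en) * I.V * (d * d * (d * d)) ≤
      40 * (I.ray z * I.ray z) * (I.ed * I.ed * (I.ed * I.ed))

def Acc (v : ℕ → ℤ) (i : ℕ) : Prop := I.Good (I.vec v i) (I.den v i)

/-- The output cells contain the decomposition belonging to `z / d`. -/
def IsOut (z : ℕ → ℤ) (d : ℤ) (σ : Store) : Prop :=
  σ 3 0 0 = 2 * (d * d * d * d) ∧ σ 3 1 0 = I.ray z * (d * d) ∧
  σ 3 2 0 = 2 * I.linDot z * (d * d * d) ∧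
  (∀ j < I.n, σ 4 0 (j + 1) = 2 * d * (d * d * I.img z j - I.ray z * z j)) ∧
  (∀ j < I.n, σ 5 (j + 1) 0 = 2 * (d * d) * (d * d * I.lin j - I.linDot z * z j)) ∧
  (∀ i < I.n, ∀ j < I.n, σ 4 (i + 1) (j + 1) = (2 - if i = j then 1 else 0) *
    (d * d * (d * d * I.B i j - (z i * I.img z j + I.img z i * z j)) + I.ray z * z i * z j))

/-- Cells of the output arrays that stay `0`. -/
def ZeroCells (σ : Store) : Prop := σ 3 3 0 = 0 ∧ σ 4 0 0 = 0 ∧ σ 5 0 0 = 0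

/-- The vector v is arbitrary here: passing the test certifies the output, wherever v came from. -/
def OutInv (σ : Store) : Prop :=
  ZeroCells σ ∧ (σ 3 0 0 = 0 ∨ ∃ v i, i < I.n ∧ I.Acc v i ∧ I.IsOut (I.vec v i) (I.den v i) σ)

/-- The store contains the input. -/
def Inp (σ : Store) : Prop :=
  σ 0 0 0 = I.n ∧ σ 0 1 0 = I.en ∧ σ 0 2 0 = I.ed ∧ σ 0 3 0 = I.hn ∧ σ 0 4 0 = I.hd ∧
    σ 1 = I.quad ∧ ∀ j, σ 2 j 0 = I.lin j

def Base (σ : Store) : Prop :=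
  I.Inp σ ∧ σ 10 0 0 = I.s ∧ σ 11 0 0 = I.V ∧ σ 12 0 0 = I.K ∧ σ 13 0 0 = I.Q

variable {I}

theorem Inp.frame {S : List ℕ} {σ σ' : Store} (h : I.Inp σ) (hf : Frame S σ σ') (h0 : 0 ∉ S)
    (h1 : 1 ∉ S) (h2 : 2 ∉ S) : I.Inp σ' := by
  unfold Inp at *
  rwa [hf 0 h0, hf 1 h1, hf 2 h2]

theorem Base.frame {S : List ℕ} {σ σ' : Store} (h : I.Base σ) (hf : Frame S σ σ')
    (hS : ∀ a ∈ S, a ∉ [0, 1, 2, 10, 11, 12, 13]) : I.Base σ' := by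
  have hn (a : ℕ) (ha : a ∈ [0, 1, 2, 10, 11, 12, 13]) : a ∉ S := fun h' => hS a h' ha
  refine ⟨h.1.frame hf (hn _ (by decide)) (hn _ (by decide)) (hn _ (by decide)), ?_⟩
  rw [hf 10 (hn _ (by decide)), hf 11 (hn _ (by decide)), hf 12 (hn _ (by decide)),
    hf 13 (hn _ (by decide))]
  exact h.2

theorem OutInv.frame {S : List ℕ} {σ σ' : Store} (h : I.OutInv σ) (hf : Frame S σ σ')
    (hS : ∀ a ∈ S, a ∉ [3, 4, 5]) : I.OutInv σ' := by
  have hn (a : ℕ) (ha : a ∈ [3, 4, 5]) : a ∉ S := fun h' => hS a h' ha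
  unfold OutInv ZeroCells IsOut at *
  rwa [hf 3 (hn _ (by decide)), hf 4 (hn _ (by decide)), hf 5 (hn _ (by decide))]

end Inst

/-! ### Values of the auxiliary expressions -/

theorem int_ind (x y : ℤ) : 1 / (1 + (x - y) * (x - y)) = if x = y then 1 else 0 := by
  split_ifs with h
  · subst h; simp
  · apply Int.ediv_eq_zero_of_lt (by norm_num)
    have : 0 < (x - y) * (x - y) := mul_self_pos.2 (sub_ne_zero.2 h)
    omega

namespace Expr

@[simp] theorem val_ind (σ : Store) (x y : Expr) :
    (ind x y).val σ = if x.val σ = y.val σ then 1 else 0 := int_ind _ _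

@[simp] theorem val_abs (σ : Store) (x : Expr) : (Expr.abs x).val σ = |x.val σ| := by
  simp only [Expr.abs, val_mul, val_add, val_one, val_div, val_ofNat]
  generalize x.val σ = y
  rcases lt_or_ge y 0 with h | h
  -- Division rounds down, so this quotient is -1 for negative y and 0 otherwise.
  · have : y / (y * y + 1) = -1 := by
      rw [Int.ediv_eq_iff_of_pos (by nlinarith)]
      constructor <;> nlinarith
    rw [this, abs_of_neg h]; ring
  · have : y / (y * y + 1) = 0 := Int.ediv_eq_zero_of_lt h (by nlinarith)
    rw [this, abs_of_nonneg h]; ring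

theorem val_entry {σ : Store} {I : Inst} (h : σ 1 = I.quad) {x y : Expr} {i j : ℕ}
    (hx : x.val σ = i) (hy : y.val σ = j) : (entry x y).val σ = I.B i j := by
  simp [entry, hx, hy, h, Inst.B]

theorem val_row {σ : Store} {n t : ℕ} (h0 : σ 0 0 0 = n) (h6 : σ 6 0 0 = t) :
    row.val σ = (t / n : ℕ) := by simp [row, h0, h6]

theorem val_col {σ : Store} {n t : ℕ} (h0 : σ 0 0 0 = n) (h6 : σ 6 0 0 = t) :
    col.val σ = (t % n : ℕ) := by
  simp only [col, val_sub, val_mul, val_div, val_var, h0, h6]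
  rw [Int.natCast_mod, Int.emod_def]

@[simp] theorem bits_ind (β : ℕ → ℕ) (x y : Expr) : (ind x y).bits β = 2 := by simp [ind]
@[simp] theorem bits_abs (β : ℕ → ℕ) (x : Expr) :
    (Expr.abs x).bits β = x.bits β + (2 + (3 + x.bits β)) := by
  have : bitLen 2 = 3 := by decide
  simp [Expr.abs, this]
@[simp] theorem bits_entry (β : ℕ → ℕ) (x y : Expr) : (entry x y).bits β = β 1 + 4 := by
  simp [entry]

end Expr

/-! ### Bit lengths of the contents of the arrays -/

/-- Bounds for the bit lengths, in terms of a bound `l` for the input and a bound `m` for the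
iterates. -/
def beta (l m : ℕ) : ℕ → ℕ
  | 3 => 100 * m
  | 4 => 400 * m
  | 5 => 200 * m
  | 7 => 31 * m
  | 10 => 4 * l
  | 11 => 12 * l
  | 12 => 10 * l
  | 13 => 5 * l
  | 14 => 2 * l
  | 15 => 2 * l
  | 16 => 6 * l
  | 17 => 10 * l
  | 18 => m
  | 19 => 3 * m
  | 20 => 4 * m
  | 21 => 17 * m
  | 22 => 28 * m
  | 23 => 31 * m
  | 24 => 60 * m
  | 25 => 63 * m
  | 26 => 31 * m
  | 27 => 4 * l
  | 28 => 4 * l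
  | _ => l

theorem beta_le {l m : ℕ} (h : 12 * l ≤ m) (a : ℕ) : beta l m a ≤ 400 * m := by
  unfold beta; split <;> omega

end GaussDecomp

/-! ### Effect and running time of the numerical commands. -/

namespace GaussDecomp
open GaussDecomp.Expr GaussDecomp.Cmd

/-- The conditions on the bounds `l` and `m` of `beta`. -/
structure Bounds (I : Inst) (l m : ℕ) : Prop where
  hl : 100 ≤ l
  hn : I.n * I.n + 1 ≤ l
  hm : 20 * l ≤ m

namespace Bounds
variable {I : Inst} {l m : ℕ}

theorem n_le (h : Bounds I l m) : I.n + 1 ≤ l := by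
  have := Nat.le_mul_self I.n
  have := h.hn
  omega

theorem beta_le (h : Bounds I l m) (a : ℕ) : beta l m a ≤ 400 * m :=
  GaussDecomp.beta_le (by have := h.hm; omega) a

theorem one_le (h : Bounds I l m) : 1 ≤ 400 * m := by have := h.hm; have := h.hl; omega

theorem bitLen_n (h : Bounds I l m) : bitLen I.n ≤ l := (bitLen_natCast_le _).trans h.n_le

theorem bitLen_nn (h : Bounds I l m) : bitLen (I.n * I.n : ℕ) ≤ l := (bitLen_natCast_le _).trans h.hn

end Bounds

variable {I : Inst} {l m : ℕ} {σ : Store}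

/-- As long as N exceeds √M, the quotient M / N is at most the integer root, so a Newton step at
least halves the excess and f steps suffice for an excess below 2^f. -/
theorem runs_sqrtLoop (hb : Bounds I l m) {M : ℕ} (f : ℕ) : ∀ {σ : Store} {N : ℕ},
    Ok (beta l m) σ → σ 19 0 0 = M → σ 20 0 0 = N → Nat.sqrt M ≤ N → N < Nat.sqrt M + 2 ^ f →
    Runs (400 * m) sqrtLoop σ (2 * f + 1) fun σ' => Ok (beta l m) σ' ∧ Frame [20] σ σ' ∧
      σ' 20 0 0 = Nat.sqrt M := by
  have hdone {σ : Store} (hok : Ok (beta l m) σ) (h19 : σ 19 0 0 = M)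
      (h20 : σ 20 0 0 = Nat.sqrt M) : Runs (400 * m) sqrtLoop σ 1 fun σ' => Ok (beta l m) σ' ∧
        Frame [20] σ σ' ∧ σ' 20 0 0 = Nat.sqrt M := by
    refine Runs.loop_neg hok hb.beta_le hb.one_le (by decide) ?_ ⟨hok, Frame.refl _ _, h20⟩
    simp only [val_sub, val_mul, val_var, h19, h20]
    have := Nat.sqrt_le M
    push Not
    rw [sub_nonpos]
    exact_mod_cast this
  induction f with
  | zero =>
    intro σ N hok h19 h20 h1 h2
    obtain rfl : N = Nat.sqrt M := by simp at h2; omega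
    exact hdone hok h19 h20
  | succ f ih =>
    intro σ N hok h19 h20 h1 h2
    rcases h1.eq_or_lt with h | h
    · exact (hdone hok h19 (by rw [h20, h])).mono (by omega) fun _ h => h
    · have hMN : M < N * N := (Nat.lt_succ_sqrt M).trans_le (Nat.mul_le_mul h h)
      have hq1 : M / N ≤ Nat.sqrt M := by
        rw [← Nat.lt_succ_iff, Nat.div_lt_iff_lt_mul (by omega)]
        exact (Nat.lt_succ_sqrt M).trans_le (Nat.mul_le_mul_left _ h)
      -- The arithmetic-geometric mean inequality in the form (2s - N) N ≤ s² ≤ M, with s the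
      -- integer root: the iteration never falls below the root.
      have hq2 : 2 * Nat.sqrt M ≤ N + M / N := by
        have : 2 * Nat.sqrt M - N ≤ M / N := by
          rw [Nat.le_div_iff_mul_le (by omega)]
          refine le_trans ?_ (Nat.sqrt_le M)
          obtain ⟨t, ht⟩ := Nat.exists_eq_add_of_lt h
          generalize Nat.sqrt M = s at *
          rcases le_total N (2 * s) with h' | h'
          · obtain ⟨e, he⟩ := Nat.exists_eq_add_of_le h'
            have h3 : 2 * s - N = e := by omega
            have h4 : s = e + (t + 1) := by omega
            have h5 : N = e + 2 * (t + 1) := by omega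
            rw [h3, h5, h4]
            ring_nf
            nlinarith
          · simp [Nat.sub_eq_zero_of_le h']
        omega
      have hstep : ((var 20 + var 19 / var 20) / 2 : Expr).val σ = ((N + M / N) / 2 : ℕ) := by
        simp [h19, h20]
      refine (Runs.loop_pos (T := 1) (T' := 2 * f + 1) (R := fun σ' => Ok (beta l m) σ' ∧
        Frame [20] σ σ' ∧ σ' 20 0 0 = ((N + M / N) / 2 : ℕ)) hok hb.beta_le hb.one_le (by decide)
        ?_ ?_ ?_).mono (by omega) fun _ h => h
      · simp only [val_sub, val_mul, val_var, h19, h20]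
        rw [sub_pos]; exact_mod_cast hMN
      · refine Runs.write hok hb.beta_le hb.one_le (by decide) ?_
        rw [hstep]
        refine ⟨hok.set ((bitLen_le_of_natAbs_le (y := N) ?_).trans (h20 ▸ hok 20 0 0)) _ _,
          (Frame.refl _ _).set (by simp) _ _ _, Store.set_self⟩
        simp only [Int.natAbs_natCast]
        omega
      · rintro σ' ⟨hok', hfr, h20'⟩
        refine (ih hok' (by rw [hfr 19 (by decide), h19]) h20' (by omega) ?_).mono le_rfl ?_
        · rw [pow_succ] at h2; omega
        · rintro σ'' ⟨h3, h4, h5⟩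
          exact ⟨h3, hfr.trans h4 (fun _ h => h) (fun _ h => h), h5⟩

theorem runs_initCmd (hb : Bounds I l m) (hok : Ok (beta l m) σ) (hI : I.Inp σ) :
    Runs (400 * m) initCmd σ (6 * (I.n * I.n) + 3 * I.n + 10) fun σ' => Ok (beta l m) σ' ∧
      Frame [10, 27, 28, 11, 6] σ σ' ∧ σ' 10 0 0 = I.s ∧ σ' 11 0 0 = I.V := by
  have hl := hb.hl
  have hm := hb.hm
  have hn := hb.hn
  have hn' := hb.n_le
  have hent {σ' : Store} {S : List ℕ} (hf : Frame S σ σ') (h0 : 0 ∉ S) (h1 : 1 ∉ S) {k : ℕ}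
      (hk : σ' 6 0 0 = k) : (entry row col).val σ' = I.B (k / I.n) (k % I.n) := by
    have h0' : σ' 0 0 0 = I.n := by rw [hf 0 h0]; exact hI.1
    exact val_entry (by rw [hf 1 h1]; exact hI.2.2.2.2.2.1) (val_row h0' hk) (val_col h0' hk)
  have hentbit (k : ℕ) : bitLen (I.B (k / I.n) (k % I.n)) ≤ l + 4 := by
    have h1 : I.B (k / I.n) (k % I.n) = (entry (.const (k / I.n : ℕ)) (.const (k % I.n : ℕ))).val σ :=
      (val_entry hI.2.2.2.2.2.1 rfl rfl).symm
    rw [h1]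
    exact (hok.bitLen_val_le _).trans (by simp [beta])
  refine (Runs.seq (Runs.sumLoop (acc := 10) (x := 6) (g := fun k => |I.B (k / I.n) (k % I.n)|) (w := l + 4)
    (N := I.n * I.n) hok hb.beta_le hb.one_le (by decide) (by decide) (by decide) hb.bitLen_nn
    ?_ ?_ ?_ (by omega) (by simp [beta]; omega)) ?_).mono
    (T := 3 * (I.n * I.n) + 3 + (3 * (I.n * I.n) + 3 + (3 * I.n + 3 + 1))) (by omega) fun _ h => h
  · intro σ' hf
    simp [hf 0 (by decide), hI.1]
  · intro k hk σ' hf h6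
    simp [hent hf (by decide) (by decide) h6]
  · intro k hk
    have := hentbit k
    rwa [bitLen, Int.natAbs_abs]
  rintro σ1 ⟨hok1, hf1, hs⟩
  refine Runs.seq (Runs.sumLoop (acc := 27) (x := 6) (g := fun k => I.B (k / I.n) (k % I.n) * I.B (k / I.n) (k % I.n))
    (w := (l + 4) + (l + 4)) (N := I.n * I.n) hok1 hb.beta_le hb.one_le (by decide) (by decide)
    (by decide) hb.bitLen_nn ?_ ?_ ?_ (by omega) (by simp [beta]; omega)) ?_
  · intro σ' hf
    simp [hf 0 (by decide), hf1 0 (by decide), hI.1]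
  · intro k hk σ' hf h6
    simp [hent (hf1.trans (T := [10, 27, 6]) hf (by decide) (by decide)) (by decide) (by decide) h6]
  · intro k hk
    exact (bitLen_mul_le _ _).trans (Nat.add_le_add (hentbit k) (hentbit k))
  rintro σ2 ⟨hok2, hf2, hF⟩
  refine Runs.seq (Runs.sumLoop (acc := 28) (x := 6) (g := fun k => I.lin k * I.lin k) (w := l + l) (N := I.n) hok2
    hb.beta_le hb.one_le (by decide) (by decide) (by decide) hb.bitLen_n ?_ ?_ ?_ (by omega)
    (by simp [beta]; omega)) ?_
  · intro σ' hf
    simp [hf 0 (by decide), hf2 0 (by decide), hf1 0 (by decide), hI.1]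
  · intro k hk σ' hf h6
    simp [h6, hf 2 (by decide), hf2 2 (by decide), hf1 2 (by decide), hI.2.2.2.2.2.2]
  · intro k hk
    have : bitLen (I.lin k) ≤ l := by rw [← hI.2.2.2.2.2.2]; exact hok 2 _ _
    exact (bitLen_mul_le _ _).trans (Nat.add_le_add this this)
  rintro σ3 ⟨hok3, hf3, hL⟩
  refine Runs.write hok3 hb.beta_le hb.one_le (by decide) ?_
  have hv : (var 27 + 2 * var 28 : Expr).val σ3 = I.V := by
    simp [hL, hf3 27 (by decide), hF, Inst.V, Inst.F]
  have hbit := hok3.bitLen_val_le (var 27 + 2 * var 28)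
  rw [hv] at hbit ⊢
  have h3 : bitLen 2 = 3 := by decide
  refine ⟨hok3.set (hbit.trans (by simp [beta, h3]; omega)) _ _, ?_, ?_, Store.set_self⟩
  · exact (((hf1.trans hf2 (T := [10, 27, 28, 11, 6]) (by decide) (by decide)).trans hf3
      (T := [10, 27, 28, 11, 6]) (by decide) (by decide))).set (by decide) _ _ _
  · rw [Store.set_ne (by decide), hf3 10 (by decide), hf2 10 (by decide), hs]; rfl

end GaussDecomp

namespace GaussDecomp
open GaussDecomp.Expr GaussDecomp.Cmd

variable {I : Inst} {l m : ℕ} {σ : Store}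

theorem runs_vectorCmd (hb : Bounds I l m) (hok : Ok (beta l m) σ) (hI : I.Inp σ) {i k : ℕ}
    {v : ℕ → ℤ} (hi : i < I.n) (h15 : σ 15 0 0 = i) (h17 : σ 17 0 0 = k)
    (h18 : ∀ j < I.n, σ 18 k j = v j) :
    Runs (400 * m) vectorCmd σ (7 * I.n + 8 * m + 8) fun σ' => Ok (beta l m) σ' ∧
      Frame [19, 20, 21, 22, 6] σ σ' ∧ σ' 21 0 0 = I.den v i ∧
      ∀ j < I.n, σ' 22 0 j = I.vec v i j := by
  have hl := hb.hl
  have hm := hb.hm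
  have hn := hb.n_le
  have h2 : bitLen 2 = 3 := by decide
  have hvb (j : ℕ) (hj : j < I.n) : bitLen (v j) ≤ m := by rw [← h18 j hj]; exact hok 18 _ _
  refine (Runs.seq (Runs.sumLoop (acc := 19) (x := 6) (g := fun j => v j * v j) (w := m + m)
    (N := I.n) hok hb.beta_le hb.one_le (by decide) (by decide) (by decide) hb.bitLen_n ?_ ?_ ?_
    (by omega) (by simp [beta]; omega)) ?_).mono
    (T := 3 * I.n + 3 + (1 + ((2 * (4 * m) + 1) + (1 + (I.n * (1 + 3) + 2))))) (by omega)
    fun _ h => h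
  · intro σ' hf
    simp [hf 0 (by decide), hI.1]
  · intro j hj σ' hf h6
    simp [h6, hf 17 (by decide), h17, hf 18 (by decide), h18 j hj]
  · intro j hj
    exact (bitLen_mul_le _ _).trans (Nat.add_le_add (hvb j hj) (hvb j hj))
  rintro σ1 ⟨hok1, hf1, hM⟩
  set M : ℕ := (∑ j ∈ Finset.range I.n, v j * v j).toNat with hMdef
  have hM' : (∑ j ∈ Finset.range I.n, v j * v j) = M := by
    rw [hMdef, Int.toNat_of_nonneg]
    exact Finset.sum_nonneg fun j _ => mul_self_nonneg _
  have hlen : I.len v = Nat.sqrt M := rfl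
  rw [hM'] at hM
  refine Runs.seq (R := fun σ' => Ok (beta l m) σ' ∧ Frame [19, 6, 20] σ σ' ∧ σ' 19 0 0 = M ∧
    σ' 20 0 0 = (M + 1 : ℕ)) ?_ ?_
  · refine Runs.write hok1 hb.beta_le hb.one_le (by decide) ?_
    have hbit := hok1.bitLen_val_le (var 19 + 1)
    have hv : (var 19 + 1 : Expr).val σ1 = (M + 1 : ℕ) := by simp [hM]
    rw [hv] at hbit ⊢
    refine ⟨hok1.set (hbit.trans (by simp [beta]; omega)) _ _,
      (hf1.mono (by decide)).set (by decide) _ _ _, ?_, Store.set_self⟩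
    rw [Store.set_ne (by decide), hM]
  rintro σ2 ⟨hok2, hf2, h19, h20⟩
  refine Runs.seq (runs_sqrtLoop hb (4 * m) hok2 h19 h20 ((Nat.sqrt_le_self M).trans (Nat.le_succ M))
    ?_) ?_
  · have h3 : bitLen (M + 1 : ℕ) ≤ 4 * m := h20 ▸ hok2 20 0 0
    have h4 : bitLen (M + 1 : ℕ) ≤ 4 * m + 1 := by omega
    rw [bitLen_le_iff, Int.natAbs_natCast] at h4
    omega
  rintro σ3 ⟨hok3, hf3, h20'⟩
  have hf3' : Frame [19, 6, 20] σ σ3 := hf2.trans hf3 (by decide) (by decide)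
  have h19' : σ3 19 0 0 = M := by rw [hf3 19 (by decide), h19]
  refine Runs.seq (R := fun σ' => Ok (beta l m) σ' ∧ Frame [19, 6, 20, 21] σ σ' ∧
    σ' 20 0 0 = I.len v ∧ σ' 21 0 0 = I.den v i) ?_ ?_
  · refine Runs.write hok3 hb.beta_le hb.one_le (by decide) ?_
    have hbit := hok3.bitLen_val_le
      (var 19 + 2 * var 20 * read 18 (var 17) (var 15) + var 20 * var 20)
    have hv : (var 19 + 2 * var 20 * read 18 (var 17) (var 15) + var 20 * var 20 : Expr).val σ3 =
        I.den v i := by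
      simp [h19', h20', hf3' 17 (by decide), h17, hf3' 18 (by decide), hf3' 15 (by decide), h15,
        h18 i hi, Inst.den, hM', hlen]
    rw [hv] at hbit ⊢
    refine ⟨hok3.set (hbit.trans (by simp [beta, h2]; omega)) _ _,
      (hf3'.mono (by decide)).set (by decide) _ _ _, ?_, Store.set_self⟩
    rw [Store.set_ne (by decide), h20', hlen]
  rintro σ4 ⟨hok4, hf4, h20'', h21⟩
  refine (Runs.fillLoop (T := 1) (S := []) (N := I.n) (a := 22) (x := 6)
    (g := fun j => I.vec v i j) (ci := fun _ => 0) (cj := fun j => j) hok4 hb.beta_le hb.one_le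
    (by decide) (by decide) (by decide) (by decide) (by decide) hb.bitLen_n (fun _ _ _ _ _ h => h)
    ?_ ?_).mono le_rfl ?_
  · intro σ' hf
    simp [hf 0 (by decide), hf4 0 (by decide), hI.1]
  · intro j hj σ' hok' hf h6 _
    have hv : (2 * (read 18 (var 17) (var 15) + var 20) *
      (read 18 (var 17) (var 6) + var 20 * ind (var 6) (var 15)) - var 21 * ind (var 6) (var 15)
        : Expr).val σ' = I.vec v i j := by
      simp [h6, hf 18 (by decide), hf4 18 (by decide), hf 17 (by decide), hf4 17 (by decide), h17,
        hf 15 (by decide), hf4 15 (by decide), h15, hf 20 (by decide), h20'', hf 21 (by decide), h21,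
        h18 i hi, h18 j hj, Inst.vec]
    have hbit := hok'.bitLen_val_le (2 * (read 18 (var 17) (var 15) + var 20) *
      (read 18 (var 17) (var 6) + var 20 * ind (var 6) (var 15)) - var 21 * ind (var 6) (var 15))
    rw [hv] at hbit
    exact Runs.skip hb.one_le ⟨hok', Frame.refl _ _, rfl, by simp [h6], hv,
      hbit.trans (by simp [beta, h2]; omega)⟩
  · rintro σ' ⟨hok', hf, h22, _⟩
    refine ⟨hok', hf4.trans hf (by decide) (by decide), ?_, h22⟩
    rw [hf 21 (by decide), h21]

/-- The sums over a row of the matrix that are used for `g = B z` and for the next iterate. -/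
theorem runs_imageCmd (hb : Bounds I l m) (hok : Ok (beta l m) σ) (hI : I.Inp σ) {z : ℕ → ℤ}
    (h22 : ∀ j < I.n, σ 22 0 j = z j) :
    Runs (400 * m) imageCmd σ (I.n * (3 * I.n + 6) + 6 * I.n + 8) fun σ' => Ok (beta l m) σ' ∧
      Frame [23, 24, 25, 6, 7, 8] σ σ' ∧ (∀ j < I.n, σ' 23 0 j = I.img z j) ∧
      σ' 24 0 0 = I.ray z ∧ σ' 25 0 0 = I.imgSq z := by
  have hl := hb.hl
  have hm := hb.hm
  have hn := hb.n_le
  have hzb (j : ℕ) (hj : j < I.n) : bitLen (z j) ≤ 28 * m := by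
    rw [← h22 j hj]; exact hok 22 _ _
  have hBb (i j : ℕ) : bitLen (I.B i j) ≤ l + 4 := by
    have h1 : I.B i j = (entry (.const i) (.const j)).val σ :=
      (val_entry hI.2.2.2.2.2.1 rfl rfl).symm
    rw [h1]
    exact (hok.bitLen_val_le _).trans (by simp [beta])
  refine (Runs.seq (Runs.fillLoop (T := 3 * I.n + 3) (S := [7, 6]) (N := I.n) (a := 23) (x := 8)
    (g := fun j => I.img z j) (ci := fun _ => 0) (cj := fun j => j) hok hb.beta_le hb.one_le
    (by decide) (by decide) (by decide) (by decide) (by decide) hb.bitLen_n (fun _ _ _ _ _ h => h)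
    ?_ ?_) ?_).mono
    (T := (I.n * (3 * I.n + 3 + 3) + 2) + ((3 * I.n + 3) + (3 * I.n + 3)))
    (by rw [Nat.add_assoc (3 * I.n)]; omega) fun _ h => h
  · intro σ' hf
    simp [hf 0 (by decide), hI.1]
  · intro j hj σ' hok' hf h8 _
    refine (Runs.sumLoop (acc := 7) (x := 6) (g := fun k => I.B j k * z k)
      (w := l + 4 + 28 * m) (N := I.n) hok' hb.beta_le hb.one_le (by decide) (by decide)
      (by decide) hb.bitLen_n ?_ ?_ ?_ (by omega) (by simp [beta]; omega)).mono le_rfl ?_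
    · intro σ'' hf'
      simp [hf' 0 (by decide), hf 0 (by decide), hI.1]
    · intro k hk σ'' hf' h6
      rw [val_mul, val_entry (I := I) (i := j) (j := k)]
      · simp [h6, hf' 22 (by decide), hf 22 (by decide), h22 k hk]
      · rw [hf' 1 (by decide), hf 1 (by decide), hI.2.2.2.2.2.1]
      · simp [hf' 8 (by decide), h8]
      · simp [h6]
    · intro k hk
      exact (bitLen_mul_le _ _).trans (Nat.add_le_add (hBb j k) (hzb k hk))
    · rintro σ'' ⟨hok'', hf', h7⟩
      refine ⟨hok'', hf', rfl, ?_, h7, ?_⟩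
      · simp [hf' 8 (by decide), h8]
      · exact (bitLen_sum_le (by omega) fun k hk => (bitLen_mul_le _ _).trans
          (Nat.add_le_add (hBb j k) (hzb k hk))).trans (by simp [beta]; omega)
  rintro σ1 ⟨hok1, hf1, h23, _⟩
  have hib (j : ℕ) (hj : j < I.n) : bitLen (I.img z j) ≤ 31 * m := by
    rw [← h23 j hj]; exact hok1 23 _ _
  refine Runs.seq (Runs.sumLoop (acc := 24) (x := 6) (g := fun j => z j * I.img z j)
    (w := 28 * m + 31 * m) (N := I.n) hok1 hb.beta_le hb.one_le (by decide) (by decide) (by decide)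
    hb.bitLen_n ?_ ?_ ?_ (by omega) (by simp [beta]; omega)) ?_
  · intro σ' hf
    simp [hf 0 (by decide), hf1 0 (by decide), hI.1]
  · intro j hj σ' hf h6
    simp [h6, hf 22 (by decide), hf1 22 (by decide), h22 j hj, hf 23 (by decide), h23 j hj]
  · intro j hj
    exact (bitLen_mul_le _ _).trans (Nat.add_le_add (hzb j hj) (hib j hj))
  rintro σ2 ⟨hok2, hf2, h24⟩
  refine (Runs.sumLoop (acc := 25) (x := 6) (g := fun j => I.img z j * I.img z j)
    (w := 31 * m + 31 * m) (N := I.n) hok2 hb.beta_le hb.one_le (by decide) (by decide) (by decide)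
    hb.bitLen_n ?_ ?_ ?_ (by omega) (by simp [beta]; omega)).mono le_rfl ?_
  · intro σ' hf
    simp [hf 0 (by decide), hf2 0 (by decide), hf1 0 (by decide), hI.1]
  · intro j hj σ' hf h6
    simp [h6, hf 23 (by decide), hf2 23 (by decide), h23 j hj]
  · intro j hj
    exact (bitLen_mul_le _ _).trans (Nat.add_le_add (hib j hj) (hib j hj))
  · rintro σ' ⟨hok', hf, h25⟩
    refine ⟨hok', (hf1.trans (T := [23, 24, 25, 6, 7, 8]) hf2 (by decide) (by decide)).trans hf
      (by decide) (by decide), ?_, ?_, h25⟩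
    · intro j hj
      rw [hf 23 (by decide), hf2 23 (by decide), h23 j hj]
    · rw [hf 24 (by decide), h24]; rfl

theorem runs_updateCmd (hb : Bounds I l m) (hok : Ok (beta l m) σ) (hB : I.Base σ) {i k : ℕ} {sg : ℤ}
    (h16 : σ 16 0 0 = sg) (h17 : σ 17 0 0 = k) (h18 : ∀ j < I.n, σ 18 k j = I.v i sg k j)
    (hbit : ∀ j < I.n, bitLen (I.v i sg (k + 1) j) ≤ m) :
    Runs (400 * m) updateCmd σ (I.n * (3 * I.n + 6) + 2) fun σ' => Ok (beta l m) σ' ∧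
      Frame [8, 18, 7, 6] σ σ' ∧ ∀ j < I.n, σ' 18 (k + 1) j = I.v i sg (k + 1) j := by
  have hl := hb.hl
  have hm := hb.hm
  have hn := hb.n_le
  obtain ⟨hI, h10, -⟩ := hB
  have hmb (j t : ℕ) (ht : t < I.n) :
      bitLen ((I.s * (if j = t then 1 else 0) + sg * I.B j t) * I.v i sg k t) ≤ 30 * m := by
    have h1 : (I.s * (if j = t then 1 else 0) + sg * I.B j t) * I.v i sg k t =
        ((var 10 * ind (.const j) (.const t) + var 16 * entry (.const j) (.const t)) *
          read 18 (.const k) (.const t) : Expr).val σ := by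
      have := val_entry hI.2.2.2.2.2.1 (x := .const j) (y := .const t) (σ := σ) rfl rfl
      simp only [this, val_var, h10, h16, val_ind, Expr.val,
        Int.toNat_natCast, h18 t ht, Nat.cast_inj]
      rfl
    rw [h1]
    exact (hok.bitLen_val_le _).trans (by simp [beta]; omega)
  refine (Runs.fillLoop (T := 3 * I.n + 3) (S := [7, 6]) (N := I.n) (a := 18) (x := 8)
    (g := fun j => I.v i sg (k + 1) j) (ci := fun _ => k + 1) (cj := fun j => j) hok hb.beta_le
    hb.one_le (by decide) (by decide) (by decide) (by decide) (by decide) hb.bitLen_n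
    (fun _ _ _ _ _ h => h) ?_ ?_).mono (by rw [Nat.add_assoc (3 * I.n)]) ?_
  · intro σ' hf
    simp [hf 0 (by decide), hI.1]
  · intro j hj σ' hok' hf h8 hun
    refine (Runs.sumLoop (acc := 7) (x := 6) (g := fun t =>
      (I.s * (if j = t then 1 else 0) + sg * I.B j t) * I.v i sg k t)
      (w := 30 * m) (N := I.n) hok' hb.beta_le hb.one_le (by decide) (by decide)
      (by decide) hb.bitLen_n ?_ ?_ ?_ (by omega) (by simp [beta]; omega)).mono le_rfl ?_
    · intro σ'' hf'
      simp [hf' 0 (by decide), hf 0 (by decide), hI.1]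
    · intro t ht σ'' hf' h6
      have h1 := val_entry (I := I) (σ := σ'') (x := var 8) (y := var 6) (i := j) (j := t)
        (by rw [hf' 1 (by decide), hf 1 (by decide), hI.2.2.2.2.2.1])
        (by simp [hf' 8 (by decide), h8]) (by simp [h6])
      -- Only row k + 1 is being filled, so row k still holds the previous iterate.
      have h2 : σ'' 18 k t = I.v i sg k t := by
        rw [hf' 18 (by decide), hun k t (by omega), h18 t ht]
      simp only [val_mul, val_add, h1, val_var, val_read, val_ind, h6, hf' 8 (by decide), h8,
        hf' 10 (by decide), hf 10 (by decide), h10, hf' 16 (by decide), hf 16 (by decide), h16,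
        hf' 17 (by decide), hf 17 (by decide), h17, Int.toNat_natCast, h2, Nat.cast_inj]
    · exact fun t ht => hmb j t ht
    · rintro σ'' ⟨hok'', hf', h7⟩
      refine ⟨hok'', hf', ?_, ?_, h7, (hbit j hj).trans (by simp [beta])⟩
      · simp [hf' 17 (by decide), hf 17 (by decide), h17]
      · simp [hf' 8 (by decide), h8]
  · rintro σ' ⟨hok', hf, h, _⟩
    exact ⟨hok', hf, h⟩

end GaussDecomp

/-! ### Writing and testing a decomposition. -/

namespace GaussDecomp
open GaussDecomp.Expr GaussDecomp.Cmd

variable {I : Inst} {l m : ℕ} {σ : Store}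

theorem runs_outputCmd (hb : Bounds I l m) (hok : Ok (beta l m) σ) (hI : I.Inp σ) {z : ℕ → ℤ} {d : ℤ}
    (h21 : σ 21 0 0 = d) (h22 : ∀ j < I.n, σ 22 0 j = z j) (h23 : ∀ j < I.n, σ 23 0 j = I.img z j)
    (h24 : σ 24 0 0 = I.ray z) (h0 : Inst.ZeroCells σ) :
    Runs (400 * m) outputCmd σ (4 * (I.n * I.n) + 11 * I.n + 12) fun σ' => Ok (beta l m) σ' ∧
      Frame [26, 3, 4, 5, 6] σ σ' ∧ Inst.ZeroCells σ' ∧ I.IsOut z d σ' := by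
  have hl := hb.hl
  have hm := hb.hm
  have hn := hb.n_le
  have h2b : bitLen 2 = 3 := by decide
  refine (Runs.seq (Runs.sumLoop (acc := 26) (x := 6) (g := fun j => I.lin j * z j)
    (w := l + 28 * m) (N := I.n) hok hb.beta_le hb.one_le (by decide) (by decide) (by decide)
    hb.bitLen_n ?_ ?_ ?_ (by omega) (by simp [beta]; omega)) ?_).mono
    (T := (3 * I.n + 3) + (1 + (1 + (1 + ((I.n * (1 + 3) + 2) + ((I.n * (1 + 3) + 2) +
      ((I.n * I.n) * (1 + 3) + 2))))))) (by omega) fun _ h => h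
  · intro σ' hf
    simp [hf 0 (by decide), hI.1]
  · intro j hj σ' hf h6
    simp [h6, hf 2 (by decide), hI.2.2.2.2.2.2, hf 22 (by decide), h22 j hj]
  · intro j hj
    refine (bitLen_mul_le _ _).trans (Nat.add_le_add ?_ ?_)
    · rw [← hI.2.2.2.2.2.2]; exact hok 2 _ _
    · rw [← h22 j hj]; exact hok 22 _ _
  rintro σ1 ⟨hok1, hf1, h26⟩
  replace h26 : σ1 26 0 0 = I.linDot z := h26
  replace h21 : σ1 21 0 0 = d := by rw [hf1 21 (by decide), h21]
  replace h24 : σ1 24 0 0 = I.ray z := by rw [hf1 24 (by decide), h24]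
  replace h22 : ∀ j < I.n, σ1 22 0 j = z j := by rw [hf1 22 (by decide)]; exact h22
  replace h23 : ∀ j < I.n, σ1 23 0 j = I.img z j := by rw [hf1 23 (by decide)]; exact h23
  replace hI : I.Inp σ1 := hI.frame hf1 (by decide) (by decide) (by decide)
  replace h0 : Inst.ZeroCells σ1 := by
    unfold Inst.ZeroCells at *
    rwa [hf1 3 (by decide), hf1 4 (by decide), hf1 5 (by decide)]
  refine Runs.seq (R := fun σ' => Ok (beta l m) σ' ∧ Frame [3] σ1 σ' ∧
    σ' 3 0 0 = 2 * (d * d * d * d) ∧ σ' 3 3 0 = 0) ?_ ?_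
  · refine Runs.write hok1 hb.beta_le hb.one_le (by decide) ?_
    have hbit := hok1.bitLen_val_le (2 * (var 21 * var 21 * var 21 * var 21))
    have hv : (2 * (var 21 * var 21 * var 21 * var 21) : Expr).val σ1 = 2 * (d * d * d * d) := by
      simp [h21]
    rw [hv] at hbit ⊢
    exact ⟨hok1.set (hbit.trans (by simp [beta, h2b]; omega)) _ _,
      (Frame.refl _ _).set (by decide) _ _ _, Store.set_self,
      by rw [Store.set_cell_ne (by simp)]; exact h0.1⟩
  rintro σ2 ⟨hok2, hf2, h30, h33⟩
  refine Runs.seq (R := fun σ' => Ok (beta l m) σ' ∧ Frame [3] σ1 σ' ∧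
    σ' 3 0 0 = 2 * (d * d * d * d) ∧ σ' 3 3 0 = 0 ∧ σ' 3 1 0 = I.ray z * (d * d)) ?_ ?_
  · refine Runs.write hok2 hb.beta_le hb.one_le (by decide) ?_
    have hbit := hok2.bitLen_val_le (var 24 * (var 21 * var 21))
    have hv : (var 24 * (var 21 * var 21) : Expr).val σ2 = I.ray z * (d * d) := by
      simp [hf2 21 (by decide), h21, hf2 24 (by decide), h24]
    rw [hv] at hbit ⊢
    exact ⟨hok2.set (hbit.trans (by simp [beta]; omega)) _ _,
      hf2.set (by decide) _ _ _, by rw [Store.set_cell_ne (by simp)]; exact h30,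
      by rw [Store.set_cell_ne (by simp)]; exact h33, Store.set_self⟩
  rintro σ3 ⟨hok3, hf3, h30, h33, h31⟩
  refine Runs.seq (R := fun σ' => Ok (beta l m) σ' ∧ Frame [3] σ1 σ' ∧
    σ' 3 0 0 = 2 * (d * d * d * d) ∧ σ' 3 3 0 = 0 ∧ σ' 3 1 0 = I.ray z * (d * d) ∧
    σ' 3 2 0 = 2 * I.linDot z * (d * d * d)) ?_ ?_
  · refine Runs.write hok3 hb.beta_le hb.one_le (by decide) ?_
    have hbit := hok3.bitLen_val_le (2 * var 26 * (var 21 * var 21 * var 21))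
    have hv : (2 * var 26 * (var 21 * var 21 * var 21) : Expr).val σ3 =
        2 * I.linDot z * (d * d * d) := by
      simp [hf3 21 (by decide), h21, hf3 26 (by decide), h26]
    rw [hv] at hbit ⊢
    exact ⟨hok3.set (hbit.trans (by simp [beta, h2b]; omega)) _ _,
      hf3.set (by decide) _ _ _, by rw [Store.set_cell_ne (by simp)]; exact h30,
      by rw [Store.set_cell_ne (by simp)]; exact h33,
      by rw [Store.set_cell_ne (by simp)]; exact h31, Store.set_self⟩
  rintro σ4 ⟨hok4, hf4, h30, h33, h31, h32⟩
  refine Runs.seq (Runs.fillLoop (T := 1) (S := []) (N := I.n) (a := 4) (x := 6)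
    (g := fun j => 2 * d * (d * d * I.img z j - I.ray z * z j)) (ci := fun _ => 0)
    (cj := fun j => j + 1) hok4 hb.beta_le hb.one_le (by decide) (by decide) (by decide) (by decide)
    (by decide) hb.bitLen_n (fun _ _ _ _ _ h => Nat.succ_injective h) ?_ ?_) ?_
  · intro σ' hf
    simp [hf 0 (by decide), hf4 0 (by decide), hI.1]
  · intro j hj σ' hok' hf h6 _
    have hv : (2 * var 21 * (var 21 * var 21 * read 23 0 (var 6) - var 24 * read 22 0 (var 6))
        : Expr).val σ' = 2 * d * (d * d * I.img z j - I.ray z * z j) := by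
      simp [h6, hf 21 (by decide), hf4 21 (by decide), h21, hf 22 (by decide), hf4 22 (by decide),
        h22 j hj, hf 23 (by decide), hf4 23 (by decide), h23 j hj, hf 24 (by decide),
        hf4 24 (by decide), h24]
    have hbit := hok'.bitLen_val_le
      (2 * var 21 * (var 21 * var 21 * read 23 0 (var 6) - var 24 * read 22 0 (var 6)))
    rw [hv] at hbit
    exact Runs.skip hb.one_le ⟨hok', Frame.refl _ _, rfl, by simp [h6], hv,
      hbit.trans (by simp [beta, h2b]; omega)⟩
  rintro σ5 ⟨hok5, hf5, h40, h4u⟩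
  have hf5' : Frame [3, 4, 6] σ1 σ5 := hf4.trans hf5 (by decide) (by decide)
  refine Runs.seq (Runs.fillLoop (T := 1) (S := []) (N := I.n) (a := 5) (x := 6)
    (g := fun j => 2 * (d * d) * (d * d * I.lin j - I.linDot z * z j)) (ci := fun j => j + 1)
    (cj := fun _ => 0) hok5 hb.beta_le hb.one_le (by decide) (by decide) (by decide) (by decide)
    (by decide) hb.bitLen_n (fun _ _ _ _ h _ => Nat.succ_injective h) ?_ ?_) ?_
  · intro σ' hf
    simp [hf 0 (by decide), hf5' 0 (by decide), hI.1]
  · intro j hj σ' hok' hf h6 _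
    have hv : (2 * (var 21 * var 21) * (var 21 * var 21 * read 2 (var 6) 0
        - var 26 * read 22 0 (var 6)) : Expr).val σ' =
        2 * (d * d) * (d * d * I.lin j - I.linDot z * z j) := by
      simp [h6, hf 21 (by decide), hf5' 21 (by decide), h21, hf 22 (by decide), hf5' 22 (by decide),
        h22 j hj, hf 2 (by decide), hf5' 2 (by decide), hI.2.2.2.2.2.2, hf 26 (by decide),
        hf5' 26 (by decide), h26]
    have hbit := hok'.bitLen_val_le (2 * (var 21 * var 21) * (var 21 * var 21 * read 2 (var 6) 0
      - var 26 * read 22 0 (var 6)))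
    rw [hv] at hbit
    exact Runs.skip hb.one_le ⟨hok', Frame.refl _ _, by simp [h6], rfl, hv,
      hbit.trans (by simp [beta, h2b]; omega)⟩
  rintro σ6 ⟨hok6, hf6, h50, h5u⟩
  have hf6' : Frame [3, 4, 5, 6] σ1 σ6 := hf5'.trans hf6 (by decide) (by decide)
  -- The number t = i n + j enumerates the pairs. Both triangles are written, though only i ≤ j is
  -- read; row and column 0, which hold the coefficients involving y, stay untouched.
  refine (Runs.fillLoop (T := 1) (S := []) (N := I.n * I.n) (a := 4) (x := 6)
    (g := fun t => (2 - if t / I.n = t % I.n then 1 else 0) *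
      (d * d * (d * d * I.B (t / I.n) (t % I.n) - (z (t / I.n) * I.img z (t % I.n) +
        I.img z (t / I.n) * z (t % I.n))) + I.ray z * z (t / I.n) * z (t % I.n)))
    (ci := fun t => t / I.n + 1) (cj := fun t => t % I.n + 1) hok6 hb.beta_le hb.one_le (by decide)
    (by decide) (by decide) (by decide) (by decide) hb.bitLen_nn ?_ ?_ ?_).mono le_rfl ?_
  · intro t _ t' _ h1 h2
    rw [← Nat.div_add_mod t I.n, Nat.succ_injective h1, Nat.succ_injective h2, Nat.div_add_mod]
  · intro σ' hf
    simp [hf 0 (by decide), hf6' 0 (by decide), hI.1]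
  · intro t ht σ' hok' hf h6 _
    have hf' : Frame [3, 4, 5, 6] σ1 σ' := hf6'.trans hf (by decide) (by decide)
    have h00 : σ' 0 0 0 = I.n := by rw [hf' 0 (by decide)]; exact hI.1
    have hnpos : 0 < I.n := by
      rcases Nat.eq_zero_or_pos I.n with h | h
      · rw [h] at ht; simp at ht
      · exact h
    have hrow := val_row h00 h6
    have hcol := val_col h00 h6
    have hrl : t / I.n < I.n := (Nat.div_lt_iff_lt_mul hnpos).2 ht
    have hcl : t % I.n < I.n := Nat.mod_lt _ hnpos
    have hent := val_entry (I := I) (by rw [hf' 1 (by decide)]; exact hI.2.2.2.2.2.1) hrow hcol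
    have hv : ((2 - ind row col) * (var 21 * var 21 * (var 21 * var 21 * entry row col
      - (read 22 0 row * read 23 0 col + read 23 0 row * read 22 0 col))
      + var 24 * read 22 0 row * read 22 0 col) : Expr).val σ' =
      (2 - if t / I.n = t % I.n then 1 else 0) *
      (d * d * (d * d * I.B (t / I.n) (t % I.n) - (z (t / I.n) * I.img z (t % I.n) +
        I.img z (t / I.n) * z (t % I.n))) + I.ray z * z (t / I.n) * z (t % I.n)) := by
      simp only [val_mul, val_add, val_sub, hent, val_ind, hrow, hcol, val_read, val_var,
        Int.toNat_natCast, Nat.cast_inj, hf' 21 (by decide), h21, hf' 22 (by decide),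
        hf' 23 (by decide), hf' 24 (by decide), h24, val_zero, Int.toNat_zero, h22 _ hrl, h22 _ hcl,
        h23 _ hrl, h23 _ hcl, val_ofNat]
    have hbit := hok'.bitLen_val_le ((2 - ind row col) * (var 21 * var 21 * (var 21 * var 21 *
      entry row col - (read 22 0 row * read 23 0 col + read 23 0 row * read 22 0 col))
      + var 24 * read 22 0 row * read 22 0 col))
    rw [hv] at hbit
    exact Runs.skip hb.one_le ⟨hok', Frame.refl _ _, by rw [val_add, hrow, val_one]; norm_cast,
      by rw [val_add, hcol, val_one]; norm_cast, hv, hbit.trans (by simp [beta, h2b]; omega)⟩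
  rintro σ7 ⟨hok7, hf7, h4, h4u'⟩
  refine ⟨hok7, (hf1.trans (T := [26, 3, 4, 5, 6]) hf6' (by decide) (by decide)).trans hf7
    (by decide) (by decide), ⟨?_, ?_, ?_⟩, ?_, ?_, ?_, ?_, ?_, ?_⟩
  · rw [hf7 3 (by decide), hf6 3 (by decide), hf5 3 (by decide), h33]
  · rw [h4u' 0 0 (by simp), hf6 4 (by decide), h4u 0 0 (by simp), hf4 4 (by decide)]
    exact h0.2.1
  · rw [hf7 5 (by decide), h5u 0 0 (by simp), hf5' 5 (by decide)]
    exact h0.2.2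
  · rw [hf7 3 (by decide), hf6 3 (by decide), hf5 3 (by decide), h30]
  · rw [hf7 3 (by decide), hf6 3 (by decide), hf5 3 (by decide), h31]
  · rw [hf7 3 (by decide), hf6 3 (by decide), hf5 3 (by decide), h32]
  · intro j hj
    rw [h4u' 0 (j + 1) (by simp), hf6 4 (by decide), h40 j hj]
  · intro j hj
    rw [hf7 5 (by decide), h50 j hj]
  · intro i hi j hj
    have h1 : (i * I.n + j) / I.n = i := by
      rw [mul_comm, Nat.mul_add_div (by omega), Nat.div_eq_of_lt hj, add_zero]
    have h2 : (i * I.n + j) % I.n = j := by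
      rw [mul_comm, Nat.mul_add_mod, Nat.mod_eq_of_lt hj]
    have h3 := h4 (i * I.n + j) (by nlinarith)
    simpa only [h1, h2] using h3

/-- There is no early exit: a later accepted vector overwrites all relevant output cells. Hence the
invariant survives, and a nonzero denominator never returns to 0. -/
theorem runs_testCmd (hb : Bounds I l m) (hok : Ok (beta l m) σ) (hB : I.Base σ) {i k : ℕ}
    {v : ℕ → ℤ} (hi : i < I.n) (h15 : σ 15 0 0 = i) (h17 : σ 17 0 0 = k)
    (h18 : ∀ j < I.n, σ 18 k j = v j) (ho : I.OutInv σ) :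
    Runs (400 * m) testCmd σ (7 * (I.n * I.n) + 30 * I.n + 8 * m + 40) fun σ' =>
      Ok (beta l m) σ' ∧ Frame [3, 4, 5, 6, 7, 8, 19, 20, 21, 22, 23, 24, 25, 26] σ σ' ∧
      I.OutInv σ' ∧ (σ 3 0 0 ≠ 0 ∨ I.Acc v i → σ' 3 0 0 ≠ 0) := by
  refine (Runs.seq (runs_vectorCmd hb hok hB.1 hi h15 h17 h18) ?_).mono
    (T := (7 * I.n + 8 * m + 8) + ((I.n * (3 * I.n + 6) + 6 * I.n + 8) +
      (4 * (I.n * I.n) + 11 * I.n + 12 + 1 + 1 + 1))) (by nlinarith) fun _ h => h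
  rintro σ1 ⟨hok1, hf1, h21, h22⟩
  have hB1 : I.Base σ1 := hB.frame hf1 (by decide)
  refine Runs.seq (runs_imageCmd hb hok1 hB1.1 h22) ?_
  rintro σ2 ⟨hok2, hf2, h23, h24, h25⟩
  have hB2 : I.Base σ2 := hB1.frame hf2 (by decide)
  have ho2 : I.OutInv σ2 := (ho.frame hf1 (by decide)).frame hf2 (by decide)
  have hf : Frame [3, 4, 5, 6, 7, 8, 19, 20, 21, 22, 23, 24, 25, 26] σ σ2 :=
    hf1.trans hf2 (by decide) (by decide)
  have h3 : σ2 3 = σ 3 := by rw [hf2 3 (by decide), hf1 3 (by decide)]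
  have h21' : σ2 21 0 0 = I.den v i := by rw [hf2 21 (by decide), h21]
  have h22' : ∀ j < I.n, σ2 22 0 j = I.vec v i j := by rw [hf2 22 (by decide)]; exact h22
  obtain ⟨⟨h00, h01, h02, h03, h04, -⟩, h10, h11, -⟩ := hB2
  -- Branches test strict positivity; the 1 added in `resCheck` and `eigCheck` makes the tested
  -- inequalities non-strict.
  have hres : 0 < resCheck.val σ2 ↔ (I.den v i * I.den v i * I.imgSq (I.vec v i) -
      I.ray (I.vec v i) * I.ray (I.vec v i)) * (I.hd * I.hd) ≤
      2 * (I.hn * I.hn) * I.V * (I.den v i * I.den v i * (I.den v i * I.den v i)) := by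
    simp only [resCheck, val_sub, val_add, val_mul, val_read, val_var, val_ofNat, val_one, val_zero,
      Int.toNat_zero, h21', h24, h25, h11, show (4 : ℤ).toNat = 4 from rfl,
      show (3 : ℤ).toNat = 3 from rfl, h03, h04]
    rw [sub_pos, Int.lt_add_one_iff]
  have heig : 0 < eigCheck.val σ2 ↔ I.en * I.en * (I.en * I.en) * I.V *
      (I.den v i * I.den v i * (I.den v i * I.den v i)) ≤
      40 * (I.ray (I.vec v i) * I.ray (I.vec v i)) * (I.ed * I.ed * (I.ed * I.ed)) := by
    simp only [eigCheck, val_sub, val_add, val_mul, val_read, val_var, val_ofNat, val_one, val_zero,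
      Int.toNat_zero, h21', h24, h11, show (2 : ℤ).toNat = 2 from rfl, h01, h02, Int.toNat_one]
    rw [sub_pos, Int.lt_add_one_iff]
  have hno (T : ℕ) (h : ¬ I.Acc v i) : Runs (400 * m) .skip σ2 (T + 1) fun σ' => Ok (beta l m) σ' ∧
      Frame [3, 4, 5, 6, 7, 8, 19, 20, 21, 22, 23, 24, 25, 26] σ σ' ∧
      I.OutInv σ' ∧ (σ 3 0 0 ≠ 0 ∨ I.Acc v i → σ' 3 0 0 ≠ 0) :=
    (Runs.skip hb.one_le ⟨hok2, hf, ho2, fun h' => by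
      rw [h3]; exact h'.resolve_right h⟩).mono (by omega) fun _ h => h
  refine Runs.ite hok2 hb.beta_le hb.one_le (by decide) (fun hd => ?_) fun hd => ?_
  · simp only [val_var, h21'] at hd
    refine Runs.ite hok2 hb.beta_le hb.one_le (by decide) (fun hr => ?_) fun hr => ?_
    · refine Runs.ite hok2 hb.beta_le hb.one_le (by decide) (fun he => ?_) fun he => ?_
      · have hacc : I.Acc v i := ⟨hd, hres.1 hr, heig.1 he⟩
        refine (runs_outputCmd hb hok2 (hB1.frame hf2 (by decide)).1 h21' h22' h23 h24 ho2.1).mono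
          le_rfl ?_
        rintro σ3 ⟨hok3, hf3, hz, hout⟩
        refine ⟨hok3, hf.trans hf3 (by decide) (by decide), ⟨hz, Or.inr ⟨v, i, hi, hacc, hout⟩⟩,
          fun _ => ?_⟩
        rw [hout.1]
        positivity
      · exact hno (4 * (I.n * I.n) + 11 * I.n + 11) fun h => he (heig.2 h.2.2)
    · exact hno (4 * (I.n * I.n) + 11 * I.n + 12) fun h => hr (hres.2 h.2.1)
  · exact hno (4 * (I.n * I.n) + 11 * I.n + 13) fun h => hd (by simpa [h21'] using h.1)

end GaussDecomp

/-! ### The loops over iterates and start vectors. -/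

namespace GaussDecomp
open GaussDecomp.Expr GaussDecomp.Cmd

variable {I : Inst} {l m : ℕ} {σ : Store}

/-- One step multiplies by a matrix entry of at most 6l bits and sums n < l terms, adding at most 7l
bits. Exact iteration therefore stays polynomial. -/
theorem Inst.Base.bitLen_v_le (hb : Bounds I l m) (hok : Ok (beta l m) σ) (hB : I.Base σ) {i : ℕ}
    {sg : ℤ} (hsg : bitLen sg ≤ 2) (k : ℕ) : ∀ j, bitLen (I.v i sg k j) ≤ 6 * l + 7 * l * k := by
  have hl := hb.hl
  have hn := hb.n_le
  have hind (i j : ℕ) : bitLen (if i = j then 1 else 0) ≤ 2 := by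
    split_ifs <;> decide
  induction k with
  | zero =>
    intro j
    have h13 := hok 13 0 0
    rw [hB.2.2.2.2, beta] at h13
    have h0 := bitLen_mul_le (I.Q : ℤ) (if j = i then 1 else 0)
    have h1 := hind j i
    rw [Inst.v]
    omega
  | succ k ih =>
    intro j
    rw [Inst.v]
    refine (bitLen_sum_le (w := 6 * l + (6 * l + 7 * l * k)) (by omega) fun t _ => ?_).trans ?_
    · refine (bitLen_mul_le _ _).trans (Nat.add_le_add ?_ (ih t))
      have h10 := hok 10 0 0
      have h1 := hok 1 j t
      rw [hB.2.1, beta] at h10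
      rw [hB.1.2.2.2.2.2.1, beta] at h1
      have h2 := bitLen_mul_le I.s (if j = t then 1 else 0)
      have h3 := bitLen_mul_le (I.quad j t) (1 + if j = t then 1 else 0)
      have h4 := bitLen_add_le 1 (if j = t then 1 else 0)
      have h5 := hind j t
      have h6 : bitLen 1 = 2 := by decide
      have h7 := bitLen_mul_le sg (I.B j t)
      have h8 := bitLen_add_le (I.s * (if j = t then 1 else 0)) (sg * I.B j t)
      rw [Inst.B] at h7 h8 ⊢
      omega
      all_goals simp
    · rw [mul_add]; omega

/-- The sign of the matrix in round number `r`. -/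
def roundSign (r : ℕ) : ℤ := 2 * (r - 2 * (r / 2 : ℕ)) - 1

theorem bitLen_roundSign (r : ℕ) : bitLen (roundSign r) ≤ 2 := by
  have : roundSign r = 1 ∨ roundSign r = -1 := by unfold roundSign; omega
  rcases this with h | h <;> rw [h] <;> decide

theorem runs_startCmd (hb : Bounds I l m) (hK : 20 * l * (I.K + 1) ≤ m) (hok : Ok (beta l m) σ)
    (hB : I.Base σ) {r : ℕ} (hr : r < 2 * I.n) (h14 : σ 14 0 0 = r) (ho : I.OutInv σ) :
    Runs (400 * m) startCmd σ
      (I.K * (10 * (I.n * I.n) + 36 * I.n + 8 * m + 44) + 4 * I.n + 6) fun σ' =>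
      Ok (beta l m) σ' ∧ Frame [15, 16, 18, 17, 3, 4, 5, 6, 7, 8, 19, 20, 21, 22, 23, 24, 25, 26] σ σ' ∧
      I.OutInv σ' ∧ ((σ 3 0 0 ≠ 0 ∨ ∃ k < I.K, I.Acc (I.v (r / 2) (roundSign r) k) (r / 2)) →
        σ' 3 0 0 ≠ 0) := by
  have hl := hb.hl
  have hm := hb.hm
  have hn := hb.n_le
  have h2b : bitLen 2 = 3 := by decide
  have hi : r / 2 < I.n := by omega
  have hvb (k : ℕ) (hk : k ≤ I.K) (j : ℕ) : bitLen (I.v (r / 2) (roundSign r) k j) ≤ m := by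
    refine (hB.bitLen_v_le hb hok (bitLen_roundSign r) k j).trans (le_trans ?_ hK)
    have := Nat.mul_le_mul_left l hk
    nlinarith
  refine (Runs.seq (R := fun σ' => Ok (beta l m) σ' ∧ Frame [15] σ σ' ∧ σ' 15 0 0 = (r / 2 : ℕ)) ?_
    ?_).mono (T := 1 + (1 + ((I.n * (1 + 3) + 2) + (I.K * (7 * (I.n * I.n) + 30 * I.n + 8 * m + 40 +
      (I.n * (3 * I.n + 6) + 2) + 2) + 2)))) (by apply le_of_eq; ring) fun _ h => h
  · refine Runs.write hok hb.beta_le hb.one_le (by decide) ?_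
    have hbit := hok.bitLen_val_le (var 14 / 2)
    have hv : (var 14 / 2 : Expr).val σ = (r / 2 : ℕ) := by simp [h14]
    rw [hv] at hbit ⊢
    exact ⟨hok.set (hbit.trans (by simp [beta])) _ _, (Frame.refl _ _).set (by decide) _ _ _,
      Store.set_self⟩
  rintro σ1 ⟨hok1, hf1, h15⟩
  refine Runs.seq (R := fun σ' => Ok (beta l m) σ' ∧ Frame [15, 16] σ σ' ∧ σ' 15 0 0 = (r / 2 : ℕ) ∧
    σ' 16 0 0 = roundSign r) ?_ ?_
  · refine Runs.write hok1 hb.beta_le hb.one_le (by decide) ?_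
    have hv : (2 * (var 14 - 2 * (var 14 / 2)) - 1 : Expr).val σ1 = roundSign r := by
      simp [hf1 14 (by decide), h14, roundSign]
    rw [hv]
    exact ⟨hok1.set ((bitLen_roundSign r).trans (by simp [beta]; omega)) _ _,
      (hf1.mono (by decide)).set (by decide) _ _ _, by rw [Store.set_cell_ne (by simp)]; exact h15,
      Store.set_self⟩
  rintro σ2 ⟨hok2, hf2, h15, h16⟩
  refine Runs.seq (Runs.fillLoop (T := 1) (S := []) (N := I.n) (a := 18) (x := 6)
    (g := fun j => I.v (r / 2) (roundSign r) 0 j) (ci := fun _ => 0) (cj := fun j => j) hok2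
    hb.beta_le hb.one_le (by decide) (by decide) (by decide) (by decide) (by decide) hb.bitLen_n
    (fun _ _ _ _ _ h => h) ?_ ?_) ?_
  · intro σ' hf
    simp [hf 0 (by decide), hf2 0 (by decide), hB.1.1]
  · intro j hj σ' hok' hf h6 _
    have hv : (var 13 * ind (var 6) (var 15) : Expr).val σ' = I.v (r / 2) (roundSign r) 0 j := by
      simp only [val_mul, val_var, val_ind, h6, hf 13 (by decide), hf2 13 (by decide), hB.2.2.2.2,
        hf 15 (by decide), h15, Nat.cast_inj, Inst.v]
    exact Runs.skip hb.one_le ⟨hok', Frame.refl _ _, rfl, by simp [h6], hv, hvb 0 (by omega) j⟩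
  rintro σ3 ⟨hok3, hf3, h18, -⟩
  have hf3' : Frame [15, 16, 18, 17, 3, 4, 5, 6, 7, 8, 19, 20, 21, 22, 23, 24, 25, 26] σ σ3 :=
    hf2.trans hf3 (by decide) (by decide)
  -- The invariant records that iterate k is available and that any success so far has left a
  -- nonzero denominator.
  refine (Runs.forLoop (x := 17) (N := I.K) (I := fun k σ' =>
    Frame [18, 17, 3, 4, 5, 6, 7, 8, 19, 20, 21, 22, 23, 24, 25, 26] σ3 σ' ∧
    (∀ j < I.n, σ' 18 k j = I.v (r / 2) (roundSign r) k j) ∧ I.OutInv σ' ∧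
    ((σ 3 0 0 ≠ 0 ∨ ∃ k' < k, I.Acc (I.v (r / 2) (roundSign r) k') (r / 2)) → σ' 3 0 0 ≠ 0))
    hok3 hb.beta_le hb.one_le (by decide) ?_ ?_ ?_ ?_ ?_).mono le_rfl ?_
  · rw [← hB.2.2.2.1]; exact hok 12 0 0
  · rintro k σ' z ⟨hf, hv, ho', hacc⟩
    have h17 : Frame [17] σ' (σ'.set 17 0 0 z) := (Frame.refl _ _).set (by decide) _ _ _
    exact ⟨hf.set (by decide) _ _ _, by rw [h17 18 (by decide)]; exact hv, ho'.frame h17 (by decide),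
      by rw [h17 3 (by decide)]; exact hacc⟩
  · rintro k σ' ⟨hf, -⟩
    simp [hf 12 (by decide), hf3' 12 (by decide), hB.2.2.2.1]
  · refine ⟨Frame.refl _ _, h18, (ho.frame hf2 (by decide)).frame hf3 (by decide), ?_⟩
    rintro (h | ⟨k', hk', -⟩)
    · rwa [hf3 3 (by decide), hf2 3 (by decide)]
    · omega
  · rintro k hk σ4 hok4 h17 ⟨hf4, hv4, ho4, hacc4⟩
    have hf4' : Frame [15, 16, 18, 17, 3, 4, 5, 6, 7, 8, 19, 20, 21, 22, 23, 24, 25, 26] σ σ4 :=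
      hf3'.trans hf4 (by decide) (by decide)
    have hB4 : I.Base σ4 := hB.frame hf4' (by decide)
    have h154 : σ4 15 0 0 = (r / 2 : ℕ) := by rw [hf4 15 (by decide), hf3 15 (by decide), h15]
    have h164 : σ4 16 0 0 = roundSign r := by rw [hf4 16 (by decide), hf3 16 (by decide), h16]
    refine Runs.seq (runs_testCmd hb hok4 hB4 hi h154 h17 hv4 ho4) ?_
    rintro σ5 ⟨hok5, hf5, ho5, hacc5⟩
    refine (runs_updateCmd hb hok5 (hB4.frame hf5 (by decide)) (by rw [hf5 16 (by decide), h164])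
      (by rw [hf5 17 (by decide), h17]) (by rw [hf5 18 (by decide)]; exact hv4)
      fun j _ => hvb (k + 1) hk j).mono le_rfl ?_
    rintro σ6 ⟨hok6, hf6, hv6⟩
    refine ⟨hok6, by rw [hf6 17 (by decide), hf5 17 (by decide), h17],
      (hf4.trans hf5 (T := [18, 17, 3, 4, 5, 6, 7, 8, 19, 20, 21, 22, 23, 24, 25, 26]) (by decide)
        (by decide)).trans hf6 (by decide) (by decide), hv6, ho5.frame hf6 (by decide), ?_⟩
    rw [hf6 3 (by decide)]
    rintro (h | ⟨k', hk', h⟩)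
    · exact hacc5 (Or.inl (hacc4 (Or.inl h)))
    · rcases Nat.lt_succ_iff_lt_or_eq.1 hk' with hk' | rfl
      · exact hacc5 (Or.inl (hacc4 (Or.inr ⟨k', hk', h⟩)))
      · exact hacc5 (Or.inr h)
  · rintro σ4 ⟨hok4, hf4, -, ho4, hacc4⟩
    exact ⟨hok4, hf3'.trans hf4 (by decide) (by decide), ho4, hacc4⟩

theorem runs_mainCmd (hb : Bounds I l m) (hK : 20 * l * (I.K + 1) ≤ m) (hok : Ok (beta l m) σ)
    (hI : I.Inp σ) (h10 : σ 10 0 0 = I.s) (h11 : σ 11 0 0 = I.V) (ho : I.OutInv σ) :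
    Runs (400 * m) mainCmd σ (2 * I.n *
      (I.K * (10 * (I.n * I.n) + 36 * I.n + 8 * m + 44) + 4 * I.n + 8) + 4) fun σ' =>
      I.OutInv σ' ∧ ((∃ r < 2 * I.n, ∃ k < I.K, I.Acc (I.v (r / 2) (roundSign r) k) (r / 2)) →
        σ' 3 0 0 ≠ 0) := by
  have hl := hb.hl
  have hm := hb.hm
  have hn := hb.n_le
  obtain ⟨h00, h01, h02, h03, h04, -⟩ := id hI
  refine (Runs.seq (R := fun σ' => Ok (beta l m) σ' ∧ Frame [12, 13] σ σ' ∧ σ' 12 0 0 = I.K) ?_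
    ?_).mono (T := 1 + (1 + (2 * I.n * (I.K * (10 * (I.n * I.n) + 36 * I.n + 8 * m + 44) +
      4 * I.n + 6 + 2) + 2))) (by apply le_of_eq; ring) fun _ h => h
  · refine Runs.write hok hb.beta_le hb.one_le (by decide) ?_
    have hbit := hok.bitLen_val_le (2 * var 0 * var 0 * (read 0 2 0 / read 0 1 0 + 1) +
      32 * var 0 * var 0 * (read 0 4 0 / read 0 3 0 + 1) * (read 0 4 0 / read 0 3 0 + 1))
    have hv : (2 * var 0 * var 0 * (read 0 2 0 / read 0 1 0 + 1) +
      32 * var 0 * var 0 * (read 0 4 0 / read 0 3 0 + 1) * (read 0 4 0 / read 0 3 0 + 1)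
        : Expr).val σ = I.K := by
      simp [h00, h01, h02, h03, h04, Inst.K, Inst.a, Inst.c, show (4 : ℤ).toNat = 4 from rfl,
        show (3 : ℤ).toNat = 3 from rfl, show (2 : ℤ).toNat = 2 from rfl]
    rw [hv] at hbit ⊢
    refine ⟨hok.set (hbit.trans ?_) _ _, (Frame.refl _ _).set (by decide) _ _ _, Store.set_self⟩
    have h2b : bitLen 2 = 3 := by decide
    have h32b : bitLen 32 = 7 := by decide
    simp [beta, h2b, h32b]; omega
  rintro σ1 ⟨hok1, hf1, h12⟩
  refine Runs.seq (R := fun σ' => Ok (beta l m) σ' ∧ Frame [12, 13] σ σ' ∧ σ' 12 0 0 = I.K ∧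
    σ' 13 0 0 = I.Q) ?_ ?_
  · refine Runs.write hok1 hb.beta_le hb.one_le (by decide) ?_
    have hbit := hok1.bitLen_val_le (var 0 * (84 * (read 0 2 0 / read 0 1 0 + 1) +
      9 * (read 0 4 0 / read 0 3 0 + 1) + 1))
    have hv : (var 0 * (84 * (read 0 2 0 / read 0 1 0 + 1) +
        9 * (read 0 4 0 / read 0 3 0 + 1) + 1) : Expr).val σ1 = I.Q := by
      simp [hf1 0 (by decide), h00, h01, h02, h03, h04, Inst.Q, Inst.a, Inst.c,
        show (4 : ℤ).toNat = 4 from rfl, show (3 : ℤ).toNat = 3 from rfl,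
        show (2 : ℤ).toNat = 2 from rfl]
    rw [hv] at hbit ⊢
    refine ⟨hok1.set (hbit.trans ?_) _ _, hf1.set (by decide) _ _ _,
      by rw [Store.set_cell_ne (by simp)]; exact h12, Store.set_self⟩
    have h84b : bitLen 84 = 8 := by decide
    have h9b : bitLen 9 = 5 := by decide
    simp [beta, h84b, h9b]; omega
  rintro σ2 ⟨hok2, hf2, h12, h13⟩
  have hB2 : I.Base σ2 := ⟨hI.frame hf2 (by decide) (by decide) (by decide),
    by rw [hf2 10 (by decide), h10], by rw [hf2 11 (by decide), h11], h12, h13⟩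
  refine (Runs.forLoop (x := 14) (N := 2 * I.n) (I := fun r σ' => I.Base σ' ∧ I.OutInv σ' ∧
    ((∃ r' < r, ∃ k < I.K, I.Acc (I.v (r' / 2) (roundSign r') k) (r' / 2)) → σ' 3 0 0 ≠ 0))
    hok2 hb.beta_le hb.one_le (by decide) ?_ ?_ ?_ ?_ ?_).mono le_rfl fun σ' h => h.2.2
  · exact (bitLen_natCast_le _).trans (by simp [beta]; omega)
  · rintro k σ' z ⟨hB', ho', hacc⟩
    have h14 : Frame [14] σ' (σ'.set 14 0 0 z) := (Frame.refl _ _).set (by decide) _ _ _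
    exact ⟨hB'.frame h14 (by decide), ho'.frame h14 (by decide), by rwa [h14 3 (by decide)]⟩
  · rintro k σ' ⟨hB', -⟩
    simp [hB'.1.1]
  · exact ⟨hB2, ho.frame hf2 (by decide), fun ⟨r', hr', _⟩ => by omega⟩
  · rintro r hr σ3 hok3 h14 ⟨hB3, ho3, hacc3⟩
    refine (runs_startCmd hb hK hok3 hB3 hr h14 ho3).mono le_rfl ?_
    rintro σ4 ⟨hok4, hf4, ho4, hacc4⟩
    refine ⟨hok4, by rw [hf4 14 (by decide), h14], hB3.frame hf4 (by decide), ho4, ?_⟩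
    rintro ⟨r', hr', h⟩
    rcases Nat.lt_succ_iff_lt_or_eq.1 hr' with hr' | rfl
    · exact hacc4 (Or.inl (hacc3 ⟨r', hr', h⟩))
    · exact hacc4 (Or.inr h)

/-- The cells of the output arrays are `0`, as they are initially. -/
def NoOutput (σ : Store) : Prop := ∀ i j, σ 3 i j = 0 ∧ σ 4 i j = 0 ∧ σ 5 i j = 0

/-- For an actual input, V ≤ 0 means p = 0. The hypothesis of (a) then reads 0 ≤ 0, so a
decomposition is due: denominator 1 with all other output cells 0 encodes the trivial one. -/
theorem runs_decomposeCmd (hb : Bounds I l m) (hK : 20 * l * (I.K + 1) ≤ m)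
    (hok : Ok (beta l m) σ) (hI : I.Inp σ) (h0 : NoOutput σ) :
    Runs (400 * m) decomposeCmd σ (6 * (I.n * I.n) + 3 * I.n + 15 + 2 * I.n *
      (I.K * (10 * (I.n * I.n) + 36 * I.n + 8 * m + 44) + 4 * I.n + 8)) fun σ' =>
      (I.V ≤ 0 → σ' 3 0 0 = 1 ∧ (∀ i j, (i, j) ≠ (0, 0) → σ' 3 i j = 0) ∧
        ∀ i j, σ' 4 i j = 0 ∧ σ' 5 i j = 0) ∧
      (0 < I.V → I.OutInv σ' ∧
        ((∃ r < 2 * I.n, ∃ k < I.K, I.Acc (I.v (r / 2) (roundSign r) k) (r / 2)) →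
          σ' 3 0 0 ≠ 0)) := by
  refine (Runs.seq (runs_initCmd hb hok hI) ?_).mono (T := (6 * (I.n * I.n) + 3 * I.n + 10) +
    ((2 * I.n * (I.K * (10 * (I.n * I.n) + 36 * I.n + 8 * m + 44) + 4 * I.n + 8) + 4) + 1))
    (by omega) fun _ h => h
  rintro σ1 ⟨hok1, hf1, h10, h11⟩
  have h0' : NoOutput σ1 := by
    unfold NoOutput; rw [hf1 3 (by decide), hf1 4 (by decide), hf1 5 (by decide)]; exact h0
  refine Runs.ite hok1 hb.beta_le hb.one_le (by decide) (fun hd => ?_) fun hd => ?_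
  · simp only [val_var, h11] at hd
    refine (runs_mainCmd hb hK hok1 (hI.frame hf1 (by decide) (by decide) (by decide)) h10 h11
      ⟨⟨(h0' 3 0).1, (h0' 0 0).2.1, (h0' 0 0).2.2⟩, Or.inl (h0' 0 0).1⟩).mono le_rfl ?_
    exact fun σ' h => ⟨fun h' => absurd hd (not_lt.2 h'), fun _ => h⟩
  · simp only [val_var, h11] at hd
    refine (Runs.write hok1 hb.beta_le hb.one_le (by decide) ?_).mono (by omega) fun _ h => h
    refine ⟨fun _ => ⟨Store.set_self, fun i j hij => ?_, fun i j => ?_⟩, fun h => absurd h hd⟩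
    · rw [Store.set_cell_ne (by simpa using hij)]; exact (h0' i j).1
    · rw [Store.set_ne (by decide), Store.set_ne (by decide)]; exact (h0' i j).2

end GaussDecomp

namespace GaussDecomp

/-! ### The input -/

/-- The data of the input consisting of `p`, `ε` and `η`. -/
noncomputable def instOf {n : ℕ} (p : MvPolynomial (Fin n) ℤ) (ε η : ℚ) : Inst where
  n := n
  quad := inputStore p ε η 1
  lin j := inputStore p ε η 2 j 0
  en := ε.num.toNat
  ed := ε.den
  hn := η.num.toNat
  hd := η.den

section Input

variable {n b : ℕ} {p : MvPolynomial (Fin n) ℤ} {ε η : ℚ}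

theorem inp_inputStore (hε : 0 < ε) (hη : 0 < η) :
    (instOf p ε η).Inp (inputStore p ε η) :=
  ⟨rfl, (Int.toNat_of_nonneg (Rat.num_pos.2 hε).le).symm, rfl,
    (Int.toNat_of_nonneg (Rat.num_pos.2 hη).le).symm, rfl, rfl, fun _ => rfl⟩

theorem noOutput_inputStore : NoOutput (inputStore p ε η) := fun _ _ => ⟨rfl, rfl, rfl⟩

theorem bitLen_inputStore_le (hp : ∀ m, |p.coeff m| < 2 ^ b) (a i j : ℕ) :
    bitLen (inputStore p ε η a i j) ≤ n + b + ratBits ε + ratBits η + 1 := by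
  have h0 : bitLen 0 ≤ n + b + ratBits ε + ratBits η + 1 := by
    rw [show bitLen 0 = 1 by decide]; omega
  have hc (m : Fin n →₀ ℕ) : bitLen (p.coeff m) ≤ n + b + ratBits ε + ratBits η + 1 := by
    refine (bitLen_le_iff.2 ?_ : _ ≤ b + 1).trans (by omega)
    have := hp m
    rw [Int.abs_eq_natAbs] at this
    exact_mod_cast this
  unfold inputStore
  split
  · exact (bitLen_natCast_le n).trans (by omega)
  · unfold ratBits; omega
  · unfold ratBits; omega
  · unfold ratBits; omega
  · unfold ratBits; omega
  · split_ifs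
    exacts [hc _, h0]
  · split_ifs
    exacts [hc _, h0]
  · exact h0

/-- A bound for the bit lengths of the input. -/
def inputBound (n b : ℕ) (ε η : ℚ) : ℕ := n * n + b + ratBits ε + ratBits η + 100

theorem exists_exec (hp : ∀ m, |p.coeff m| < 2 ^ b) (hε : 0 < ε) (hη : 0 < η) :
    Runs (400 * (20 * inputBound n b ε η * ((instOf p ε η).K + 1))) decomposeCmd
      (inputStore p ε η) (6 * (n * n) + 3 * n + 15 + 2 * n *
      ((instOf p ε η).K * (10 * (n * n) + 36 * n +
        8 * (20 * inputBound n b ε η * ((instOf p ε η).K + 1)) + 44) + 4 * n + 8)) fun σ' =>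
      ((instOf p ε η).V ≤ 0 → σ' 3 0 0 = 1 ∧ (∀ i j, (i, j) ≠ (0, 0) → σ' 3 i j = 0) ∧
        ∀ i j, σ' 4 i j = 0 ∧ σ' 5 i j = 0) ∧
      (0 < (instOf p ε η).V → (instOf p ε η).OutInv σ' ∧
        ((∃ r < 2 * n, ∃ k < (instOf p ε η).K,
          (instOf p ε η).Acc ((instOf p ε η).v (r / 2) (roundSign r) k) (r / 2)) →
          σ' 3 0 0 ≠ 0)) := by
  set I := instOf p ε η
  set l := inputBound n b ε η with hl
  have hll : 20 * l ≤ 20 * l * (I.K + 1) := Nat.le_mul_of_pos_right _ (Nat.succ_pos _)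
  have hn : n ≤ n * n := Nat.le_mul_self n
  have hb : Bounds I l (20 * l * (I.K + 1)) := by
    refine ⟨?_, ?_, hll⟩
    · rw [hl, inputBound]; omega
    · change n * n + 1 ≤ l
      rw [hl, inputBound]; omega
  refine runs_decomposeCmd hb le_rfl (fun a i j => ?_) (inp_inputStore hε hη) noOutput_inputStore
  have h1 : l ≤ beta l (20 * l * (I.K + 1)) a := by unfold beta; split <;> omega
  refine ((bitLen_inputStore_le hp a i j).trans ?_).trans h1
  rw [hl, inputBound]; omega

end Input

/-! ### The running time -/

/-- The degrees are: input bits Z², iterations Z⁴, hence iterate bits Z⁶; elementary steps n·K·m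
give Z¹¹, each of cost m², that is Z¹². The total degree is 23. -/
theorem time_le : ∃ D k : ℕ, ∀ n b a c q Z : ℕ, n + b + a + c + q + 1 ≤ Z →
    (6 * (n * n) + 3 * n + 15 + 2 * n * ((2 * n * n * a + 32 * n * n * c * c) *
      (10 * (n * n) + 36 * n + 8 * (20 * (n * n + b + q + 100) *
      (2 * n * n * a + 32 * n * n * c * c + 1)) + 44) + 4 * n + 8)) *
      stepCost (400 * (20 * (n * n + b + q + 100) * (2 * n * n * a + 32 * n * n * c * c + 1))) ≤
      D * Z ^ k := by
  refine ⟨10 ^ 33, 23, fun n b a c q Z hZ => ?_⟩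
  have h1 : 1 ≤ Z := by omega
  have hp (i j : ℕ) (h : i ≤ j) : Z ^ i ≤ Z ^ j := Nat.pow_le_pow_right h1 h
  have hn : n ≤ Z := by omega
  have hl : n * n + b + q + 100 ≤ 102 * Z ^ 2 := by
    have h2 : n * n ≤ Z ^ 2 := by rw [pow_two]; gcongr
    have h3 : b + q ≤ Z := by omega
    have h4 := hp 1 2 (by norm_num)
    have h5 := hp 0 2 (by norm_num)
    rw [pow_one] at h4; rw [pow_zero] at h5
    omega
  have hK : 2 * n * n * a + 32 * n * n * c * c ≤ 34 * Z ^ 4 := by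
    have ha : a ≤ Z := by omega
    have hc : c ≤ Z := by omega
    calc 2 * n * n * a + 32 * n * n * c * c ≤ 2 * Z * Z * Z + 32 * Z * Z * Z * Z := by gcongr
      _ = 2 * Z ^ 3 + 32 * Z ^ 4 := by ring
      _ ≤ 2 * Z ^ 4 + 32 * Z ^ 4 := by have := hp 3 4 (by norm_num); omega
      _ = _ := by ring
  generalize 2 * n * n * a + 32 * n * n * c * c = K at *
  generalize n * n + b + q + 100 = l at *
  have hm : 20 * l * (K + 1) ≤ 71400 * Z ^ 6 := by
    calc 20 * l * (K + 1) ≤ 20 * (102 * Z ^ 2) * (34 * Z ^ 4 + Z ^ 4) := by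
          have := hp 0 4 (by norm_num)
          rw [pow_zero] at this
          gcongr
      _ = _ := by ring
  generalize 20 * l * (K + 1) = m at *
  have hT : 6 * (n * n) + 3 * n + 15 + 2 * n * (K * (10 * (n * n) + 36 * n + 8 * m + 44) +
      4 * n + 8) ≤ 10 ^ 8 * Z ^ 11 := by
    have h0 (i : ℕ) (hi : i ≤ 11) : Z ^ i ≤ Z ^ 11 := hp i 11 hi
    calc _ ≤ 6 * (Z * Z) + 3 * Z + 15 + 2 * Z * (34 * Z ^ 4 * (10 * (Z * Z) + 36 * Z +
          8 * (71400 * Z ^ 6) + 44) + 4 * Z + 8) := by gcongr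
      _ = 6 * Z ^ 2 + 3 * Z ^ 1 + 15 * Z ^ 0 + 680 * Z ^ 7 + 2448 * Z ^ 6 + 38841600 * Z ^ 11 +
          2992 * Z ^ 5 + 8 * Z ^ 2 + 16 * Z ^ 1 := by ring
      _ ≤ 6 * Z ^ 11 + 3 * Z ^ 11 + 15 * Z ^ 11 + 680 * Z ^ 11 + 2448 * Z ^ 11 +
          38841600 * Z ^ 11 + 2992 * Z ^ 11 + 8 * Z ^ 11 + 16 * Z ^ 11 := by
        gcongr <;> first | exact h1 | norm_num
      _ ≤ _ := by omega
  calc _ ≤ (10 ^ 8 * Z ^ 11) * (2 * 1000 ^ 3 * (400 * (71400 * Z ^ 6)) ^ 2) := by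
        unfold stepCost; gcongr
    _ = (10 ^ 8 * (2 * 1000 ^ 3 * (400 * 71400) ^ 2)) * Z ^ 23 := by ring
    _ ≤ _ := by gcongr; norm_num

theorem div_add_one_le {q : ℚ} (hq : 0 < q) : ((q.den / q.num.toNat + 1 : ℕ) : ℚ) ≤ 1 / q + 1 := by
  have h1 : ((q.num.toNat : ℕ) : ℚ) = q.num := by
    exact_mod_cast Int.toNat_of_nonneg (Rat.num_pos.2 hq).le
  have h2 : (q.den : ℚ) / q.num = 1 / q := by
    conv_rhs => rw [← Rat.num_div_den q]
    rw [one_div_div]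
  push_cast
  have := @Nat.cast_div_le ℚ _ _ _ q.den q.num.toNat
  rw [h1, h2] at this
  linarith

end GaussDecomp

namespace GaussDecomp

/-! ### Correctness of the output -/

theorem map_quadPoly {R S : Type*} [CommRing R] [CommRing S] {m : ℕ} (f : R →+* S)
    (A : Fin m → Fin m → R) (b : Fin m → R) (c : R) :
    MvPolynomial.map f (quadPoly A b c) =
      quadPoly (fun i j => f (A i j)) (fun i => f (b i)) (f c) := by
  simp [quadPoly, MvPolynomial.map_monomial]

theorem sum_range_mul_self {M : Type*} [AddCommMonoid M] (n : ℕ) (f : ℕ → ℕ → M) :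
    ∑ t ∈ Finset.range (n * n), f (t / n) (t % n) = ∑ i : Fin n, ∑ j : Fin n, f i j := by
  rw [Finset.sum_range, ← Fintype.sum_prod_type' (fun i j : Fin n => f i j),
    ← finProdFinEquiv.symm.sum_comp]
  rfl

section

variable {n : ℕ} {p : MvPolynomial (Fin n) ℤ} {ε η : ℚ}

theorem hessian_map_eq (i j : Fin n) :
    hessian (p.map (Int.castRingHom ℝ)) i j = ((instOf p ε η).B i j : ℝ) := by
  have h : (instOf p ε η).quad i j = p.coeff (pairExp i j) := dif_pos ⟨i.2, j.2⟩
  rw [Inst.B, h, hessian, MvPolynomial.coeff_map]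
  simp only [Fin.val_inj]
  split_ifs <;> simp; ring

theorem coeff_map_single_eq (i : Fin n) :
    (p.map (Int.castRingHom ℝ)).coeff (Finsupp.single i 1) = ((instOf p ε η).lin i : ℝ) := by
  have h : (instOf p ε η).lin i = p.coeff (Finsupp.single i 1) := dif_pos i.2
  rw [h, MvPolynomial.coeff_map]
  rfl

theorem totalDegree_map_le_two (hp : p.totalDegree ≤ 2) :
    (p.map (Int.castRingHom ℝ)).totalDegree ≤ 2 :=
  (Finset.sup_mono (MvPolynomial.support_map_subset _ _)).trans hp

theorem cast_V_eq (hp : p.totalDegree ≤ 2) :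
    ((instOf p ε η).V : ℝ) = 2 * polyVar (p.map (Int.castRingHom ℝ)) := by
  rw [polyVar_eq_hessian (totalDegree_map_le_two hp), Inst.V, Inst.F]
  have h := sum_range_mul_self n fun i j => (instOf p ε η).B i j * (instOf p ε η).B i j
  change ((∑ t ∈ Finset.range (n * n), _ + 2 * ∑ j ∈ Finset.range n, _ : ℤ) : ℝ) = _
  rw [show (instOf p ε η).n = n from rfl, h, Finset.sum_range]
  push_cast
  simp only [hessian_map_eq (ε := ε) (η := η), coeff_map_single_eq (ε := ε) (η := η), pow_two]

/-- Reflections preserve length, in integral form. This is a polynomial identity in N, so exactness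
of the unit length does not depend on how well N approximates |v|. -/
theorem Inst.sum_vec_sq (I : Inst) (v : ℕ → ℤ) {i : ℕ} (hi : i < I.n) :
    ∑ j ∈ Finset.range I.n, I.vec v i j ^ 2 = I.den v i ^ 2 := by
  obtain ⟨N, hN⟩ : ∃ N : ℤ, N = I.len v := ⟨_, rfl⟩
  have h1 : ∑ j ∈ Finset.range I.n, (v j + N * if j = i then 1 else 0) ^ 2 = I.den v i := by
    have (j : ℕ) : (v j + N * if j = i then 1 else 0) ^ 2 =
        v j * v j + (if j = i then 2 * N * v j + N * N else 0) := by
      split_ifs <;> ring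
    simp only [this, Finset.sum_add_distrib, Finset.sum_ite_eq', Finset.mem_range, hi, if_true]
    rw [Inst.den, ← hN]; ring
  have h2 (j : ℕ) : I.vec v i j ^ 2 = 4 * (v i + N) ^ 2 * (v j + N * if j = i then 1 else 0) ^ 2 +
      (if j = i then I.den v i ^ 2 - 4 * (v i + N) * (v j + N) * I.den v i else 0) := by
    rw [Inst.vec, ← hN]
    split_ifs <;> ring
  simp only [h2, Finset.sum_add_distrib, ← Finset.mul_sum, h1, Finset.sum_ite_eq',
    Finset.mem_range, hi, if_true]
  ring

theorem readOutput_eq {σ : Store} (h : σ 3 0 0 ≠ 0) : readOutput n σ =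
    .decomposition ((σ 3 1 0 : ℚ) / σ 3 0 0) ((σ 3 2 0 : ℚ) / σ 3 0 0)
      (quadPoly (fun i j => (σ 4 i j : ℚ) / σ 3 0 0) (fun i => (σ 5 i 0 : ℚ) / σ 3 0 0)
        ((σ 3 3 0 : ℚ) / σ 3 0 0)) := by
  rw [readOutput, if_neg h]
  rfl

theorem cast_toNat_num {q : ℚ} (hq : 0 < q) : ((q.num.toNat : ℕ) : ℝ) = q * (q.den : ℕ) := by
  have h : ((q.num.toNat : ℤ) : ℚ) = q * q.den := by
    rw [Int.toNat_of_nonneg (Rat.num_pos.2 hq).le, Rat.mul_den_eq_num]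
  exact_mod_cast congrArg (Rat.cast (K := ℝ)) h

theorem cast_en_eq (hε : 0 < ε) : ((instOf p ε η).en : ℝ) = ε * (instOf p ε η).ed :=
  cast_toNat_num hε

theorem cast_hn_eq (hη : 0 < η) : ((instOf p ε η).hn : ℝ) = η * (instOf p ε η).hd :=
  cast_toNat_num hη

theorem isGood_readOutput (hp : p.totalDegree ≤ 2) (hp0 : p.coeff 0 = 0) (hε : 0 < ε) (hη : 0 < η)
    {σ : Store} (h : (instOf p ε η).OutInv σ) (h3 : σ 3 0 0 ≠ 0) :
    (readOutput n σ).IsGood (p.map (Int.castRingHom ℝ)) ε η := by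
  obtain ⟨⟨h33, h40, h50⟩, h | ⟨v, i, hi, ⟨hd, hres, heig⟩, h30, h31, h32, hA0, hb, hA⟩⟩ := h
  · exact absurd h h3
  refine ⟨_, _, _, readOutput_eq h3, ?_⟩
  rw [map_quadPoly, h33]
  have hz2 := (instOf p ε η).sum_vec_sq v hi
  have hV := cast_V_eq (ε := ε) (η := η) hp
  have hB := hessian_map_eq (p := p) (ε := ε) (η := η)
  have hlin := coeff_map_single_eq (p := p) (ε := ε) (η := η)
  have hen := cast_en_eq (p := p) (η := η) hε
  have hhn := cast_hn_eq (p := p) (ε := ε) hη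
  have hed : (0 : ℝ) < (instOf p ε η).ed := by exact_mod_cast ε.den_pos
  have hhd : (0 : ℝ) < (instOf p ε η).hd := by exact_mod_cast η.den_pos
  change ∀ j < n, _ at hA0 hb
  change ∀ i < n, ∀ j < n, _ at hA
  set I := instOf p ε η
  set P := p.map (Int.castRingHom ℝ)
  set z := I.vec v i with hz
  set d := I.den v i
  have hD : (0 : ℝ) < d := by exact_mod_cast hd
  generalize hDd : (d : ℝ) = D at hD
  have h30' : (σ 3 0 0 : ℝ) = 2 * D ^ 4 := by rw [h30]; push_cast; rw [hDd]; ring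
  have hsum : ∑ j : Fin n, (z j : ℝ) ^ 2 = D ^ 2 := by
    rw [← hDd]
    exact_mod_cast (Finset.sum_range fun j => z j ^ 2).symm.trans hz2
  have himg (j : Fin n) : (I.img z j : ℝ) = ∑ k : Fin n, hessian P j k * z k := by
    rw [Inst.img, show I.n = n from rfl, Finset.sum_range]
    push_cast
    simp only [hB]
  have hray : (I.ray z : ℝ) = ∑ k : Fin n, (z k : ℝ) * I.img z k := by
    rw [Inst.ray, show I.n = n from rfl, Finset.sum_range]; push_cast; rfl
  have hsq : (I.imgSq z : ℝ) = ∑ k : Fin n, (I.img z k : ℝ) ^ 2 := by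
    rw [Inst.imgSq, show I.n = n from rfl, Finset.sum_range]; push_cast; simp only [pow_two]
  have hld : (I.linDot z : ℝ) = ∑ k : Fin n, P.coeff (Finsupp.single k 1) * z k := by
    rw [Inst.linDot, show I.n = n from rfl, Finset.sum_range]; push_cast; simp only [hlin]
  replace hres : (D * D * I.imgSq z - I.ray z * I.ray z) * (I.hd * I.hd : ℝ) ≤
      2 * (I.hn * I.hn) * I.V * (D * D * (D * D)) := by rw [← hDd]; exact_mod_cast hres
  replace heig : I.en * I.en * (I.en * I.en) * I.V * (D * D * (D * D)) ≤
      (40 * (I.ray z * I.ray z) * (I.ed * I.ed * (I.ed * I.ed)) : ℝ) := by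
    rw [← hDd]; exact_mod_cast heig
  -- The unit vector is w = z/D. The coefficients involve up to four divisions by D and, on the
  -- diagonal, one by 2, whence the common denominator 2D⁴.
  have key := isDecomposition_of_unit (p := P) (totalDegree_map_le_two hp)
    (by rw [MvPolynomial.coeff_map, hp0]; simp) (w := fun j => z j / D)
    (g := fun j => I.img z j / D) (h := I.ray z / D ^ 2) (β := I.linDot z / D) (ε := ε) (η := η)
    (A := fun i j => (σ 4 i j : ℝ) / σ 3 0 0) (b := fun i => (σ 5 i 0 : ℝ) / σ 3 0 0)
    ?_ ?_ ?_ ?_ ?_ ?_ ?_ ?_ ?_ ?_ ?_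
  · convert key using 1
    · simp only [Rat.cast_div, Rat.cast_intCast, h30', h31]
      push_cast
      rw [hDd]
      field_simp
    · simp only [Rat.cast_div, Rat.cast_intCast, h30', h32]
      push_cast
      rw [hDd]
      field_simp
    · simp
  · simp only [div_pow, ← Finset.sum_div, hsum]
    exact div_self (by positivity)
  · intro j
    simp only [himg, Finset.sum_div, mul_div_assoc]
  · simp only [hray, Finset.sum_div]
    exact Finset.sum_congr rfl fun k _ => by field_simp
  · simp only [hld, Finset.sum_div, mul_div_assoc]
  · simp [h40]
  · intro j
    have h1 := hA0 j j.2
    simp only [Fin.val_zero, Fin.val_succ, h1, h30']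
    push_cast
    rw [hDd]
    field_simp
  · intro k j hkj
    have h1 := hA k k.2 j j.2
    simp only [Fin.val_succ, h1, h30', hB, Fin.val_inj]
    push_cast
    rw [hDd]
    split_ifs <;> field_simp <;> ring
  · simp [h50]
  · intro j
    have h1 := hb j j.2
    simp only [Fin.val_succ, h1, h30', hlin]
    push_cast
    rw [hDd]
    field_simp
  · have h1 : ∑ k : Fin n, ((I.img z k : ℝ) / D - I.ray z / D ^ 2 * (z k / D)) ^ 2 =
        (D * D * I.imgSq z - I.ray z * I.ray z) / D ^ 4 := by
      have (k : Fin n) : ((I.img z k : ℝ) / D - I.ray z / D ^ 2 * (z k / D)) ^ 2 =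
          (I.img z k : ℝ) ^ 2 / D ^ 2 - 2 * I.ray z / D ^ 4 * (z k * I.img z k) +
            I.ray z ^ 2 / D ^ 6 * (z k : ℝ) ^ 2 := by
        field_simp; ring
      simp only [this, Finset.sum_add_distrib, Finset.sum_sub_distrib, ← Finset.sum_div,
        ← Finset.mul_sum, hsum, ← hray, ← hsq]
      field_simp; ring
    rw [h1, div_le_iff₀ (by positivity)]
    rw [hhn, hV] at hres
    have h2 : 0 < (I.hd : ℝ) * I.hd := by positivity
    refine le_of_mul_le_mul_right (hres.trans_eq ?_) h2
    ring
  · rw [hen, hV] at heig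
    have h2 : 0 < (I.ed : ℝ) * I.ed * (I.ed * I.ed) := by positivity
    have h3 : (ε : ℝ) ^ 4 * (2 * polyVar P) * D ^ 4 ≤ 40 * (I.ray z : ℝ) ^ 2 := by
      refine le_of_mul_le_mul_right (le_trans (le_of_eq ?_) (heig.trans_eq ?_)) h2 <;> ring
    rw [div_pow, ← pow_mul, div_div, le_div_iff₀ (by positivity)]
    linarith

end

end GaussDecomp

namespace GaussDecomp

/-! ### The algorithm finds a large eigenvalue -/

open Matrix

theorem mulVec_dot_self_le {n : ℕ} (B : Matrix (Fin n) (Fin n) ℝ) (x : Fin n → ℝ) :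
    (B *ᵥ x) ⬝ᵥ (B *ᵥ x) ≤ (∑ i, ∑ j, B i j ^ 2) * (x ⬝ᵥ x) := by
  rw [Finset.sum_mul]
  refine Finset.sum_le_sum fun i _ => ?_
  have := dot_sq_le (B i) x
  simpa only [dotProduct, mulVec, ← pow_two] using this

theorem abs_dot_mulVec_le_sum {n : ℕ} (B : Matrix (Fin n) (Fin n) ℝ) (x : Fin n → ℝ) :
    |x ⬝ᵥ B *ᵥ x| ≤ (∑ i, ∑ j, |B i j|) * (x ⬝ᵥ x) := by
  have hx (i j : Fin n) : |x i * x j| ≤ x ⬝ᵥ x := by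
    have h (i : Fin n) : x i ^ 2 ≤ x ⬝ᵥ x := by
      rw [pow_two]
      exact Finset.single_le_sum (f := fun i => x i * x i) (fun i _ => mul_self_nonneg _)
        (Finset.mem_univ i)
    have h1 := h i
    have h2 := h j
    rw [abs_le]
    constructor <;> nlinarith [sq_nonneg (x i + x j), sq_nonneg (x i - x j)]
  rw [dotProduct, Finset.sum_mul]
  refine (Finset.abs_sum_le_sum_abs _ _).trans (Finset.sum_le_sum fun i _ => ?_)
  rw [mulVec, dotProduct, Finset.mul_sum, Finset.sum_mul]
  refine (Finset.abs_sum_le_sum_abs _ _).trans (Finset.sum_le_sum fun j _ => ?_)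
  rw [show x i * (B i j * x j) = B i j * (x i * x j) by ring, abs_mul]
  exact mul_le_mul_of_nonneg_left (hx i j) (abs_nonneg _)

theorem sum_abs_sq_le {n : ℕ} (B : Matrix (Fin n) (Fin n) ℝ) :
    (∑ i, ∑ j, |B i j|) ^ 2 ≤ n ^ 2 * ∑ i, ∑ j, B i j ^ 2 := by
  have h := sq_sum_le_card_mul_sum_sq (s := (Finset.univ : Finset (Fin n × Fin n)))
    (f := fun ij => |B ij.1 ij.2|)
  simp only [sq_abs, Fintype.sum_prod_type, Finset.card_univ, Fintype.card_prod,
    Fintype.card_fin] at h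
  refine h.trans_eq ?_
  push_cast; ring

/-- An eigenvalue whose magnitude is almost the largest one. -/
theorem exists_eigenvector_of_lt_lambdaMax {n : ℕ} {P : MvPolynomial (Fin n) ℝ} {t : ℝ}
    (ht0 : 0 ≤ t) (ht : t < lambdaMax P) :
    ∃ (μ : ℝ) (x : Fin n → ℝ), t < |μ| ∧ x ≠ 0 ∧ Matrix.of (hessian P) *ᵥ x = (2 * μ) • x := by
  -- Without eigenvalues the supremum would be the default value 0, contradicting 0 ≤ t < `lambdaMax
  -- P`.
  have hne : {t : ℝ | ∃ μ : ℝ, Module.End.HasEigenvalue (Matrix.toLin' (quadMatrix P)) μ ∧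
      t = |μ|}.Nonempty := by
    by_contra h
    rw [Set.not_nonempty_iff_eq_empty] at h
    rw [lambdaMax, h, Real.sSup_empty] at ht
    exact absurd ht0 (not_le.2 ht)
  obtain ⟨_, ⟨μ, hμ, rfl⟩, h⟩ := exists_lt_of_lt_csSup hne ht
  obtain ⟨x, hx⟩ := hμ.exists_hasEigenvector
  refine ⟨μ, x, h, hx.2, ?_⟩
  have h1 : Matrix.of (hessian P) = (2 : ℝ) • quadMatrix P := by
    ext i j
    simp only [Matrix.of_apply, hessian, quadMatrix, Matrix.smul_apply, smul_eq_mul]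
    split_ifs <;> ring
  have h2 := hx.apply_eq_smul
  rw [Matrix.toLin'_apply] at h2
  rw [h1, Matrix.smul_mulVec, h2, smul_smul]

section

variable {n : ℕ} {p : MvPolynomial (Fin n) ℤ} {ε η : ℚ}

theorem cast_v_eq {i : Fin n} {sg : ℤ} (k : ℕ) : ∀ j : Fin n,
    ((instOf p ε η).v i sg k j : ℝ) = powSeq (((instOf p ε η).s : ℝ) • 1 +
      (sg : ℝ) • Matrix.of (hessian (p.map (Int.castRingHom ℝ))))
      (((instOf p ε η).Q : ℝ) • Pi.single i 1) k j := by
  induction k with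
  | zero =>
    intro j
    rw [Inst.v, powSeq]
    simp [Pi.single_apply, Fin.val_inj]
  | succ k ih =>
    intro j
    rw [Inst.v, powSeq, show (instOf p ε η).n = n from rfl, Finset.sum_range, mulVec, dotProduct]
    push_cast
    refine Finset.sum_congr rfl fun t _ => ?_
    rw [ih t, Matrix.add_apply, Matrix.smul_apply, Matrix.smul_apply, Matrix.of_apply,
      hessian_map_eq (ε := ε) (η := η), Matrix.one_apply]
    simp [Fin.val_inj]

/-- Acceptance, in terms of the rational unit vector. -/
theorem acc_of_reflVec (hε : 0 < ε) (hη : 0 < η) {v : ℕ → ℤ} {i : Fin n} {x w u : Fin n → ℝ}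
    (hx : x = fun j : Fin n => (v j : ℝ)) {N : ℝ} (hN : N = (instOf p ε η).len v)
    (hu : u = x + N • Pi.single i 1) (hw : w = reflVec x N i) (h0 : 0 < u ⬝ᵥ u)
    {B : Matrix (Fin n) (Fin n) ℝ} (hB : B = Matrix.of (hessian (p.map (Int.castRingHom ℝ))))
    (h1 : (B *ᵥ w) ⬝ᵥ (B *ᵥ w) - (w ⬝ᵥ B *ᵥ w) ^ 2 ≤ 2 * η ^ 2 * (instOf p ε η).V)
    (h2 : ε ^ 4 * (instOf p ε η).V ≤ 40 * (w ⬝ᵥ B *ᵥ w) ^ 2) : (instOf p ε η).Acc v i := by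
  have hen := cast_en_eq (p := p) (η := η) hε
  have hhn := cast_hn_eq (p := p) (ε := ε) hη
  set I := instOf p ε η
  have hBij (j k : Fin n) : B j k = (I.B j k : ℝ) := by rw [hB]; exact hessian_map_eq j k
  have hden : (I.den v i : ℝ) = u ⬝ᵥ u := by
    have h3 : u ⬝ᵥ u = x ⬝ᵥ x + 2 * N * x i + N * N := by
      rw [hu]
      simp only [add_dotProduct, dotProduct_add, smul_dotProduct, dotProduct_smul, smul_eq_mul,
        single_dotProduct, dotProduct_single, one_mul, mul_one,
        Pi.add_apply, Pi.smul_apply, Pi.single_eq_same]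
      ring
    rw [h3, Inst.den, show I.n = n from rfl, Finset.sum_range, hx, hN]
    push_cast; rfl
  have hz (j : Fin n) : (I.vec v i j : ℝ) = (u ⬝ᵥ u) * w j := by
    rw [hw, reflVec, ← hu, Inst.vec]
    push_cast
    rw [hden, ← hN]
    have h4 (k : Fin n) : u k = v k + N * if (k : ℕ) = i then 1 else 0 := by
      rw [hu, hx]
      simp [Pi.single_apply, Fin.val_inj]
    have h5 : (Pi.single i 1 : Fin n → ℝ) j = if (j : ℕ) = i then 1 else 0 := by
      simp [Pi.single_apply, Fin.val_inj]
    rw [Pi.sub_apply, Pi.smul_apply, smul_eq_mul, h5, mul_sub, ← mul_assoc, mul_div_cancel₀ _ h0.ne',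
      h4 j, h4 i, if_pos rfl, mul_one]
  generalize u ⬝ᵥ u = D at *
  have himg (j : Fin n) : (I.img (I.vec v i) j : ℝ) = D * (B *ᵥ w) j := by
    rw [Inst.img, show I.n = n from rfl, Finset.sum_range, mulVec, dotProduct, Finset.mul_sum]
    push_cast
    exact Finset.sum_congr rfl fun k _ => by rw [hz, hBij]; ring
  have hray : (I.ray (I.vec v i) : ℝ) = D ^ 2 * (w ⬝ᵥ B *ᵥ w) := by
    rw [Inst.ray, show I.n = n from rfl, Finset.sum_range, dotProduct, Finset.mul_sum]
    push_cast
    exact Finset.sum_congr rfl fun k _ => by rw [hz, himg]; ring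
  have hsq : (I.imgSq (I.vec v i) : ℝ) = D ^ 2 * ((B *ᵥ w) ⬝ᵥ (B *ᵥ w)) := by
    rw [Inst.imgSq, show I.n = n from rfl, Finset.sum_range, dotProduct, Finset.mul_sum]
    push_cast
    exact Finset.sum_congr rfl fun k _ => by rw [himg]; ring
  refine ⟨?_, ?_, ?_⟩
  · rw [← hden] at h0; exact_mod_cast h0
  · have : ((I.den v i * I.den v i * I.imgSq (I.vec v i) - I.ray (I.vec v i) * I.ray (I.vec v i)) *
        (I.hd * I.hd) : ℝ) ≤
        2 * (I.hn * I.hn) * I.V * (I.den v i * I.den v i * (I.den v i * I.den v i)) := by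
      rw [hden, hsq, hray, hhn]
      have := mul_le_mul_of_nonneg_left h1 (show 0 ≤ D ^ 4 * (I.hd : ℝ) ^ 2 by positivity)
      linarith
    exact_mod_cast this
  · have : (I.en * I.en * (I.en * I.en) * I.V *
        (I.den v i * I.den v i * (I.den v i * I.den v i)) : ℝ) ≤
        40 * (I.ray (I.vec v i) * I.ray (I.vec v i)) * (I.ed * I.ed * (I.ed * I.ed)) := by
      rw [hden, hray, hen]
      have := mul_le_mul_of_nonneg_left h2 (show 0 ≤ D ^ 4 * (I.ed : ℝ) ^ 4 by positivity)
      linarith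
    exact_mod_cast this

theorem one_div_le_div_add_one {q : ℚ} (hq : 0 < q) :
    1 / (q : ℝ) ≤ ((q.den / q.num.toNat + 1 : ℕ) : ℝ) := by
  have h1 : ((q.num.toNat : ℕ) : ℤ) = q.num := Int.toNat_of_nonneg (Rat.num_pos.2 hq).le
  have h2 : (0 : ℝ) < (q.num.toNat : ℕ) := by
    have : (0 : ℤ) < (q.num.toNat : ℕ) := by rw [h1]; exact Rat.num_pos.2 hq
    exact_mod_cast this
  have h3 : (q : ℝ) = (q.num.toNat : ℕ) / (q.den : ℝ) := by
    rw [Rat.cast_def]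
    congr 1
    exact_mod_cast h1.symm
  rw [h3, one_div_div, div_le_iff₀ h2]
  exact_mod_cast (Nat.lt_mul_of_div_lt (Nat.lt_succ_self _) (by exact_mod_cast h2)).le

theorem residual_le {η c X F Y : ℝ} (hη : 0 < η) (hc : 1 / η ≤ c) (hX : 0 ≤ X)
    (h : c ^ 2 * X ≤ 2 * F ^ 2) (hF : F ^ 2 ≤ 2 * Y) : X ≤ 2 * η ^ 2 * (2 * Y) := by
  have h1 : 1 ≤ η * c := by rw [div_le_iff₀ hη] at hc; linarith
  calc X ≤ (η * c) ^ 2 * X := le_mul_of_one_le_left hX (one_le_pow₀ h1)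
    _ = η ^ 2 * (c ^ 2 * X) := by ring
    _ ≤ η ^ 2 * (2 * F ^ 2) := by gcongr
    _ ≤ η ^ 2 * (2 * (2 * Y)) := by gcongr
    _ = _ := by ring

/-- The bound on L yields t² of order ε²Y. The chain 9ε²Y/4 ≤ L² ≤ F² ≤ 2Y forces ε ≤ 1, so ε⁴ ≤ ε².
-/
theorem eigenvalue_sq_ge {ε F L Y t : ℝ} (hε : 0 < ε) (hY : 0 < Y) (hL : 3 / 2 * (ε * √Y) ≤ L)
    (hLF : L ^ 2 ≤ F ^ 2) (hF : F ^ 2 ≤ 2 * Y) (ht : L / 4 ≤ t) :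
    ε ^ 4 * (2 * Y) ≤ 40 * t ^ 2 := by
  have h0 : 0 < √Y := Real.sqrt_pos.2 hY
  have hL0 : 0 ≤ L := le_trans (by positivity) hL
  have h3 : (L / 4) ^ 2 ≤ t ^ 2 := by gcongr
  have h4 : (3 / 2 * (ε * √Y)) ^ 2 ≤ L ^ 2 := by gcongr
  have h5 : (3 / 2 * (ε * √Y)) ^ 2 = 9 / 4 * (ε ^ 2 * Y) := by
    rw [mul_pow, mul_pow, Real.sq_sqrt hY.le]; ring
  have h6 : ε ^ 2 ≤ 1 := by
    refine le_of_mul_le_mul_right (a := Y) ?_ hY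
    linarith
  have h7 : ε ^ 4 * Y ≤ ε ^ 2 * Y := by
    rw [show ε ^ 4 * Y = ε ^ 2 * (ε ^ 2 * Y) by ring]
    exact mul_le_of_le_one_left (by positivity) h6
  have h8 : 0 < ε ^ 2 * Y := by positivity
  rw [h5] at h4
  calc ε ^ 4 * (2 * Y) = 2 * (ε ^ 4 * Y) := by ring
    _ ≤ 40 * (L / 4) ^ 2 := by linarith
    _ ≤ 40 * t ^ 2 := by linarith

theorem len_bounds {I : Inst} {v : ℕ → ℤ} {x : Fin I.n → ℝ} (hx : x = fun j : Fin I.n => (v j : ℝ)) :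
    (I.len v : ℝ) ^ 2 ≤ x ⬝ᵥ x ∧ x ⬝ᵥ x ≤ (I.len v + 1 : ℝ) ^ 2 := by
  have hvv : x ⬝ᵥ x = ((∑ j ∈ Finset.range I.n, v j * v j).toNat : ℕ) := by
    have h0 : 0 ≤ ∑ j ∈ Finset.range I.n, v j * v j := Finset.sum_nonneg fun j _ => mul_self_nonneg _
    have h1 : (((∑ j ∈ Finset.range I.n, v j * v j).toNat : ℕ) : ℤ) = _ := Int.toNat_of_nonneg h0
    have h2 : (((∑ j ∈ Finset.range I.n, v j * v j).toNat : ℕ) : ℝ) =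
        ((∑ j ∈ Finset.range I.n, v j * v j : ℤ) : ℝ) := by exact_mod_cast h1
    rw [h2, Finset.sum_range, hx]
    push_cast; rfl
  rw [hvv]
  exact ⟨by exact_mod_cast Nat.sqrt_le' _, by exact_mod_cast (Nat.lt_succ_sqrt' _).le⟩

theorem exists_acc (hp : p.totalDegree ≤ 2) (hε : 0 < ε) (hη : 0 < η)
    (hV : 0 < (instOf p ε η).V)
    (hlam : ε * √(polyVar (p.map (Int.castRingHom ℝ))) ≤ lambdaMax (p.map (Int.castRingHom ℝ))) :
    ∃ r < 2 * n, ∃ k < (instOf p ε η).K,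
      (instOf p ε η).Acc ((instOf p ε η).v (r / 2) (roundSign r) k) (r / 2) := by
  have hVv := cast_V_eq (ε := ε) (η := η) hp
  have hVR : (0 : ℝ) < (instOf p ε η).V := by exact_mod_cast hV
  have hBij := hessian_map_eq (p := p) (ε := ε) (η := η)
  have hvar := polyVar_eq_hessian (totalDegree_map_le_two hp)
  have hεR : (0 : ℝ) < ε := by exact_mod_cast hε
  have hηR : (0 : ℝ) < η := by exact_mod_cast hη
  have ha : 1 / (ε : ℝ) ≤ (instOf p ε η).a := one_div_le_div_add_one hε
  have hc : 1 / (η : ℝ) ≤ (instOf p ε η).c := one_div_le_div_add_one hη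
  have hc1 : 1 ≤ (instOf p ε η).c := Nat.le_add_left _ _
  have hcv := fun (i : Fin n) (sg : ℤ) (k : ℕ) => cast_v_eq (p := p) (ε := ε) (η := η) (i := i)
    (sg := sg) k
  set P := p.map (Int.castRingHom ℝ) with hP
  set Y := polyVar P
  have hY : 0 < Y := by linarith
  have hsY := Real.sqrt_pos.2 hY
  have hsY2 := Real.sq_sqrt hY.le
  -- The loss of 3/4 avoids showing that the supremum is attained. It is affordable because 2·(3/4)
  -- is still at least √2, as needed for `haL`.
  obtain ⟨μ, x, hμ, hx0, hx⟩ := exists_eigenvector_of_lt_lambdaMax (P := P)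
    (t := 3 / 4 * (ε * √Y)) (by positivity)
    (lt_of_lt_of_le (by nlinarith [mul_pos hεR hsY]) hlam)
  obtain ⟨sg, hsg, hsgμ⟩ : ∃ sg : ℤ, (sg = 1 ∨ sg = -1) ∧ (sg : ℝ) * μ = |μ| := by
    rcases le_or_gt 0 μ with h | h
    · exact ⟨1, Or.inl rfl, by rw [abs_of_nonneg h]; simp⟩
    · exact ⟨-1, Or.inr rfl, by rw [abs_of_neg h]; simp⟩
  have hsg2 : (sg : ℝ) ^ 2 = 1 := by rcases hsg with rfl | rfl <;> norm_num
  set H : Matrix (Fin n) (Fin n) ℝ := Matrix.of (hessian P) with hH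
  set L := 2 * |μ| with hL
  have hLε : 3 / 2 * (ε * √Y) ≤ L := by linarith
  have hL0 : 0 < L := lt_of_lt_of_le (by positivity) hLε
  set B : Matrix (Fin n) (Fin n) ℝ := (sg : ℝ) • H with hB
  have hBx : B *ᵥ x = L • x := by
    rw [hB, Matrix.smul_mulVec, hx, smul_smul, hL, ← hsgμ]
    congr 1; ring
  have hBs : B.IsSymm := by
    ext i j
    simp only [hB, hH, Matrix.transpose_apply, Matrix.smul_apply, Matrix.of_apply, hessian_symm P i j]
  have hBB : ∑ i, ∑ j, B i j ^ 2 = ∑ i, ∑ j, hessian P i j ^ 2 := by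
    simp only [hB, hH, Matrix.smul_apply, Matrix.of_apply, smul_eq_mul, mul_pow, hsg2, one_mul]
  set F := √(∑ i, ∑ j, hessian P i j ^ 2) with hFdef
  have hF2 : F ^ 2 = ∑ i, ∑ j, hessian P i j ^ 2 :=
    Real.sq_sqrt (Finset.sum_nonneg fun i _ => Finset.sum_nonneg fun j _ => sq_nonneg _)
  have hFY : F ^ 2 ≤ 2 * Y := by
    rw [hF2, hvar]
    have : 0 ≤ ∑ i, P.coeff (Finsupp.single i 1) ^ 2 := Finset.sum_nonneg fun i _ => sq_nonneg _
    linarith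
  have hFn : ∀ y, (B *ᵥ y) ⬝ᵥ (B *ᵥ y) ≤ F ^ 2 * (y ⬝ᵥ y) := fun y => by
    rw [hF2, ← hBB]; exact mulVec_dot_self_le B y
  have hLF : L ^ 2 ≤ F ^ 2 := by
    have h1 := hFn x
    have hxx : 0 < x ⬝ᵥ x := (dot_self_nonneg x).lt_of_ne fun h =>
      hx0 (dotProduct_self_eq_zero.1 h.symm)
    rw [hBx, smul_dotProduct, dotProduct_smul, smul_eq_mul, smul_eq_mul] at h1
    exact le_of_mul_le_mul_right (by linarith) hxx
  have hF0 : 0 < F := by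
    refine (Real.sqrt_nonneg _).lt_of_ne fun h => ?_
    rw [hFdef, ← h] at hLF
    nlinarith
  have hs : ((instOf p ε η).s : ℝ) = ∑ i, ∑ j, |B i j| := by
    have h1 := sum_range_mul_self n fun i j => |(instOf p ε η).B i j|
    rw [Inst.s, show (instOf p ε η).n = n from rfl, h1]
    push_cast
    have habs : |(sg : ℝ)| = 1 := by rcases hsg with rfl | rfl <;> simp
    simp only [hB, hH, Matrix.smul_apply, Matrix.of_apply, smul_eq_mul, abs_mul, habs, one_mul, hBij]
  have hsn : ((instOf p ε η).s : ℝ) ≤ n * F := by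
    rw [hs]
    refine abs_le_of_sq_le_sq' ?_ (by positivity) |>.2
    rw [mul_pow, hF2, ← hBB]
    exact sum_abs_sq_le B
  -- A positive integer is at least 1; this is where integrality of the coefficients enters.
  have hs1 : (1 : ℝ) ≤ (instOf p ε η).s := by
    have h0 : (0 : ℝ) < (instOf p ε η).s := by
      rw [hs]
      refine (Finset.sum_nonneg fun i _ => Finset.sum_nonneg fun j _ => abs_nonneg _).lt_of_ne
        fun h => ?_
      have h1 := abs_dot_mulVec_le_sum B x
      have hxx : 0 < x ⬝ᵥ x := (dot_self_nonneg x).lt_of_ne fun h =>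
        hx0 (dotProduct_self_eq_zero.1 h.symm)
      rw [← h, zero_mul, hBx, dotProduct_smul, smul_eq_mul, abs_of_pos (by positivity)] at h1
      nlinarith
    have : 0 < (instOf p ε η).s := by exact_mod_cast h0
    exact_mod_cast this
  -- From F ≤ √2 √Y ≤ (3/2) √Y = (1/ε)(3/2) ε √Y ≤ aL.
  have haL : F ≤ (instOf p ε η).a * L := by
    have h1 : 1 / (ε : ℝ) * (3 / 2 * (ε * √Y)) ≤ (instOf p ε η).a * L := by gcongr
    have h2 : 1 / (ε : ℝ) * (3 / 2 * (ε * √Y)) = 3 / 2 * √Y := by field_simp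
    refine le_trans (abs_le_of_sq_le_sq' ?_ (by positivity)).2 (h2 ▸ h1)
    nlinarith
  obtain ⟨i, k, hk, h⟩ := exists_good_iterate hBs hF0 hFn
    (fun y => by rw [hs]; exact abs_dot_mulVec_le_sum B y) hs1 hsn hx0 hBx hL0 hc1 haL
  obtain ⟨r, hr, hri, hrs⟩ : ∃ r < 2 * n, r / 2 = i ∧ roundSign r = sg := by
    have := i.2
    rcases hsg with rfl | rfl
    · exact ⟨2 * i + 1, by omega, by omega, by unfold roundSign; omega⟩
    · exact ⟨2 * i, by omega, by omega, by unfold roundSign; omega⟩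
  refine ⟨r, hr, k, lt_of_lt_of_eq hk ?_, ?_⟩
  · rw [Inst.K, show (instOf p ε η).n = n from rfl]; ring
  rw [hri, hrs]
  have hv : (fun j : Fin n => ((instOf p ε η).v i sg k j : ℝ)) =
      powSeq (((instOf p ε η).s : ℝ) • 1 + B) (((n * (84 * (instOf p ε η).a +
        9 * (instOf p ε η).c + 1) : ℕ) : ℝ) • Pi.single i 1) k := funext fun j => hcv i sg k j
  simp only [← hv] at h
  set v := (instOf p ε η).v i sg k
  set xv : Fin n → ℝ := fun j => (v j : ℝ) with hxv
  have hlen := len_bounds (I := instOf p ε η) (v := v) (x := xv) hxv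
  set N := (instOf p ε η).len v
  obtain ⟨hu, h1, h2⟩ := h N (Nat.cast_nonneg _) hlen.1 hlen.2
  have hw1 := reflVec_dot_self hu
  set w := reflVec xv N i with hw
  have e1 : (B *ᵥ w) ⬝ᵥ (B *ᵥ w) = (H *ᵥ w) ⬝ᵥ (H *ᵥ w) := by
    rw [hB, Matrix.smul_mulVec, smul_dotProduct, dotProduct_smul, smul_smul, ← pow_two, hsg2,
      one_smul]
  have e2 : (w ⬝ᵥ B *ᵥ w) ^ 2 = (w ⬝ᵥ H *ᵥ w) ^ 2 := by
    rw [hB, Matrix.smul_mulVec, dotProduct_smul, smul_eq_mul, mul_pow, hsg2, one_mul]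
  refine acc_of_reflVec (p := p) hε hη (x := xv) hxv rfl rfl hw hu hH ?_ ?_
  · rw [← e1, ← e2, hVv]
    have hX : 0 ≤ (B *ᵥ w) ⬝ᵥ (B *ᵥ w) - (w ⬝ᵥ B *ᵥ w) ^ 2 := by
      have := dot_sq_le w (B *ᵥ w)
      rw [hw1, one_mul] at this
      linarith
    exact residual_le hηR hc hX h1 hFY
  · rw [← e2, hVv]
    exact eigenvalue_sq_ge hεR hY hLε hLF hFY h2

end

end GaussDecomp

/-! ### The case of zero variance, and the final form of the time bound. -/

namespace GaussDecomp

section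

variable {n : ℕ} {p : MvPolynomial (Fin n) ℤ} {ε η : ℚ}

/-- If the variance vanishes, then the trivial decomposition has the required properties. -/
theorem isGood_readOutput_of_var_eq_zero (hp : p.totalDegree ≤ 2) (hp0 : p.coeff 0 = 0)
    (hV : polyVar (p.map (Int.castRingHom ℝ)) ≤ 0) {σ : Store} (h3 : σ 3 0 0 = 1)
    (h3' : ∀ i j, (i, j) ≠ (0, 0) → σ 3 i j = 0) (h4 : ∀ i j, σ 4 i j = 0 ∧ σ 5 i j = 0) :
    (readOutput n σ).IsGood (p.map (Int.castRingHom ℝ)) ε η := by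
  refine ⟨_, _, _, readOutput_eq (by rw [h3]; exact one_ne_zero), ?_⟩
  have h2 := polyVar_eq_hessian (totalDegree_map_le_two hp)
  have hpe := eq_quadPoly (totalDegree_map_le_two hp)
  have hV0 : 0 ≤ polyVar (p.map (Int.castRingHom ℝ)) := variance_nonneg _ _
  have hp0' : (p.map (Int.castRingHom ℝ)).coeff 0 = 0 := by
    rw [MvPolynomial.coeff_map, hp0, map_zero]
  generalize p.map (Int.castRingHom ℝ) = P at *
  have hA (i j : Fin n) : hessian P i j = 0 := by
    have h1 : 0 ≤ ∑ i, P.coeff (Finsupp.single i 1) ^ 2 := Finset.sum_nonneg fun i _ => sq_nonneg _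
    have h5 : hessian P i j ^ 2 ≤ ∑ i, ∑ j, hessian P i j ^ 2 :=
      (Finset.single_le_sum (f := fun j => hessian P i j ^ 2) (fun j _ => sq_nonneg _)
        (Finset.mem_univ j)).trans (Finset.single_le_sum (f := fun i => ∑ j, hessian P i j ^ 2)
        (fun i _ => Finset.sum_nonneg fun j _ => sq_nonneg _) (Finset.mem_univ i))
    exact pow_eq_zero_iff two_ne_zero |>.1 (le_antisymm (by linarith) (sq_nonneg _))
  have hb (i : Fin n) : P.coeff (Finsupp.single i 1) = 0 := by
    have h1 : 0 ≤ ∑ i, ∑ j, hessian P i j ^ 2 :=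
      Finset.sum_nonneg fun i _ => Finset.sum_nonneg fun j _ => sq_nonneg _
    have h5 : P.coeff (Finsupp.single i 1) ^ 2 ≤ ∑ i, P.coeff (Finsupp.single i 1) ^ 2 :=
      Finset.single_le_sum (f := fun i => P.coeff (Finsupp.single i 1) ^ 2)
        (fun i _ => sq_nonneg _) (Finset.mem_univ i)
    exact pow_eq_zero_iff two_ne_zero |>.1 (le_antisymm (by linarith) (sq_nonneg _))
  have hA' (i j : Fin n) : P.coeff (pairExp i j) = 0 := by
    have := hA i j
    unfold hessian at this
    split_ifs at this
    · linarith
    · exact this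
  have hP : P = 0 := by
    rw [hpe, hp0']
    simp [quadPoly, hA', hb]
  have hq : quadPoly (fun i j : Fin (n + 1) => (σ 4 i j : ℚ) / σ 3 0 0)
      (fun i : Fin (n + 1) => (σ 5 i 0 : ℚ) / σ 3 0 0) ((σ 3 3 0 : ℚ) / σ 3 0 0) = 0 := by
    simp [quadPoly, h4, h3' 3 0 (by decide)]
  have hres : residue (Pi.single 0 1) (0 : MvPolynomial (Fin (n + 1)) ℝ) = 0 := by
    simp [residue, splitAlong]
  have hvar {m : ℕ} : polyVar (0 : MvPolynomial (Fin m) ℝ) = 0 := by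
    simp only [polyVar, map_zero]
    exact variance_zero _
  have hlaw {m : ℕ} : law (0 : MvPolynomial (Fin m) ℝ) = Measure.dirac 0 := by
    simp only [law, map_zero]
    rw [Measure.map_const, measure_univ, one_smul]
  rw [hq, hP, h3' 1 0 (by decide), h3' 2 0 (by decide)]
  constructor <;> simp [hres, hvar, hlaw]

end

/-- Convexity of the k-th power, (x + y)^k ≤ 2^(k-1) (x^k + y^k), separates the bit lengths of ε and
η from the other parameters. The two roundings a ≤ e + 1 and c ≤ h + 1 are absorbed in the factor 3.
-/
theorem exists_time_const (D k : ℕ) : ∃ C : ℕ, ∀ {n b a c q q' t : ℕ} {e h : ℚ},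
    t ≤ D * (n + b + a + c + (q + q') + 1) ^ k → (a : ℚ) ≤ e + 1 → (c : ℚ) ≤ h + 1 →
    0 < e → 0 < h → (t : ℚ) ≤ C * (n + b + e + h + 1) ^ k + C * (q + q' : ℚ) ^ k := by
  refine ⟨D * 2 ^ (k - 1) * 3 ^ k, fun {n b a c q q' t e h} ht ha hc he hh => ?_⟩
  obtain ⟨X, hX⟩ : ∃ X : ℚ, X = n + b + e + h + 1 := ⟨_, rfl⟩
  obtain ⟨Y, hY⟩ : ∃ Y : ℚ, Y = q + q' := ⟨_, rfl⟩
  rw [← hX, ← hY]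
  have hX0 : 0 ≤ X := by rw [hX]; positivity
  have hY0 : 0 ≤ Y := by rw [hY]; positivity
  have hZX : ((n + b + a + c + (q + q') + 1 : ℕ) : ℚ) ≤ 3 * X + Y := by
    push_cast
    have h1 : (0 : ℚ) ≤ n := Nat.cast_nonneg _
    have h2 : (0 : ℚ) ≤ b := Nat.cast_nonneg _
    linarith
  calc (t : ℚ) ≤ ((D * (n + b + a + c + (q + q') + 1) ^ k : ℕ) : ℚ) := Nat.cast_le.2 ht
    _ = D * ((n + b + a + c + (q + q') + 1 : ℕ) : ℚ) ^ k := by rw [Nat.cast_mul, Nat.cast_pow]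
    _ ≤ D * (3 * X + Y) ^ k := by gcongr
    _ ≤ D * (2 ^ (k - 1) * ((3 * X) ^ k + Y ^ k)) := by
      gcongr
      exact add_pow_le (by positivity) hY0 k
    _ = D * 2 ^ (k - 1) * 3 ^ k * X ^ k + D * 2 ^ (k - 1) * 1 * Y ^ k := by
      rw [mul_pow]; ring
    _ ≤ D * 2 ^ (k - 1) * 3 ^ k * X ^ k + D * 2 ^ (k - 1) * 3 ^ k * Y ^ k := by
      gcongr
      exact one_le_pow₀ (by norm_num)
    _ = _ := by push_cast; ring

/-- The running time is polynomial. -/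
theorem exists_time_le : ∃ C k : ℕ, ∀ {n b : ℕ} {p : MvPolynomial (Fin n) ℤ} {ε η : ℚ},
    (∀ m, |p.coeff m| < 2 ^ b) → 0 < ε → 0 < η → ∃ (t : ℕ) (σ : Store),
      Exec decomposeCmd (inputStore p ε η) t σ ∧
      (t : ℚ) ≤ C * (n + b + 1 / ε + 1 / η + 1) ^ k + C * (ratBits ε + ratBits η : ℚ) ^ k ∧
      ((instOf p ε η).V ≤ 0 → σ 3 0 0 = 1 ∧ (∀ i j, (i, j) ≠ (0, 0) → σ 3 i j = 0) ∧
        ∀ i j, σ 4 i j = 0 ∧ σ 5 i j = 0) ∧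
      (0 < (instOf p ε η).V → (instOf p ε η).OutInv σ ∧
        ((∃ r < 2 * n, ∃ k < (instOf p ε η).K,
          (instOf p ε η).Acc ((instOf p ε η).v (r / 2) (roundSign r) k) (r / 2)) →
          σ 3 0 0 ≠ 0)) := by
  obtain ⟨D, k, hDk⟩ := time_le
  obtain ⟨C, hC⟩ := exists_time_const D k
  refine ⟨C, k, fun {n b p ε η} hpb hε hη => ?_⟩
  obtain ⟨t, σ, hexec, ht, h⟩ := exists_exec hpb hε hη
  have h1 := hDk n b (instOf p ε η).a (instOf p ε η).c (ratBits ε + ratBits η) _ le_rfl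
  rw [inputBound, Inst.K, add_assoc (n * n + b)] at ht
  exact ⟨t, σ, hexec, hC (ht.trans h1) (div_add_one_le hε) (div_add_one_le hη) (by positivity)
    (by positivity), h⟩

end GaussDecomp

theorem theorem2p2 :
    ∃ (prog : GaussDecomp.Cmd) (C k : ℕ),
      ∀ (n b : ℕ) (p : MvPolynomial (Fin n) ℤ) (ε η : ℚ),
        p.totalDegree ≤ 2 → p.coeff 0 = 0 → (∀ m, |p.coeff m| < 2 ^ b) → 0 < ε → 0 < η →
        ∃ (t : ℕ) (σ : GaussDecomp.Store),
          GaussDecomp.Exec prog (GaussDecomp.inputStore p ε η) t σ ∧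
          (t : ℚ) ≤ C * (n + b + 1 / ε + 1 / η + 1) ^ k
            + C * (GaussDecomp.ratBits ε + GaussDecomp.ratBits η : ℚ) ^ k ∧
          (ε * √(GaussDecomp.polyVar (p.map (Int.castRingHom ℝ))) ≤
              GaussDecomp.lambdaMax (p.map (Int.castRingHom ℝ)) →
            (GaussDecomp.readOutput n σ).IsGood (p.map (Int.castRingHom ℝ)) ε η) ∧
          (GaussDecomp.lambdaMax (p.map (Int.castRingHom ℝ)) <
              ε * √(GaussDecomp.polyVar (p.map (Int.castRingHom ℝ))) →
            GaussDecomp.readOutput n σ = .smallMaxEigenvalue ∨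
              (GaussDecomp.readOutput n σ).IsGood (p.map (Int.castRingHom ℝ)) ε η) := by
  open GaussDecomp in
  obtain ⟨C, k, hC⟩ := exists_time_le
  refine ⟨decomposeCmd, C, k, fun n b p ε η hp hp0 hpb hε hη => ?_⟩
  obtain ⟨t, σ, hexec, ht, hV0, hV⟩ := hC hpb hε hη
  have hVv := cast_V_eq (ε := ε) (η := η) hp
  refine ⟨t, σ, hexec, ht, ?_⟩
  -- With positive variance, any nonzero denominator certifies a good output, which settles (b); for
  -- (a), `exists_acc` ensures that the denominator is nonzero.
  rcases le_or_gt (instOf p ε η).V 0 with h | h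
  · obtain ⟨h3, h3', h4⟩ := hV0 h
    have hgood := isGood_readOutput_of_var_eq_zero (ε := ε) (η := η) hp hp0 (by
      have : ((instOf p ε η).V : ℝ) ≤ 0 := by exact_mod_cast h
      linarith) h3 h3' h4
    exact ⟨fun _ => hgood, fun _ => Or.inr hgood⟩
  · obtain ⟨hout, hacc⟩ := hV h
    refine ⟨fun hlam => isGood_readOutput hp hp0 hε hη hout (hacc (exists_acc hp hε hη h hlam)),
      fun _ => ?_⟩
    rcases eq_or_ne (σ 3 0 0) 0 with h3 | h3
    · exact Or.inl (if_pos h3)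
    · exact Or.inr (isGood_readOutput hp hp0 hε hη hout h3)
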